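/- **Setting.** Let $T>0$, let $C_0[0,T]$ be the space of real continuous functions on $[0,T]$ vanishing at $0$, and let $\mathfrak m$ be Wiener measure on it. A property of $y\in C_0[0,T]$ holds *s-a.e.* if for every $\rho>0$ it holds at $\rho y$ for $\mathfrak m$-a.e. $y$; a functional $F:C_0[0,T]\to\mathbb C$ is *scale-invariant measurable* if $F(\rho\,\cdot)$ is Wiener measurable for all $\rho>0$. Fix a complete orthonormal set $\{\varphi_j\}_{j\ge 0}$ of $L_2[0,T]$ consisting of functions of bounded variation, let $\langle u,x\rangle=\lim_{n}\sum_{j<n}(u,\varphi_j)_2\int_0^T\varphi_j\,dx$ be the Paley–Wiener–Zygmund integral, and let $\mathcal Z_h(x,t)=\langle h\mathbf 1_{[0,t]},x\rangle$, which for $h\in L_\infty[0,T]$ is for $\mathfrak m$-a.e. $x$ defined for all $t$ and continuous in $t$. Let $\mathbb C_+=\{\operatorname{Re}\lambda>0\}$. *Analytic integrals.* If $J(\lambda)=\int \Psi(\lambda^{-1/2},x)\,d\mathfrak m(x)$ exists for all $\lambda>0$ and extends to an analytic function $J^*$ on $\mathbb C_+$, then $J^*(\lambda)$ is the analytic Wiener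 integral $\int^{\mathrm{anw}_\lambda}$, and for real $q\neq0$ the analytic Feynman integral $\int^{\mathrm{anf}_q}$ is $\lim J^*(\lambda)$ as $\lambda\to-iq$ in $\mathbb C_+$, if it exists. Integrands are written below at $\lambda=1$; $\Psi(c,x)$ is obtained by multiplying each path $\mathcal Z_h(x,\cdot)$ in it by $c$. *Transform.* Let $T_{\lambda,h}(F)(y)=\int^{\mathrm{anw}_\lambda}F(y+\mathcal Z_h(x,\cdot))\,d\mathfrak m(x)$ (for s-a.e. $y$). Then $T^{(1)}_{q,h}(F)(y)=\lim T_{\lambda,h}(F)(y)$ for s-a.e. $y$, and for $1<p\le2$, $T^{(p)}_{q,h}(F)$ is the functional with $\int|T_{\lambda,h}(F)(\rho y)-T^{(p)}_{q,h}(F)(\rho y)|^{p'}d\mathfrak m(y)\to0$ for every $\rho>0$, where $1/p+1/p'=1$; the limits are taken as $\lambda\to-iq$ in $\mathbb C_+$. The transform is determined s-a.e. *Convolution product.* $(F*G)_q^{(h_1,h_2)}(y)=\int^{\mathrm{anf}_q}F\big(\tfrac{y+\mathcal Z_{h_1}(x,\cdot)}{\sqrt2}\big)G\big(\tfrac{y-\mathcal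 Z_{h_2}(x,\cdot)}{\sqrt2}\big)d\mathfrak m(x)$. *The class $\mathcal S(L_2[0,T])$.* It consists of the functionals $F$ for which there is a complex Borel measure $f$ on $L_2[0,T]$ such that $F(x)=\int\exp\{i\langle u,x\rangle\}\,df(u)$ at every $x$ for which $\langle u,x\rangle$ exists for $|f|$-a.e. $u$ (which is the case for s-a.e. $x$; elsewhere $F$ is arbitrary). In an iterated transform each transform is taken to be an element of $\mathcal S(L_2[0,T])$. **Theorem 5.3.** Let $F,G\in\mathcal S(L_2[0,T])$, let $h$ be a nonzero function in $L_\infty[0,T]$, and let $\mathcal K_1=\{k_{11},\dots,k_{1n}\}$ and $\mathcal K_2=\{k_{21},\dots,k_{2m}\}$ be finite sequences of nonzero functions in $L_\infty[0,T]$. Let $\mathbf s_1=\mathbf s(\mathcal K_1)$ and $\mathbf s_2=\mathbf s(\mathcal K_2)$ be functions in $L_\infty[0,T]$ with $\mathbf s_1^2=\sum_jk_{1j}^2$ and $\mathbf s_2^2=\sum_jk_{2j}^2$ a.e., and assume that $h^2=\mathbf s_1\mathbf s_2$ a.e. on $[0,T]$. Let $\mathbf r_1=\mathbf s(h,\mathbf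 s_1)$ and $\mathbf r_2=\mathbf s(h,\mathbf s_2)$ be functions in $L_\infty[0,T]$ with $\mathbf r_j^2=h^2+\mathbf s_j^2$ a.e. Then for all $p\in[1,2]$ and all real $q\ne0$, all transforms and convolution products below exist (the transforms in $\mathcal S(L_2[0,T])$), and for s-a.e. $y\in C_0[0,T]$ $$\begin{aligned} &\Big(T^{(p)}_{q,h/\sqrt2}\big(T^{(p)}_{q,k_{1n}/\sqrt2}(\cdots T^{(p)}_{q,k_{11}/\sqrt2}(F)\cdots)\big)*T^{(p)}_{q,h/\sqrt2}\big(T^{(p)}_{q,k_{2m}/\sqrt2}(\cdots T^{(p)}_{q,k_{21}/\sqrt2}(G)\cdots)\big)\Big)^{(\mathbf s_1,\mathbf s_2)}_{-q}(y)\\ &=\Big(T^{(p)}_{q,h/\sqrt2}\big(T^{(p)}_{q,\mathbf s_1/\sqrt2}(F)\big)*T^{(p)}_{q,h/\sqrt2}\big(T^{(p)}_{q,\mathbf s_2/\sqrt2}(G)\big)\Big)^{(\mathbf s_1,\mathbf s_2)}_{-q}(y)\\ &=\Big(T^{(p)}_{q,\mathbf r_1/\sqrt2}(F)*T^{(p)}_{q,\mathbf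 r_2/\sqrt2}(G)\Big)^{(\mathbf s_1,\mathbf s_2)}_{-q}(y)\\ &=T^{(p)}_{q,h}\Big(F\big(\tfrac{\cdot}{\sqrt2}\big)G\big(\tfrac{\cdot}{\sqrt2}\big)\Big)(y). \end{aligned}$$ -/

import Mathlib

open MeasureTheory ProbabilityTheory Filter Topology
open scoped ENNReal

noncomputable section

namespace WienerGFFT

/-- Lebesgue measure on `[0,T]`. -/
abbrev leb (T : ℝ) : Measure ℝ := volume.restrict (Set.Icc 0 T)

/-- The real Hilbert space `L₂[0,T]`, with its Borel σ-algebra. -/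
abbrev L2 (T : ℝ) : Type := Lp ℝ 2 (leb T)

instance instMeasurableSpaceL2 (T : ℝ) : MeasurableSpace (L2 T) := borel _

instance instBorelSpaceL2 (T : ℝ) : BorelSpace (L2 T) := ⟨rfl⟩

/-- The function `k` on `[0,T]` is a nonzero element of `L_∞[0,T]`. -/
def NonzeroLinfty (T : ℝ) (k : ℝ → ℝ) : Prop :=
  MemLp k ∞ (leb T) ∧ ¬ k =ᵐ[leb T] 0

/-- Wiener space `C₀[0,T]`: the real continuous functions on `[0,T]` that vanish at `0`,
with the uniform topology and its Borel σ-algebra. -/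
def C0 (T : ℝ) : Submodule ℝ C(Set.Icc (0 : ℝ) T, ℝ) where
  carrier := {x | ∀ t : Set.Icc (0 : ℝ) T, (t : ℝ) = 0 → x t = 0}
  add_mem' {x y} hx hy t ht := by simp [hx t ht, hy t ht]
  zero_mem' t ht := by simp
  smul_mem' c x hx t ht := by simp [hx t ht]

instance instMeasurableSpaceC0 (T : ℝ) : MeasurableSpace (C0 T) := borel _

instance instBorelSpaceC0 (T : ℝ) : BorelSpace (C0 T) := ⟨rfl⟩

/-- `m` is Wiener measure on `C₀[0,T]`: a probability measure under which the coordinate process is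
a centred Gaussian process with covariance `min s t`. This determines `m`; completing `m` is
accounted for by using almost everywhere measurability below. -/
structure IsWienerMeasure (T : ℝ) (m : Measure (C0 T)) : Prop where
  isProbabilityMeasure : IsProbabilityMeasure m
  isGaussianProcess : IsGaussianProcess (fun (t : Set.Icc (0 : ℝ) T) (x : C0 T) => x.1 t) m
  mean (t : Set.Icc (0 : ℝ) T) : ∫ x : C0 T, x.1 t ∂m = 0
  covariance (s t : Set.Icc (0 : ℝ) T) :
    cov[fun x : C0 T => x.1 s, fun x : C0 T => x.1 t; m] = min (s : ℝ) (t : ℝ)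

section PWZ

variable {T : ℝ} [hT : Fact (0 < T)]

/-- The value at a real time of a path in `C₀[0,T]` (constant extension outside `[0,T]`). -/
def ev (x : C0 T) (t : ℝ) : ℝ := x.1 (Set.projIcc 0 T hT.out.le t)

/-- The Riemann–Stieltjes integral `∫₀ᵀ φ dx` of a function `φ` of bounded variation with respect
to a continuous path `x`. It exists, so it is the limit of the sums over the uniform partitions. -/
def rsIntegral (φ : ℝ → ℝ) (x : C0 T) : ℝ :=
  limUnder atTop fun n : ℕ => ∑ i ∈ Finset.range n,
    φ (i * T / n) * (ev x ((i + 1 : ℕ) * T / n) - ev x (i * T / n))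

variable (T) in
/-- `φ₀, φ₁, …` is a complete orthonormal set in `L₂[0,T]` of functions of bounded variation. -/
structure IsBVBasis (φ : ℕ → ℝ → ℝ) : Prop where
  boundedVariation (j : ℕ) : BoundedVariationOn (φ j) (Set.Icc 0 T)
  orthonormal (i j : ℕ) : ∫ t, φ i t * φ j t ∂(leb T) = if i = j then 1 else 0
  complete (u : ℝ → ℝ) : MemLp u 2 (leb T) → (∀ j, ∫ t, u t * φ j t ∂(leb T) = 0) →
    u =ᵐ[leb T] 0

/-- The Paley–Wiener–Zygmund integral `∫₀ᵀ u d̃x`, formed with the system `φ`, exists and is `a`: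
`a = lim_n ∑_{j < n} (u, φ_j) ∫₀ᵀ φ_j dx`. -/
def HasPWZ (φ : ℕ → ℝ → ℝ) (u : ℝ → ℝ) (x : C0 T) (a : ℝ) : Prop :=
  Tendsto (fun n : ℕ => ∑ j ∈ Finset.range n, (∫ t, u t * φ j t ∂(leb T)) * rsIntegral (φ j) x)
    atTop (𝓝 a)

open Classical in
/-- The Paley–Wiener–Zygmund integral `⟨u,x⟩ = ∫₀ᵀ u d̃x` (`0` where it does not exist). -/
def pwz (φ : ℕ → ℝ → ℝ) (u : ℝ → ℝ) (x : C0 T) : ℝ :=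
  if h : ∃ a, HasPWZ φ u x a then h.choose else 0

open Classical in
/-- The path of the Gaussian process `Z_h(x,t) = ∫₀ᵗ h d̃x`, as an element of `C₀[0,T]` (the zero
path for those `x` for which these integrals do not exist for all `t` or are not continuous
in `t`). -/
def gaussPath (φ : ℕ → ℝ → ℝ) (h : ℝ → ℝ) (x : C0 T) : C0 T :=
  if hw : ∃ w : C0 T, ∀ t : Set.Icc (0 : ℝ) T,
      HasPWZ φ ((Set.Icc 0 (t : ℝ)).indicator h) x (w.1 t)
  then hw.choose else 0

end PWZ

section Transform

variable {T : ℝ}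

/-- `P` holds scale-invariant almost everywhere. -/
def SAE (m : Measure (C0 T)) (P : C0 T → Prop) : Prop :=
  ∀ ρ : ℝ, 0 < ρ → ∀ᵐ y ∂m, P (ρ • y)

/-- `F` is a scale-invariant measurable functional. -/
def SIMeasurable (m : Measure (C0 T)) (F : C0 T → ℂ) : Prop :=
  ∀ ρ : ℝ, 0 < ρ → AEStronglyMeasurable (fun x : C0 T => F (ρ • x)) m

/-- The open right half-plane. -/
def rightHalf : Set ℂ := {z | 0 < z.re}

/-- `J` is the generalized analytic Wiener integral `λ ↦ ∫^{anw_λ} Ψ 1 x dm(x)`, where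
`Ψ c x` is the integrand with the Gaussian paths in it multiplied by `c`: for `λ > 0` the integral
of `Ψ (λ^{-1/2})` exists and is `J λ`, and `J` is analytic on the open right half-plane. -/
structure HasAnalyticWiener (m : Measure (C0 T)) (Ψ : ℝ → C0 T → ℂ) (J : ℂ → ℂ) : Prop where
  integrable (l : ℝ) : 0 < l → Integrable (Ψ (Real.sqrt l)⁻¹) m
  eq_integral (l : ℝ) : 0 < l → J (l : ℂ) = ∫ x, Ψ (Real.sqrt l)⁻¹ x ∂m
  analytic : DifferentiableOn ℂ J rightHalf

/-- Approach `λ → -iq` through the open right half-plane. -/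
def toFeynman (q : ℝ) : Filter ℂ := 𝓝[rightHalf] (-(Complex.I * q))

/-- The generalized analytic Feynman integral with parameter `q` exists and is `a`. -/
def HasAnalyticFeynman (m : Measure (C0 T)) (Ψ : ℝ → C0 T → ℂ) (q : ℝ) (a : ℂ) : Prop :=
  ∃ J : ℂ → ℂ, HasAnalyticWiener m Ψ J ∧ Tendsto J (toFeynman q) (𝓝 a)

variable [hT : Fact (0 < T)]

/-- `H` is (a version of) the `L_p` analytic generalized Fourier–Feynman transform
`T^{(p)}_{q,h}(F)`, for `1 ≤ p ≤ 2`. Here `Tl l` is `T_{λ,h}(F)` for `λ = l`. -/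
def IsGFFT (m : Measure (C0 T)) (φ : ℕ → ℝ → ℝ) (p q : ℝ) (h : ℝ → ℝ) (F H : C0 T → ℂ) : Prop :=
  SIMeasurable m F ∧ SIMeasurable m H ∧
  ∃ Tl : ℂ → C0 T → ℂ,
    (∀ l ∈ rightHalf, SIMeasurable m (Tl l)) ∧
    SAE m (fun y => HasAnalyticWiener m (fun c x => F (y + c • gaussPath φ h x))
      (fun l => Tl l y)) ∧
    (p = 1 → SAE m (fun y => Tendsto (fun l => Tl l y) (toFeynman q) (𝓝 (H y)))) ∧
    (1 < p → ∀ ρ : ℝ, 0 < ρ →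
      Tendsto (fun l => ∫⁻ y, ‖Tl l (ρ • y) - H (ρ • y)‖ₑ ^ (p / (p - 1)) ∂m)
        (toFeynman q) (𝓝 0))

/-- The generalized convolution product `(F * G)_q^{(h₁,h₂)}` exists s-a.e. and is s-a.e. equal
to `H`. -/
def IsGCP (m : Measure (C0 T)) (φ : ℕ → ℝ → ℝ) (q : ℝ) (h₁ h₂ : ℝ → ℝ) (F G H : C0 T → ℂ) :
    Prop :=
  SIMeasurable m F ∧ SIMeasurable m G ∧
  SAE m (fun y => HasAnalyticFeynman m
    (fun c x => F ((Real.sqrt 2)⁻¹ • (y + c • gaussPath φ h₁ x)) *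
      G ((Real.sqrt 2)⁻¹ • (y - c • gaussPath φ h₂ x))) q (H y))

/-- `F` belongs to `S(L₂[0,T])`: for a complex Borel measure `f` on `L₂[0,T]`,
`F(x) = ∫ exp{i⟨u,x⟩} df(u)` at every `x` at which the integrand is defined, that is, for which
`⟨u,x⟩` exists for almost every `u` with respect to the total variation of `f`. (This is the case
for s-a.e. `x`; at the other `x` the value of `F` is arbitrary.) -/
def MemS (φ : ℕ → ℝ → ℝ) (F : C0 T → ℂ) : Prop :=
  ∃ f : ComplexMeasure (L2 T), ∀ x : C0 T,
    (∀ᵐ u : L2 T ∂f.variation, ∃ a, HasPWZ φ (u : ℝ → ℝ) x a) →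
    F x = ∫ᵛ u : L2 T, Complex.exp (Complex.I * (pwz φ (u : ℝ → ℝ) x : ℂ))
      ∂[ContinuousLinearMap.mul ℝ ℂ; f]

/-- `A` is the iterated transform `T_{q,h_n}(⋯(T_{q,h_1}(F))⋯)` for the list `[h_1, …, h_n]`
(head applied first), each transform being taken as an element of `S(L₂[0,T])`. -/
def IsIterGFFT (m : Measure (C0 T)) (φ : ℕ → ℝ → ℝ) (p q : ℝ) :
    List (ℝ → ℝ) → (C0 T → ℂ) → (C0 T → ℂ) → Prop
  | [], F, A => A = F
  | k :: ks, F, A => ∃ H : C0 T → ℂ, MemS φ H ∧ IsGFFT m φ p q k F H ∧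
      IsIterGFFT m φ p q ks H A

/-- The iterated transforms of `F` along the kernels `L₁` and of `G` along the kernels `L₂` exist
in `S(L₂[0,T])`, and the convolution product `( · * · )_{q'}^{(h₁,h₂)}` of these exists and is
s-a.e. equal to `C`. -/
def GCPOfIterGFFT (m : Measure (C0 T)) (φ : ℕ → ℝ → ℝ) (p q q' : ℝ) (h₁ h₂ : ℝ → ℝ)
    (L₁ L₂ : List (ℝ → ℝ)) (F G C : C0 T → ℂ) : Prop :=
  (∃ A, IsIterGFFT m φ p q L₁ F A) ∧ (∃ B, IsIterGFFT m φ p q L₂ G B) ∧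
  ∀ A B, IsIterGFFT m φ p q L₁ F A → IsIterGFFT m φ p q L₂ G B → IsGCP m φ q' h₁ h₂ A B C

end Transform

end WienerGFFT

end

/-! A functional in `S(L₂[0,T])` is a superposition `F(x) = ∫ exp(i⟨u,x⟩) df(u)`, so each operation
can be followed through its effect on the frequency `u` and on the density. For almost every `x` one
has `⟨u, Z_h(x,·)⟩ = ⟨hu, x⟩` (`ae_hasPWZ_comp_gaussPath`), and `⟨hu,·⟩` is centred Gaussian with
variance `‖hu‖²` (`map_pwz`). Hence `T_{λ,h}` multiplies the density by `exp(-‖hu‖²/(2λ))`, which is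
analytic in `λ` and at `λ = -iq` becomes the unimodular factor `exp(-(i/2q) ∫ h²u²)`. An iterated
transform therefore sees only the sum of the squares of its kernels, which is why the three
convolution products agree.

The convolution product with parameter `-q` runs over pairs `(u,v)`, has frequency `(u+v)/√2`, and
contributes the factor `exp(+(i/2q) ‖(s₁u - s₂v)/√2‖²)`. The transform of `F(·/√2) G(·/√2)` has the
same frequency and the exponent of `‖h(u+v)/√2‖²`. The two match because `½∫(h²+s₁²)u² +
½∫(h²+s₂²)v² - ½∫(s₁u - s₂v)² = ½∫h²(u+v)²`, the cross terms agreeing since `s₁s₂ = h²`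
(`norm_halfDiff_add`).

Two points need work. The Paley–Wiener–Zygmund integral is the limit of one fixed series, so its
existence and that of the continuous paths of `Z_h` must be proved for that series. Gaussian fourth
moments are multiples of squared variances, so the maximal inequality
`lintegral_sup_edist_pow_four_le` applies, once in the number of terms and once more in time
(`ae_uniform_oscillation`).

Secondly, a transform is determined only s-a.e., while the next operation evaluates it on paths `y +
c Z_h(x,·)`, whose law need not be absolutely continuous with respect to a scaled Wiener measure.
Membership in `S(L₂[0,T])` is therefore used pointwise, on a linear set of paths (`PWZDomain`), and
the representing measure is recovered from almost everywhere values (`MemS.isPWZRep_of_ae_eq`),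
since a complex measure on a separable Hilbert space is determined by its Gaussian convolutions. -/

set_option linter.unusedSectionVars false

noncomputable section

namespace WienerGFFT

/-! ### Riemann–Stieltjes integrals against continuous paths. -/

section RiemannStieltjes

/-- The Riemann–Stieltjes sum of `ψ` along `x` over the uniform partition into `n` intervals. -/
def rsSum {T : ℝ} [Fact (0 < T)] (ψ : ℝ → ℝ) (n : ℕ) (x : C0 T) : ℝ :=
  ∑ i ∈ Finset.range n, ψ (i * T / n) * (ev x ((i + 1 : ℕ) * T / n) - ev x (i * T / n))

/-- Abel summation: it moves the differences from the path to the integrand, where bounded variation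
controls them. -/
lemma sum_sub_mul_sub_eq (a b : ℕ → ℝ) (m : ℕ) :
    ∑ k ∈ Finset.range m, (a k - a 0) * (b (k + 1) - b k) =
      ∑ k ∈ Finset.range m, (a (k + 1) - a k) * (b m - b (k + 1)) := by
  have h1 : ∀ m : ℕ, ∑ k ∈ Finset.range m, (a k - a 0) * (b (k + 1) - b k) =
      (a m - a 0) * b m - ∑ k ∈ Finset.range m, (a (k + 1) - a k) * b (k + 1) := by
    intro m
    induction m with
    | zero => simp
    | succ m ih => rw [Finset.sum_range_succ, Finset.sum_range_succ, ih]; ring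
  rw [h1, ← Finset.sum_range_sub a m, Finset.sum_mul, ← Finset.sum_sub_distrib]
  exact Finset.sum_congr rfl fun k _ => by ring

lemma abs_sum_sub_mul_sub_le (a b : ℕ → ℝ) (m : ℕ) (w : ℝ)
    (hw : ∀ k ≤ m, |b m - b k| ≤ w) :
    |∑ k ∈ Finset.range m, (a k - a 0) * (b (k + 1) - b k)| ≤
      w * ∑ k ∈ Finset.range m, |a (k + 1) - a k| := by
  rw [sum_sub_mul_sub_eq, Finset.mul_sum]
  refine (Finset.abs_sum_le_sum_abs _ _).trans (Finset.sum_le_sum fun k hk => ?_)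
  rw [abs_mul, mul_comm]
  have := hw (k + 1) (Finset.mem_range.1 hk)
  gcongr

lemma sum_range_mul_eq {M : Type*} [AddCommMonoid M] (f : ℕ → M) (n m : ℕ) :
    ∑ j ∈ Finset.range (n * m), f j =
      ∑ i ∈ Finset.range n, ∑ k ∈ Finset.range m, f (i * m + k) := by
  induction n with
  | zero => simp
  | succ n ih => rw [Nat.add_mul, one_mul, Finset.sum_range_add, ih, Finset.sum_range_succ]

variable {T : ℝ} [hT : Fact (0 < T)]

lemma grid_mem {n i : ℕ} (hi : i ≤ n) : (i : ℝ) * T / n ∈ Set.Icc (0 : ℝ) T := by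
  have h0 := hT.out.le
  rcases Nat.eq_zero_or_pos n with rfl | hn
  · simpa using h0
  have hn' : (0 : ℝ) < n := by exact_mod_cast hn
  refine ⟨by positivity, ?_⟩
  rw [div_le_iff₀ hn', mul_comm]
  have : (i : ℝ) ≤ n := by exact_mod_cast hi
  gcongr

lemma uniformContinuous_ev (x : C0 T) : UniformContinuous (ev x) :=
  (CompactSpace.uniformContinuous_of_continuous x.1.continuous).comp
    (LipschitzWith.projIcc hT.out.le).uniformContinuous

lemma continuous_ev_left (t : ℝ) : Continuous fun x : C0 T => ev x t :=
  (continuous_eval_const _).comp continuous_subtype_val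

@[simp] lemma ev_add (x y : C0 T) (t : ℝ) : ev (x + y) t = ev x t + ev y t := rfl
@[simp] lemma ev_smul (c : ℝ) (x : C0 T) (t : ℝ) : ev (c • x) t = c * ev x t := rfl

lemma sum_abs_sub_le_eVariationOn {ψ : ℝ → ℝ} (hψ : BoundedVariationOn ψ (Set.Icc 0 T)) (n : ℕ) :
    ∑ j ∈ Finset.range n, |ψ ((j + 1 : ℕ) * T / n) - ψ (j * T / n)| ≤
      (eVariationOn ψ (Set.Icc 0 T)).toReal := by
  have h := eVariationOn.sum_le_of_monotoneOn_Iic (f := ψ) (s := Set.Icc 0 T) (n := n)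
    (u := fun j : ℕ => (j : ℝ) * T / n)
    (fun i _ j _ hij => by
      have := hT.out.le
      have : (i : ℝ) ≤ j := by exact_mod_cast hij
      dsimp only; gcongr) (fun i hi => grid_mem hi)
  rw [← ENNReal.ofReal_le_iff_le_toReal hψ, ENNReal.ofReal_sum_of_nonneg fun _ _ => abs_nonneg _]
  refine le_trans (le_of_eq (Finset.sum_congr rfl fun j _ => ?_)) h
  rw [edist_dist, Real.dist_eq]

/-- Abel summation inside each coarse interval bounds the effect of a refinement by the oscillation
of the path at scale `T / n` times the variation of `ψ`. Nested partitions suffice, because two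
arbitrary ones are compared through the common refinement `n * m`. -/
lemma abs_rsSum_sub_rsSum_mul_le {ψ : ℝ → ℝ} (hψ : BoundedVariationOn ψ (Set.Icc 0 T))
    (x : C0 T) {n m : ℕ} (hn : 0 < n) (hm : 0 < m) {w : ℝ}
    (hw : ∀ s t : ℝ, |s - t| ≤ T / n → |ev x s - ev x t| ≤ w) :
    |rsSum ψ (n * m) x - rsSum ψ n x| ≤ w * (eVariationOn ψ (Set.Icc 0 T)).toReal := by
  have hn' : (n : ℝ) ≠ 0 := by positivity
  have hm' : (m : ℝ) ≠ 0 := by positivity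
  have hw0 : 0 ≤ w := le_trans (abs_nonneg _) (hw 0 0 (by have := hT.out.le; simp; positivity))
  set g : ℕ → ℝ := fun j => (j : ℝ) * T / (n * m : ℕ) with hg
  have hgrid : ∀ i : ℕ, (i : ℝ) * T / n = g (i * m) := fun i => by
    simp only [hg]; push_cast; field_simp
  have key : rsSum ψ (n * m) x - rsSum ψ n x = ∑ i ∈ Finset.range n, ∑ k ∈ Finset.range m,
      (ψ (g (i * m + k)) - ψ (g (i * m + 0))) *
        (ev x (g (i * m + (k + 1))) - ev x (g (i * m + k))) := by
    unfold rsSum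
    rw [sum_range_mul_eq, ← Finset.sum_sub_distrib]
    refine Finset.sum_congr rfl fun i _ => ?_
    have h1 : ψ (i * T / n) * (ev x ((i + 1 : ℕ) * T / n) - ev x (i * T / n)) =
        ∑ k ∈ Finset.range m, ψ (g (i * m + 0)) *
          (ev x (g (i * m + (k + 1))) - ev x (g (i * m + k))) := by
      rw [← Finset.mul_sum, Finset.sum_range_sub (fun k => ev x (g (i * m + k))), hgrid, hgrid]
      simp [Nat.add_mul]
    rw [h1, ← Finset.sum_sub_distrib]
    refine Finset.sum_congr rfl fun k _ => ?_
    rw [sub_mul]; rfl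
  rw [key]
  calc _ ≤ ∑ i ∈ Finset.range n, w * ∑ k ∈ Finset.range m,
        |ψ (g (i * m + (k + 1))) - ψ (g (i * m + k))| := by
        refine (Finset.abs_sum_le_sum_abs _ _).trans (Finset.sum_le_sum fun i _ => ?_)
        refine abs_sum_sub_mul_sub_le (fun k => ψ (g (i * m + k))) (fun k => ev x (g (i * m + k)))
          m w fun k hk => hw _ _ ?_
        have hk' : (k : ℝ) ≤ m := by exact_mod_cast hk
        have h0 := hT.out
        have : g (i * m + m) - g (i * m + k) = (m - k : ℝ) * T / (n * m) := by
          simp only [hg]; push_cast; ring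
        rw [this, abs_of_nonneg (div_nonneg (mul_nonneg (by linarith) h0.le) (by positivity)),
          div_le_div_iff₀ (by positivity) (by positivity)]
        have : (m - k : ℝ) ≤ m := by linarith [(Nat.cast_nonneg k : (0 : ℝ) ≤ k)]
        calc (m - k : ℝ) * T * n ≤ m * T * n := by gcongr
          _ = T * (n * m) := by ring
    _ = w * ∑ j ∈ Finset.range (n * m), |ψ (g (j + 1)) - ψ (g j)| := by
        rw [← Finset.mul_sum, sum_range_mul_eq]; rfl
    _ ≤ _ := by gcongr; exact sum_abs_sub_le_eVariationOn hψ (n * m)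

lemma cauchySeq_rsSum {ψ : ℝ → ℝ} (hψ : BoundedVariationOn ψ (Set.Icc 0 T)) (x : C0 T) :
    CauchySeq fun n => rsSum ψ n x := by
  rw [Metric.cauchySeq_iff]
  intro ε hε
  set V := (eVariationOn ψ (Set.Icc 0 T)).toReal
  have hV : 0 ≤ V := ENNReal.toReal_nonneg
  -- Each of the two comparisons with the common refinement costs this modulus times `V`; the extra
  -- `2` covers `V = 0` and makes the final inequality strict.
  obtain ⟨δ, hδ, hx⟩ := Metric.uniformContinuous_iff.1 (uniformContinuous_ev x)
    (ε / (2 * V + 2)) (by positivity)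
  obtain ⟨N, hN⟩ := exists_nat_gt (T / δ)
  have hN0 : (0 : ℝ) < N := lt_trans (div_pos hT.out hδ) hN
  have hmod : ∀ n ≥ N, 0 < n ∧ ∀ s t : ℝ, |s - t| ≤ T / n → |ev x s - ev x t| ≤ ε / (2 * V + 2) := by
    intro n hn
    have hn' : (N : ℝ) ≤ n := by exact_mod_cast hn
    have hn0 : (0 : ℝ) < n := hN0.trans_le hn'
    refine ⟨by exact_mod_cast hn0, fun s t hst => (hx (lt_of_le_of_lt hst ?_)).le⟩
    rw [div_lt_iff₀ hn0, mul_comm]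
    exact lt_of_lt_of_le ((div_lt_iff₀ hδ).1 hN) (by gcongr)
  refine ⟨N, fun n hn m hm => ?_⟩
  have h1 := abs_rsSum_sub_rsSum_mul_le hψ x (hmod n hn).1 (hmod m hm).1 (hmod n hn).2
  have h2 := abs_rsSum_sub_rsSum_mul_le hψ x (hmod m hm).1 (hmod n hn).1 (hmod m hm).2
  rw [mul_comm m n] at h2
  rw [Real.dist_eq]
  have h3 : ε / (2 * V + 2) * V + ε / (2 * V + 2) * V < ε := by
    rw [← two_mul, ← sub_pos]
    have : ε - 2 * (ε / (2 * V + 2) * V) = ε * (2 / (2 * V + 2)) := by field_simp; ring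
    rw [this]; positivity
  calc |rsSum ψ n x - rsSum ψ m x|
      = |(rsSum ψ (n * m) x - rsSum ψ m x) - (rsSum ψ (n * m) x - rsSum ψ n x)| := by
        congr 1; ring
    _ ≤ _ := abs_sub _ _
    _ ≤ _ := add_le_add h2 h1
    _ < ε := h3

lemma tendsto_rsSum {ψ : ℝ → ℝ} (hψ : BoundedVariationOn ψ (Set.Icc 0 T)) (x : C0 T) :
    Tendsto (fun n => rsSum ψ n x) atTop (𝓝 (rsIntegral ψ x)) :=
  (cauchySeq_rsSum hψ x).tendsto_limUnder

lemma rsSum_add_path (ψ : ℝ → ℝ) (n : ℕ) (x y : C0 T) :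
    rsSum ψ n (x + y) = rsSum ψ n x + rsSum ψ n y := by
  simp only [rsSum, ev_add, ← Finset.sum_add_distrib]
  exact Finset.sum_congr rfl fun i _ => by ring

lemma rsSum_smul_path (ψ : ℝ → ℝ) (n : ℕ) (c : ℝ) (x : C0 T) :
    rsSum ψ n (c • x) = c * rsSum ψ n x := by
  simp only [rsSum, ev_smul, Finset.mul_sum]
  exact Finset.sum_congr rfl fun i _ => by ring

lemma continuous_rsSum (ψ : ℝ → ℝ) (n : ℕ) : Continuous fun x : C0 T => rsSum ψ n x :=
  continuous_finsetSum _ fun _ _ =>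
    continuous_const.mul ((continuous_ev_left _).sub (continuous_ev_left _))

lemma rsIntegral_add {ψ : ℝ → ℝ} (hψ : BoundedVariationOn ψ (Set.Icc 0 T)) (x y : C0 T) :
    rsIntegral ψ (x + y) = rsIntegral ψ x + rsIntegral ψ y :=
  tendsto_nhds_unique (tendsto_rsSum hψ _)
    (((tendsto_rsSum hψ x).add (tendsto_rsSum hψ y)).congr fun n => (rsSum_add_path ψ n x y).symm)

lemma rsIntegral_smul {ψ : ℝ → ℝ} (hψ : BoundedVariationOn ψ (Set.Icc 0 T)) (c : ℝ) (x : C0 T) :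
    rsIntegral ψ (c • x) = c * rsIntegral ψ x :=
  tendsto_nhds_unique (tendsto_rsSum hψ _)
    (((tendsto_rsSum hψ x).const_mul c).congr fun n => (rsSum_smul_path ψ n c x).symm)

lemma measurable_rsIntegral {ψ : ℝ → ℝ} (hψ : BoundedVariationOn ψ (Set.Icc 0 T)) :
    Measurable fun x : C0 T => rsIntegral ψ x :=
  measurable_of_tendsto_metrizable (fun n => (continuous_rsSum ψ n).measurable)
    (tendsto_pi_nhds.2 fun x => tendsto_rsSum hψ x)

lemma rsSum_sum (s : Finset ℕ) (c : ℕ → ℝ) (ψ : ℕ → ℝ → ℝ) (n : ℕ) (x : C0 T) :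
    rsSum (fun t => ∑ j ∈ s, c j * ψ j t) n x = ∑ j ∈ s, c j * rsSum (ψ j) n x := by
  simp only [rsSum, Finset.sum_mul, Finset.mul_sum]
  rw [Finset.sum_comm]
  exact Finset.sum_congr rfl fun j _ => Finset.sum_congr rfl fun i _ => by ring

end RiemannStieltjes

/-! ### Step function approximation of functions of bounded variation. -/

section StepFunction

variable (T : ℝ)

/-- The left-endpoint step function of `ψ` on the uniform partition of `[0,T]` into `n`
intervals. -/
def stepFn (ψ : ℝ → ℝ) (n : ℕ) (t : ℝ) : ℝ :=
  ∑ i ∈ Finset.range n,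
    (Set.Ioc ((i : ℝ) * T / n) ((i + 1 : ℕ) * T / n)).indicator (fun _ => ψ (i * T / n)) t

variable {T}

lemma measurable_stepFn (ψ : ℝ → ℝ) (n : ℕ) : Measurable (stepFn T ψ n) :=
  Finset.measurable_sum _ fun _ _ => measurable_const.indicator measurableSet_Ioc

lemma ae_leb_mem_Ioc : ∀ᵐ t ∂(leb T), t ∈ Set.Ioc (0 : ℝ) T := by
  have : leb T = volume.restrict (Set.Ioc 0 T) :=
    Measure.restrict_congr_set Ioc_ae_eq_Icc.symm
  rw [this]
  exact ae_restrict_mem measurableSet_Ioc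

variable [hT : Fact (0 < T)]

lemma stepFn_eq {ψ : ℝ → ℝ} {n i : ℕ} (hi : i < n) {t : ℝ}
    (ht : t ∈ Set.Ioc ((i : ℝ) * T / n) ((i + 1 : ℕ) * T / n)) : stepFn T ψ n t = ψ (i * T / n) := by
  have hn : (0 : ℝ) < n := by exact_mod_cast (Nat.zero_le i).trans_lt hi
  have h0 := hT.out
  have aux : ∀ a b : ℕ, (a : ℝ) * T / n < b * T / n → a < b := by
    intro a b h
    rw [div_lt_div_iff_of_pos_right hn, mul_lt_mul_iff_left₀ h0] at h
    exact_mod_cast h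
  unfold stepFn
  rw [Finset.sum_eq_single i]
  · rw [Set.indicator_of_mem ht]
  · intro j _ hji
    rw [Set.indicator_of_notMem]
    intro hj
    have h1 := aux _ _ (ht.1.trans_le hj.2)
    have h2 := aux _ _ (hj.1.trans_le ht.2)
    omega
  · exact fun h => absurd (Finset.mem_range.2 hi) h

lemma exists_mem_grid {n : ℕ} (hn : 0 < n) {t : ℝ} (ht : t ∈ Set.Ioc (0 : ℝ) T) :
    ∃ i < n, t ∈ Set.Ioc ((i : ℝ) * T / n) ((i + 1 : ℕ) * T / n) := by
  have h0 := hT.out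
  have hn' : (0 : ℝ) < n := by exact_mod_cast hn
  set c := ⌈t * n / T⌉₊ with hc
  have hc0 : 0 < c := Nat.ceil_pos.2 (div_pos (mul_pos ht.1 hn') h0)
  have hcn : c ≤ n := Nat.ceil_le.2 (by rw [div_le_iff₀ h0, mul_comm]; gcongr; exact ht.2)
  have h1 : t * n / T ≤ c := Nat.le_ceil _
  have h2 : (c : ℝ) < t * n / T + 1 :=
    Nat.ceil_lt_add_one (div_nonneg (mul_nonneg ht.1.le hn'.le) h0.le)
  refine ⟨c - 1, by omega, ?_, ?_⟩
  · rw [Nat.cast_sub hc0, div_lt_iff₀ hn', ← lt_div_iff₀ h0]; push_cast; linarith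
  · rw [Nat.sub_add_cancel hc0, le_div_iff₀ hn', ← div_le_iff₀ h0]; exact h1

lemma stepFn_of_notMem {ψ : ℝ → ℝ} {n : ℕ} {t : ℝ} (ht : t ∉ Set.Ioc (0 : ℝ) T) :
    stepFn T ψ n t = 0 := by
  unfold stepFn
  refine Finset.sum_eq_zero fun i hi => Set.indicator_of_notMem (fun h => ht ?_) _
  have hi' := Finset.mem_range.1 hi
  exact ⟨(grid_mem hi'.le).1.trans_lt h.1, h.2.trans (grid_mem (Nat.succ_le_of_lt hi')).2⟩

lemma stepFn_sq (ψ : ℝ → ℝ) (n : ℕ) (t : ℝ) :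
    stepFn T ψ n t ^ 2 = stepFn T (fun s => ψ s ^ 2) n t := by
  rcases Nat.eq_zero_or_pos n with rfl | hn
  · simp [stepFn]
  by_cases ht : t ∈ Set.Ioc (0 : ℝ) T
  · obtain ⟨i, hi, hti⟩ := exists_mem_grid hn ht
    rw [stepFn_eq hi hti, stepFn_eq hi hti]
  · rw [stepFn_of_notMem ht, stepFn_of_notMem ht]; simp

lemma abs_stepFn_le {ψ : ℝ → ℝ} {M : ℝ} (hM : ∀ t ∈ Set.Icc (0 : ℝ) T, |ψ t| ≤ M) (n : ℕ) (t : ℝ) :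
    |stepFn T ψ n t| ≤ M := by
  have hM0 : 0 ≤ M := (abs_nonneg _).trans (hM 0 ⟨le_rfl, hT.out.le⟩)
  rcases Nat.eq_zero_or_pos n with rfl | hn
  · simpa [stepFn] using hM0
  by_cases ht : t ∈ Set.Ioc (0 : ℝ) T
  · obtain ⟨i, hi, hti⟩ := exists_mem_grid hn ht
    rw [stepFn_eq hi hti]
    exact hM _ (grid_mem hi.le)
  · rw [stepFn_of_notMem ht]; simpa using hM0

lemma integral_stepFn (ψ : ℝ → ℝ) (n : ℕ) :
    ∫ t, stepFn T ψ n t ∂(leb T) = ∑ i ∈ Finset.range n, ψ (i * T / n) * (T / n) := by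
  unfold stepFn
  rw [integral_finsetSum _ fun i _ => (integrable_const _).indicator measurableSet_Ioc]
  refine Finset.sum_congr rfl fun i hi => ?_
  have hi' := Finset.mem_range.1 hi
  have hn : (0 : ℝ) < n := by exact_mod_cast (Nat.zero_le i).trans_lt hi'
  rw [integral_indicator measurableSet_Ioc, Measure.restrict_restrict measurableSet_Ioc,
    Set.inter_eq_left.2 (fun t ht => Set.mem_Icc.2 ⟨(grid_mem hi'.le).1.trans ht.1.le,
      ht.2.trans (grid_mem (Nat.succ_le_of_lt hi')).2⟩), setIntegral_const, smul_eq_mul,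
    Measure.real, Real.volume_Ioc, ENNReal.toReal_ofReal]
  · push_cast; ring
  · have := hT.out
    rw [sub_nonneg]; gcongr; omega

/-- A function of bounded variation is differentiable, hence continuous, almost everywhere, and the
left grid points approach `t`. -/
lemma ae_tendsto_stepFn {ψ : ℝ → ℝ} (hψ : BoundedVariationOn ψ (Set.Icc 0 T)) :
    ∀ᵐ t ∂(leb T), Tendsto (fun n => stepFn T ψ n t) atTop (𝓝 (ψ t)) := by
  have h1 : ∀ᵐ t ∂(leb T), DifferentiableWithinAt ℝ ψ (Set.Icc 0 T) t :=
    (ae_restrict_iff' measurableSet_Icc).2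
      hψ.locallyBoundedVariationOn.ae_differentiableWithinAt_of_mem_real
  filter_upwards [h1, ae_leb_mem_Ioc] with t ht htm
  have hex : ∀ n : ℕ, ∃ s ∈ Set.Icc (0 : ℝ) T, 0 < n → |s - t| ≤ T / n ∧ stepFn T ψ n t = ψ s := by
    intro n
    rcases Nat.eq_zero_or_pos n with rfl | hn
    · exact ⟨0, ⟨le_rfl, hT.out.le⟩, fun h => absurd h (lt_irrefl _)⟩
    obtain ⟨i, hi, hti⟩ := exists_mem_grid hn htm
    refine ⟨_, grid_mem hi.le, fun _ => ⟨?_, stepFn_eq hi hti⟩⟩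
    have h2 := hti.2
    push_cast at h2
    rw [add_mul, add_div, one_mul] at h2
    rw [abs_sub_comm, abs_of_nonneg (by linarith [hti.1])]
    linarith
  choose s hs hs' using hex
  have hst : Tendsto s atTop (𝓝[Set.Icc 0 T] t) := by
    refine tendsto_nhdsWithin_iff.2 ⟨?_, Eventually.of_forall hs⟩
    rw [tendsto_iff_dist_tendsto_zero]
    refine squeeze_zero' (Eventually.of_forall fun _ => dist_nonneg)
      ((eventually_gt_atTop 0).mono fun n hn => ?_) (tendsto_const_div_atTop_nhds_zero_nat T)
    exact (hs' n hn).1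
  refine (ht.continuousWithinAt.tendsto.comp hst).congr' ?_
  filter_upwards [eventually_gt_atTop 0] with n hn using (hs' n hn).2.symm

lemma aestronglyMeasurable_of_boundedVariationOn {ψ : ℝ → ℝ}
    (hψ : BoundedVariationOn ψ (Set.Icc 0 T)) : AEStronglyMeasurable ψ (leb T) :=
  aestronglyMeasurable_of_tendsto_ae _
    (fun n => (measurable_stepFn ψ n).aestronglyMeasurable) (ae_tendsto_stepFn hψ)

lemma exists_abs_le_of_boundedVariationOn {ψ : ℝ → ℝ}
    (hψ : BoundedVariationOn ψ (Set.Icc 0 T)) : ∃ M, ∀ t ∈ Set.Icc (0 : ℝ) T, |ψ t| ≤ M := by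
  refine ⟨(eVariationOn ψ (Set.Icc 0 T)).toReal + |ψ 0|, fun t ht => ?_⟩
  have := hψ.dist_le ht (⟨le_rfl, hT.out.le⟩ : (0 : ℝ) ∈ Set.Icc 0 T)
  rw [Real.dist_eq] at this
  calc |ψ t| = |(ψ t - ψ 0) + ψ 0| := by ring_nf
    _ ≤ _ := abs_add_le _ _
    _ ≤ _ := by gcongr

lemma memLp_top_of_boundedVariationOn {ψ : ℝ → ℝ}
    (hψ : BoundedVariationOn ψ (Set.Icc 0 T)) : MemLp ψ ∞ (leb T) := by
  obtain ⟨M, hM⟩ := exists_abs_le_of_boundedVariationOn hψ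
  exact memLp_top_of_bound (aestronglyMeasurable_of_boundedVariationOn hψ) M
    ((ae_restrict_iff' measurableSet_Icc).2 (Eventually.of_forall hM))

/-- These sums are the variances of the Riemann–Stieltjes sums under Wiener measure. -/
lemma tendsto_sum_sq_mul {ψ : ℝ → ℝ} (hψ : BoundedVariationOn ψ (Set.Icc 0 T)) :
    Tendsto (fun n : ℕ => ∑ i ∈ Finset.range n, ψ (i * T / n) ^ 2 * (T / n)) atTop
      (𝓝 (∫ t, ψ t ^ 2 ∂(leb T))) := by
  obtain ⟨M, hM⟩ := exists_abs_le_of_boundedVariationOn hψ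
  simp_rw [← integral_stepFn (fun t => ψ t ^ 2), ← stepFn_sq]
  refine tendsto_integral_of_dominated_convergence (fun _ => M ^ 2)
    (fun n => ((measurable_stepFn ψ n).pow_const 2).aestronglyMeasurable) (integrable_const _)
    (fun n => Eventually.of_forall fun t => ?_) ?_
  · rw [Real.norm_eq_abs, abs_pow]
    have := abs_stepFn_le hM n t
    gcongr
  · filter_upwards [ae_tendsto_stepFn hψ] with t ht using ht.pow 2

end StepFunction

/-! ### Limits and fourth moments of centred Gaussian variables. -/

section GaussianLimits

variable {Ω : Type*} {mΩ : MeasurableSpace Ω} {P : Measure Ω}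

lemma integral_cexp_of_map_eq_gaussianReal {X : Ω → ℝ} {v : ℝ} (hX : AEMeasurable X P) (hv : 0 ≤ v)
    (h : P.map X = gaussianReal 0 v.toNNReal) (t : ℝ) :
    ∫ ω, Complex.exp (t * X ω * Complex.I) ∂P = Complex.exp (-(v * t ^ 2 / 2)) := by
  have h1 := charFun_gaussianReal (μ := 0) (v := v.toNNReal) t
  rw [← h, charFun_apply_real, integral_map hX
    (by exact Continuous.aestronglyMeasurable (by fun_prop))] at h1
  rw [h1]
  simp [Real.coe_toNNReal v hv]

/-- Characteristic functions converge by dominated convergence. This carries the Gaussian law from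
Riemann–Stieltjes sums to Stieltjes integrals and on to Paley–Wiener–Zygmund integrals. -/
lemma map_eq_gaussianReal_of_tendsto [IsProbabilityMeasure P] {X : ℕ → Ω → ℝ} {Y : Ω → ℝ}
    {v : ℕ → ℝ} {w : ℝ} (hX : ∀ n, AEMeasurable (X n) P) (hv : ∀ n, 0 ≤ v n)
    (h : ∀ n, P.map (X n) = gaussianReal 0 (v n).toNNReal)
    (hXY : ∀ᵐ ω ∂P, Tendsto (fun n => X n ω) atTop (𝓝 (Y ω))) (hvw : Tendsto v atTop (𝓝 w)) :
    P.map Y = gaussianReal 0 w.toNNReal := by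
  have hY : AEMeasurable Y P := aemeasurable_of_tendsto_metrizable_ae' hX hXY
  have hw : 0 ≤ w := ge_of_tendsto' hvw hv
  have := Measure.isProbabilityMeasure_map (μ := P) hY
  refine Measure.ext_of_charFun ?_
  ext t
  rw [charFun_apply_real, charFun_gaussianReal, integral_map hY
    (by exact Continuous.aestronglyMeasurable (by fun_prop))]
  have h1 : Tendsto (fun n => ∫ ω, Complex.exp (t * X n ω * Complex.I) ∂P) atTop
      (𝓝 (∫ ω, Complex.exp (t * Y ω * Complex.I) ∂P)) := by
    refine tendsto_integral_of_dominated_convergence (fun _ => 1)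
      (fun n => ?_) (integrable_const _) (fun n => Eventually.of_forall fun ω => ?_) ?_
    · exact ((Continuous.measurable (by fun_prop :
        Continuous fun y : ℝ => Complex.exp (t * y * Complex.I))).comp_aemeasurable
          (hX n)).aestronglyMeasurable
    · rw [← Complex.ofReal_mul, Complex.norm_exp_ofReal_mul_I]
    · filter_upwards [hXY] with ω hω
      exact ((by fun_prop : Continuous fun y : ℝ =>
        Complex.exp (t * y * Complex.I)).tendsto _).comp hω
  refine tendsto_nhds_unique h1 ?_
  simp_rw [fun n => integral_cexp_of_map_eq_gaussianReal (hX n) (hv n) (h n) t]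
  have h2 : Tendsto (fun n => Complex.exp (-(v n * t ^ 2 / 2))) atTop
      (𝓝 (Complex.exp (-(w * t ^ 2 / 2)))) :=
    ((by fun_prop : Continuous fun y : ℝ => Complex.exp (-(y * t ^ 2 / 2))).tendsto _).comp hvw
  convert h2 using 3
  simp [Real.coe_toNNReal w hw]

/-- The fourth moment of the standard normal distribution. -/
def gaussFourth : ℝ≥0∞ := ∫⁻ y : ℝ, ‖y‖ₑ ^ 4 ∂(gaussianReal 0 1)

lemma gaussFourth_ne_top : gaussFourth ≠ ∞ := by
  have h := (memLp_id_gaussianReal (μ := 0) (v := 1) 4).2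
  rw [eLpNorm_lt_top_iff_lintegral_rpow_enorm_lt_top (by simp) (by simp)] at h
  convert h.ne using 1
  simp only [gaussFourth]
  congr 1; ext y
  simp only [id]
  rw [← ENNReal.rpow_natCast]; norm_num

/-- By scaling from the standard normal law. The fourth power is used because it yields `v ^ 2`, a
power of the variance greater than one, as chaining requires. -/
lemma lintegral_enorm_pow_four_of_map_eq {X : Ω → ℝ} {v : ℝ} (hX : AEMeasurable X P) (hv : 0 ≤ v)
    (h : P.map X = gaussianReal 0 v.toNNReal) :
    ∫⁻ ω, ‖X ω‖ₑ ^ 4 ∂P = gaussFourth * ENNReal.ofReal v ^ 2 := by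
  have hm : Measurable fun y : ℝ => ‖y‖ₑ ^ 4 := by fun_prop
  have h1 : gaussianReal 0 v.toNNReal = (gaussianReal 0 1).map (fun y => √v * y) := by
    rw [gaussianReal_map_const_mul]
    congr 1
    · simp
    · ext; simp [Real.coe_toNNReal v hv, Real.sq_sqrt hv]
  rw [← lintegral_map' (f := fun y : ℝ => ‖y‖ₑ ^ 4) hm.aemeasurable hX, h, h1,
    lintegral_map hm (by fun_prop), gaussFourth]
  simp_rw [enorm_mul, mul_pow]
  rw [lintegral_const_mul _ hm, mul_comm]
  congr 1
  rw [Real.enorm_of_nonneg (Real.sqrt_nonneg v), ← ENNReal.ofReal_pow (Real.sqrt_nonneg v),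
    ← ENNReal.ofReal_pow hv, show √v ^ 4 = (√v ^ 2) ^ 2 by ring, Real.sq_sqrt hv]

end GaussianLimits

/-! ### Laws of Stieltjes integrals under Wiener measure. -/

section Wiener

variable {T : ℝ} [hT : Fact (0 < T)] {m : Measure (C0 T)}

/-- The grid increments are jointly Gaussian, and the covariance `min s t` makes them uncorrelated
with variance `T / n`. -/
lemma map_rsSum (hm : IsWienerMeasure T m) (ψ : ℝ → ℝ) {n : ℕ} (hn : 0 < n) :
    m.map (rsSum ψ n) = gaussianReal 0
      (∑ i ∈ Finset.range n, ψ (i * T / n) ^ 2 * (T / n)).toNNReal := by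
  have := hm.isProbabilityMeasure
  have h0 := hT.out
  have hn' : (0 : ℝ) < n := by exact_mod_cast hn
  set t : Fin (n + 1) → Set.Icc (0 : ℝ) T := fun i => Set.projIcc 0 T h0.le ((i : ℕ) * T / n)
  have htv : ∀ i : Fin (n + 1), ((t i : ℝ)) = (i : ℕ) * T / n := fun i => by
    simp only [t]
    rw [Set.projIcc_of_mem h0.le (grid_mem (Nat.lt_succ_iff.1 i.2))]
  set c : Fin n → ℝ := fun i => ψ ((i : ℕ) * T / n)
  set I : Fin n → C0 T → ℝ := fun i x => x.1 (t i.succ) - x.1 (t i.castSucc)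
  have hinc := hm.isGaussianProcess.hasGaussianLaw_increments (t := t)
  have hsum : rsSum ψ n = fun x => ∑ i, c i * I i x := by
    ext x
    simp only [rsSum]
    rw [Finset.sum_range]
    rfl
  have hL : HasGaussianLaw (rsSum ψ n) m := by
    let L : (Fin n → ℝ) →L[ℝ] ℝ :=
      ∑ i : Fin n, c i • ContinuousLinearMap.proj (R := ℝ) (φ := fun _ => ℝ) i
    have he : rsSum ψ n = L ∘ fun ω i => ω.1 (t i.succ) - ω.1 (t i.castSucc) := by
      rw [hsum]; ext x
      simp [L, I]
    rw [he]
    exact hinc.map L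
  have hx2 : ∀ s, MemLp (fun x : C0 T => x.1 s) 2 m := fun s =>
    (hm.isGaussianProcess.hasGaussianLaw_eval s).memLp_two
  have hI2 : ∀ i, MemLp (I i) 2 m := fun i => (hx2 _).sub (hx2 _)
  have hcov : ∀ i j, cov[I i, I j; m] = if i = j then T / n else 0 := by
    intro i j
    change cov[fun x : C0 T => x.1 (t i.succ) - x.1 (t i.castSucc), I j; m] = _
    rw [covariance_fun_sub_left (hx2 _) (hx2 _) (hI2 j),
      covariance_fun_sub_right (hx2 _) (hx2 _) (hx2 _),
      covariance_fun_sub_right (hx2 _) (hx2 _) (hx2 _), hm.covariance, hm.covariance,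
      hm.covariance, hm.covariance, htv, htv, htv, htv]
    have hmin : ∀ a b : ℕ, min ((a : ℝ) * T / n) (b * T / n) = (min a b : ℕ) * T / n := by
      intro a b
      have hmono : Monotone fun k : ℕ => (k : ℝ) * T / n := fun p q hpq => by
        have : (p : ℝ) ≤ q := by exact_mod_cast hpq
        dsimp only; gcongr
      exact (hmono.map_min).symm
    simp only [hmin, Fin.val_succ, Fin.val_castSucc]
    rcases lt_trichotomy (i : ℕ) j with hij | hij | hij
    · rw [if_neg (by rintro rfl; exact lt_irrefl _ hij), min_eq_left (by omega : (i : ℕ) + 1 ≤ j + 1),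
        min_eq_left (by omega : (i : ℕ) + 1 ≤ j), min_eq_left (by omega : (i : ℕ) ≤ j + 1),
        min_eq_left hij.le]
      ring
    · rw [if_pos (Fin.ext hij), hij, min_self, min_self, min_eq_right (by omega), min_eq_left (by omega)]
      push_cast; ring
    · rw [if_neg (by rintro rfl; exact lt_irrefl _ hij), min_eq_right (by omega : (j : ℕ) + 1 ≤ i + 1),
        min_eq_right (by omega : (j : ℕ) ≤ i + 1), min_eq_right (by omega : (j : ℕ) + 1 ≤ i),
        min_eq_right hij.le]
      ring
  rw [hL.map_eq_gaussianReal]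
  congr 2
  · rw [hsum, integral_finsetSum _ fun i _ => ((hI2 i).integrable one_le_two).const_mul _]
    refine Finset.sum_eq_zero fun i _ => ?_
    rw [integral_const_mul, integral_sub ((hx2 _).integrable one_le_two)
      ((hx2 _).integrable one_le_two), hm.mean, hm.mean]
    simp
  · rw [hsum, variance_fun_sum fun i => (hI2 i).const_mul (c i), Finset.sum_range]
    refine Finset.sum_congr rfl fun i _ => ?_
    simp_rw [covariance_const_mul_left, covariance_const_mul_right, hcov]
    rw [Finset.sum_eq_single i (fun j _ hj => by rw [if_neg hj.symm]; simp)
      (fun h => absurd (Finset.mem_univ i) h)]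
    simp [c]; ring

lemma map_rsIntegral (hm : IsWienerMeasure T m) {ψ : ℝ → ℝ}
    (hψ : BoundedVariationOn ψ (Set.Icc 0 T)) :
    m.map (rsIntegral ψ) = gaussianReal 0 (∫ t, ψ t ^ 2 ∂(leb T)).toNNReal := by
  have := hm.isProbabilityMeasure
  have h0 := hT.out
  refine map_eq_gaussianReal_of_tendsto (X := fun n => rsSum ψ (n + 1))
    (fun n => (continuous_rsSum ψ _).measurable.aemeasurable) (fun n => ?_)
    (fun n => map_rsSum hm ψ n.succ_pos)
    (Eventually.of_forall fun x => (tendsto_rsSum hψ x).comp (tendsto_add_atTop_nat 1))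
    ((tendsto_sum_sq_mul hψ).comp (tendsto_add_atTop_nat 1))
  exact Finset.sum_nonneg fun i _ => by positivity

end Wiener

/-! ### A maximal inequality from fourth moments of increments. -/

section Maximal

/-- Split according to whether `p ≥ 10 r`: `1.1 ^ 4 ≤ 3 / 2` and `11 ^ 4 = 14641`. The coefficient
of `p ^ 4` has to be below `2` for the bisection argument that follows to close. -/
lemma add_pow_four_le (p r : ℝ≥0∞) : (p + r) ^ 4 ≤ 3 / 2 * p ^ 4 + 14641 * r ^ 4 := by
  rcases eq_or_ne p ∞ with rfl | hp
  · simp [ENNReal.mul_top, ENNReal.top_pow]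
  rcases eq_or_ne r ∞ with rfl | hr
  · simp [ENNReal.mul_top, ENNReal.top_pow]
  lift p to NNReal using hp
  lift r to NNReal using hr
  have h32 : (3 / 2 : ℝ≥0∞) = ((3 / 2 : NNReal) : ℝ≥0∞) := by
    rw [ENNReal.coe_div (by norm_num)]; rfl
  rw [h32]
  norm_cast
  rw [← NNReal.coe_le_coe]
  push_cast
  obtain ⟨a, ha⟩ : ∃ a : ℝ, a = p := ⟨_, rfl⟩
  obtain ⟨b, hb⟩ : ∃ b : ℝ, b = r := ⟨_, rfl⟩
  have ha0 : 0 ≤ a := ha ▸ p.2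
  have hb0 : 0 ≤ b := hb ▸ r.2
  rw [← ha, ← hb]
  rcases le_total (10 * b) a with h | h
  · calc (a + b) ^ 4 ≤ (a + a / 10) ^ 4 := by gcongr; linarith
      _ = 14641 / 10000 * a ^ 4 := by ring
      _ ≤ 3 / 2 * a ^ 4 + 14641 * b ^ 4 := by
        have : 0 ≤ a ^ 4 := by positivity
        have : 0 ≤ b ^ 4 := by positivity
        linarith
  · calc (a + b) ^ 4 ≤ (10 * b + b) ^ 4 := by gcongr
      _ = 14641 * b ^ 4 := by ring
      _ ≤ _ := by
        have : 0 ≤ a ^ 4 := by positivity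
        linarith

lemma aemeasurable_finset_sup {Ω ι : Type*} {mΩ : MeasurableSpace Ω} {P : Measure Ω}
    {f : ι → Ω → ℝ≥0∞} (hf : ∀ t, AEMeasurable (f t) P) (D : Finset ι) :
    AEMeasurable (fun ω => D.sup fun t => f t ω) P := by
  simp_rw [Finset.sup_eq_iSup]
  exact AEMeasurable.biSup _ D.countable_toSet fun t _ => hf t

/-- The constant in the maximal inequality. -/
def maxConst : ℝ≥0∞ := 58564

variable {Ω : Type*} {mΩ : MeasurableSpace Ω} {P : Measure Ω} {ι : Type*} [LinearOrder ι]
  {E : Type*} [PseudoEMetricSpace E]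

/-- A process whose fourth moments of increments are controlled by the squared increments of a
function `τ` has the fourth moment of its maximal increment controlled in the same way
(Móricz, Billingsley). -/
theorem lintegral_sup_edist_pow_four_le {X : ι → Ω → E} {τ : ι → ℝ} {K : ℝ≥0∞}
    (hX : ∀ s t, AEMeasurable (fun ω => edist (X s ω) (X t ω)) P)
    (hK : ∀ s t, s ≤ t →
      ∫⁻ ω, edist (X s ω) (X t ω) ^ 4 ∂P ≤ K * ENNReal.ofReal (τ t - τ s) ^ 2)
    (D : Finset ι) (a : ι) (w : ℝ) (hD : ∀ t ∈ D, a ≤ t ∧ τ t - τ a ≤ w) :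
    ∫⁻ ω, (D.sup fun t => edist (X a ω) (X t ω)) ^ 4 ∂P ≤ maxConst * K * ENNReal.ofReal w ^ 2 := by
  classical
  induction hcard : D.card using Nat.strong_induction_on generalizing D a w with
  | _ N ih =>
  rcases D.eq_empty_or_nonempty with rfl | hne
  · simp
  -- Bisection by `τ` rather than by cardinality: `k` is the first point where `τ - τ a` exceeds `w
  -- / 2`, `L` collects the points where it does not, and `R` the others, now measured from `k`. If
  -- there is no such point, `k` is arbitrary and `R` is empty.
  obtain ⟨k, hk, L, R, hDe, hL, hR, hLc, hRc⟩ : ∃ k ∈ D, ∃ L R : Finset ι, D = insert k (L ∪ R) ∧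
      (∀ t ∈ L, a ≤ t ∧ τ t - τ a ≤ w / 2) ∧ (∀ t ∈ R, k ≤ t ∧ τ t - τ k ≤ w / 2) ∧
      L.card < D.card ∧ R.card < D.card := by
    by_cases hR : (D.filter fun t => w / 2 < τ t - τ a).Nonempty
    · set R := D.filter fun t => w / 2 < τ t - τ a with hRdef
      set k := R.min' hR with hkdef
      have hkR : k ∈ R := Finset.min'_mem _ _
      have hkD : k ∈ D := (Finset.mem_filter.1 hkR).1
      have hkw : w / 2 < τ k - τ a := (Finset.mem_filter.1 hkR).2
      refine ⟨k, hkD, D.filter fun t => ¬ w / 2 < τ t - τ a, R.erase k, ?_, ?_, ?_, ?_, ?_⟩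
      · ext t
        simp only [Finset.mem_insert, Finset.mem_union, Finset.mem_filter, Finset.mem_erase, R]
        by_cases htk : t = k
        · simp [htk, hkD]
        · by_cases htD : t ∈ D
          · simpa [htk, htD] using le_or_gt (τ t - τ a) (w / 2)
          · simp [htk, htD]
      · intro t ht
        have := Finset.mem_filter.1 ht
        exact ⟨(hD t this.1).1, not_lt.1 this.2⟩
      · intro t ht
        have htR := Finset.mem_of_mem_erase ht
        refine ⟨Finset.min'_le _ _ htR, ?_⟩
        have := (hD t (Finset.mem_filter.1 htR).1).2
        linarith
      · refine Finset.card_lt_card (Finset.filter_ssubset.2 ⟨k, hkD, not_not.2 hkw⟩)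
      · exact (Finset.card_erase_lt_of_mem hkR).trans_le (Finset.card_filter_le _ _)
    · obtain ⟨k, hk⟩ := hne
      refine ⟨k, hk, D.erase k, ∅, ?_, ?_, by simp, Finset.card_erase_lt_of_mem hk, ?_⟩
      · simp [Finset.insert_erase hk]
      · intro t ht
        have htD := Finset.mem_of_mem_erase ht
        refine ⟨(hD t htD).1, ?_⟩
        by_contra hcon
        exact hR ⟨t, Finset.mem_filter.2 ⟨htD, not_le.1 hcon⟩⟩
      · simpa using Finset.card_pos.2 ⟨k, hk⟩
  have hw : 0 ≤ ENNReal.ofReal w := zero_le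
  have ihL := ih _ (hcard ▸ hLc) L a (w / 2) hL rfl
  have ihR := ih _ (hcard ▸ hRc) R k (w / 2) hR rfl
  have hak : ∫⁻ ω, edist (X a ω) (X k ω) ^ 4 ∂P ≤ K * ENNReal.ofReal w ^ 2 := by
    refine (hK a k (hD k hk).1).trans ?_
    gcongr
    exact (hD k hk).2
  have hsupL : AEMeasurable (fun ω => L.sup fun t => edist (X a ω) (X t ω)) P := aemeasurable_finset_sup (hX a) L
  have hsupR : AEMeasurable (fun ω => R.sup fun t => edist (X k ω) (X t ω)) P := aemeasurable_finset_sup (hX k) R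
  -- Points of `R` are reached through `X k`, so the two half-maxima enter as a maximum and only one
  -- extra increment is paid.
  have hpt : ∀ ω, (D.sup fun t => edist (X a ω) (X t ω)) ≤
      max (L.sup fun t => edist (X a ω) (X t ω)) (R.sup fun t => edist (X k ω) (X t ω)) +
        edist (X a ω) (X k ω) := by
    intro ω
    refine Finset.sup_le fun t ht => ?_
    rw [hDe, Finset.mem_insert, Finset.mem_union] at ht
    rcases ht with rfl | ht | ht
    · exact le_add_self
    · exact le_add_right (le_max_of_le_left (Finset.le_sup (f := fun t => edist (X a ω) (X t ω)) ht))
    · refine (edist_triangle _ (X k ω) _).trans ?_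
      rw [add_comm]
      gcongr
      exact le_max_of_le_right (Finset.le_sup (f := fun t => edist (X k ω) (X t ω)) ht)
  have hhalf : ENNReal.ofReal (w / 2) ^ 2 = ENNReal.ofReal w ^ 2 / 4 := by
    rw [ENNReal.ofReal_div_of_pos two_pos, ENNReal.div_eq_inv_mul, mul_pow, ← ENNReal.inv_pow,
      ENNReal.div_eq_inv_mul]
    norm_num
  calc ∫⁻ ω, (D.sup fun t => edist (X a ω) (X t ω)) ^ 4 ∂P
      ≤ ∫⁻ ω, (3 / 2 * ((L.sup fun t => edist (X a ω) (X t ω)) ^ 4 +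
          (R.sup fun t => edist (X k ω) (X t ω)) ^ 4) + 14641 * edist (X a ω) (X k ω) ^ 4) ∂P := by
        refine lintegral_mono fun ω => ?_
        refine (pow_le_pow_left₀ zero_le (hpt ω) 4).trans ((add_pow_four_le _ _).trans ?_)
        gcongr
        rcases le_total (L.sup fun t => edist (X a ω) (X t ω))
          (R.sup fun t => edist (X k ω) (X t ω)) with h | h
        · rw [max_eq_right h]; exact le_add_self
        · rw [max_eq_left h]; exact le_self_add
    _ = 3 / 2 * (∫⁻ ω, (L.sup fun t => edist (X a ω) (X t ω)) ^ 4 ∂P +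
          ∫⁻ ω, (R.sup fun t => edist (X k ω) (X t ω)) ^ 4 ∂P) +
          14641 * ∫⁻ ω, edist (X a ω) (X k ω) ^ 4 ∂P := by
        have h1 : AEMeasurable (fun ω => (L.sup fun t => edist (X a ω) (X t ω)) ^ 4 +
            (R.sup fun t => edist (X k ω) (X t ω)) ^ 4) P :=
          (hsupL.pow_const 4).add (hsupR.pow_const 4)
        rw [lintegral_add_left' (h1.const_mul _), lintegral_const_mul'' _ h1,
          lintegral_add_left' (hsupL.pow_const 4), lintegral_const_mul'' _ ((hX a k).pow_const 4)]
    _ ≤ 3 / 2 * (maxConst * K * (ENNReal.ofReal w ^ 2 / 4) +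
          maxConst * K * (ENNReal.ofReal w ^ 2 / 4)) + 14641 * (K * ENNReal.ofReal w ^ 2) := by
        rw [← hhalf]; gcongr
    _ = (3 / 2 * (maxConst / 4 + maxConst / 4) + 14641) * (K * ENNReal.ofReal w ^ 2) := by
        simp only [ENNReal.div_eq_inv_mul]; ring
    -- Halving `w` gains a factor `1 / 4`, so the constant `C` must satisfy `3 / 2 * (C / 4 + C / 4)
    -- + 14641 = C`, that is `C = 4 * 14641 = 58564`.
    _ = maxConst * K * ENNReal.ofReal w ^ 2 := by
        rw [mul_assoc]; congr 1
        unfold maxConst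
        have h1 : (58564 : ℝ≥0∞) / 4 = 14641 :=
          (ENNReal.eq_div_iff (by norm_num) (by norm_num)).2 (by norm_num) |>.symm
        rw [h1, ← two_mul, ← mul_assoc, ENNReal.div_mul_cancel (by norm_num) (by norm_num)]
        norm_num

theorem lintegral_iSup_edist_pow_four_le {X : ι → Ω → E} {τ : ι → ℝ} {K : ℝ≥0∞}
    (hX : ∀ s t, AEMeasurable (fun ω => edist (X s ω) (X t ω)) P)
    (hK : ∀ s t, s ≤ t →
      ∫⁻ ω, edist (X s ω) (X t ω) ^ 4 ∂P ≤ K * ENNReal.ofReal (τ t - τ s) ^ 2)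
    (d : ℕ → ι) (a : ι) (w : ℝ) (hd : ∀ k, a ≤ d k ∧ τ (d k) - τ a ≤ w) :
    ∫⁻ ω, ⨆ k, edist (X a ω) (X (d k) ω) ^ 4 ∂P ≤ maxConst * K * ENNReal.ofReal w ^ 2 := by
  classical
  have h1 : ∀ ω, ⨆ k, edist (X a ω) (X (d k) ω) ^ 4 =
      ⨆ n, (((Finset.range n).image d).sup fun t => edist (X a ω) (X t ω)) ^ 4 := by
    intro ω
    refine le_antisymm (iSup_le fun k => ?_) (iSup_le fun n => ?_)
    · refine le_iSup_of_le (k + 1) (pow_le_pow_left₀ zero_le ?_ 4)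
      exact Finset.le_sup (f := fun t => edist (X a ω) (X t ω))
        (Finset.mem_image_of_mem d (Finset.self_mem_range_succ k))
    · rw [Finset.apply_sup_eq_sup_comp (fun y : ℝ≥0∞ => y ^ 4) (fun x y =>
        (pow_left_mono 4).map_sup x y) (by simp)]
      refine Finset.sup_le fun t ht => ?_
      obtain ⟨k, -, rfl⟩ := Finset.mem_image.1 ht
      exact le_iSup (fun k => edist (X a ω) (X (d k) ω) ^ 4) k
  simp_rw [h1]
  rw [lintegral_iSup']
  · refine iSup_le fun n => lintegral_sup_edist_pow_four_le hX hK _ a w fun t ht => ?_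
    obtain ⟨k, -, rfl⟩ := Finset.mem_image.1 ht
    exact hd k
  · intro n
    exact (aemeasurable_finset_sup (hX a) _).pow_const 4
  · refine Eventually.of_forall fun ω n n' hn => pow_le_pow_left₀ zero_le (Finset.sup_mono ?_) 4
    exact Finset.image_subset_image (Finset.range_mono hn)

/-- The maximal oscillation after index `N` has fourth moment of order `(τ' - τ N) ^ 2`, which tends
to zero, so its infimum over `N` vanishes almost everywhere. -/
theorem ae_cauchySeq_of_fourth_moment {X : ℕ → Ω → ℝ} {τ : ℕ → ℝ} {K : ℝ≥0∞} {τ' : ℝ}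
    (hK0 : K ≠ ∞) (hX : ∀ n, AEMeasurable (X n) P)
    (hK : ∀ s t, s ≤ t → ∫⁻ ω, ‖X t ω - X s ω‖ₑ ^ 4 ∂P ≤ K * ENNReal.ofReal (τ t - τ s) ^ 2)
    (hτ : Tendsto τ atTop (𝓝 τ')) (hmono : Monotone τ) :
    ∀ᵐ ω ∂P, CauchySeq fun n => X n ω := by
  have hX' : ∀ s t, AEMeasurable (fun ω => edist (X s ω) (X t ω)) P := fun s t =>
    (hX s).edist (hX t)
  have hK' : ∀ s t, s ≤ t →
      ∫⁻ ω, edist (X s ω) (X t ω) ^ 4 ∂P ≤ K * ENNReal.ofReal (τ t - τ s) ^ 2 := by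
    intro s t hst
    simp_rw [edist_comm (X s _), edist_eq_enorm_sub]
    exact hK s t hst
  have h1 : ∀ N, ∫⁻ ω, ⨅ n, ⨆ k, edist (X n ω) (X (n + k) ω) ^ 4 ∂P ≤
      maxConst * K * ENNReal.ofReal (τ' - τ N) ^ 2 := by
    intro N
    refine (lintegral_mono fun ω => iInf_le _ N).trans
      (lintegral_iSup_edist_pow_four_le hX' hK' (fun k => N + k) N (τ' - τ N) fun k => ⟨by simp, ?_⟩)
    have := hmono.ge_of_tendsto hτ (N + k)
    linarith
  have h2 : Tendsto (fun N => maxConst * K * ENNReal.ofReal (τ' - τ N) ^ 2) atTop (𝓝 0) := by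
    have h3 : Tendsto (fun N => ENNReal.ofReal (τ' - τ N)) atTop (𝓝 0) := by
      have := ENNReal.tendsto_ofReal (tendsto_const_nhds (x := τ').sub hτ)
      simpa using this
    have h4 := ENNReal.Tendsto.const_mul (a := maxConst * K) (ENNReal.Tendsto.pow (n := 2) h3)
      (Or.inr (ENNReal.mul_ne_top (by simp [maxConst]) hK0))
    simpa using h4
  have h5 : ∫⁻ ω, ⨅ n, ⨆ k, edist (X n ω) (X (n + k) ω) ^ 4 ∂P = 0 :=
    le_antisymm (ge_of_tendsto' h2 h1) zero_le
  rw [lintegral_eq_zero_iff' (.iInf fun n => .iSup fun k => (hX' _ _).pow_const 4)] at h5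
  filter_upwards [h5] with ω hω
  rw [EMetric.cauchySeq_iff']
  intro ε hε
  have h6 : ⨅ n, ⨆ k, edist (X n ω) (X (n + k) ω) ^ 4 < ε ^ 4 := by
    rw [show _ = (0 : ℝ≥0∞) from hω]; positivity
  obtain ⟨N, hN⟩ := iInf_lt_iff.1 h6
  refine ⟨N, fun n hn => ?_⟩
  obtain ⟨k, rfl⟩ := Nat.exists_eq_add_of_le hn
  have := (le_iSup (fun k => edist (X N ω) (X (N + k) ω) ^ 4) k).trans_lt hN
  rw [edist_comm]
  exact lt_of_not_ge fun h => not_lt.2 (pow_le_pow_left₀ zero_le h 4) this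

end Maximal

/-! ### Separability of `L₂[0,T]`. -/

instance (T : ℝ) : SecondCountableTopology (L2 T) :=
  haveI : Fact ((2 : ℝ≥0∞) ≠ ∞) := ⟨by simp⟩
  inferInstanceAs (SecondCountableTopology (Lp ℝ 2 (leb T)))

/-! ### Linear combinations of functions of bounded variation. -/

section BoundedVariationSum

lemma boundedVariationOn_sum {s : Set ℝ} (F : Finset ℕ) (c : ℕ → ℝ) {ψ : ℕ → ℝ → ℝ}
    (hψ : ∀ j, BoundedVariationOn (ψ j) s) :
    BoundedVariationOn (fun t => ∑ j ∈ F, c j * ψ j t) s := by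
  have hle : eVariationOn (fun t => ∑ j ∈ F, c j * ψ j t) s ≤
      ∑ j ∈ F, ‖c j‖ₑ * eVariationOn (ψ j) s := by
    refine iSup_le fun ⟨n, u, hu, us⟩ => ?_
    calc ∑ i ∈ Finset.range n, edist (∑ j ∈ F, c j * ψ j (u (i + 1))) (∑ j ∈ F, c j * ψ j (u i))
        ≤ ∑ i ∈ Finset.range n, ∑ j ∈ F, ‖c j‖ₑ * edist (ψ j (u (i + 1))) (ψ j (u i)) := by
          refine Finset.sum_le_sum fun i _ => ?_
          rw [edist_eq_enorm_sub, ← Finset.sum_sub_distrib]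
          refine (enorm_sum_le _ _).trans (Finset.sum_le_sum fun j _ => ?_)
          rw [← mul_sub, enorm_mul, edist_eq_enorm_sub]
      _ = ∑ j ∈ F, ‖c j‖ₑ * ∑ i ∈ Finset.range n, edist (ψ j (u (i + 1))) (ψ j (u i)) := by
          rw [Finset.sum_comm]; simp_rw [Finset.mul_sum]
      _ ≤ _ := by
          gcongr with j _
          exact eVariationOn.sum_le hu us
  refine ne_top_of_le_ne_top (ENNReal.sum_ne_top.2 fun j _ => ?_) hle
  exact ENNReal.mul_ne_top (by simp) (hψ j)

end BoundedVariationSum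

/-! ### The orthonormal system as a Hilbert basis. -/

section Basis

variable {T : ℝ} [hT : Fact (0 < T)] {φ : ℕ → ℝ → ℝ}

lemma IsBVBasis.memLp (hφ : IsBVBasis T φ) (j : ℕ) (p : ℝ≥0∞) : MemLp (φ j) p (leb T) :=
  (memLp_top_of_boundedVariationOn (hφ.boundedVariation j)).mono_exponent le_top

/-- The basis functions as elements of `L₂[0,T]`. -/
def IsBVBasis.vec (hφ : IsBVBasis T φ) (j : ℕ) : L2 T := (hφ.memLp j 2).toLp (φ j)

lemma IsBVBasis.integral_mul (hφ : IsBVBasis T φ) (u : L2 T) (j : ℕ) :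
    ∫ t, u t * φ j t ∂(leb T) = inner ℝ (hφ.vec j) u := by
  rw [L2.inner_def]
  refine integral_congr_ae ?_
  filter_upwards [(hφ.memLp j 2).coeFn_toLp] with t ht
  simp [IsBVBasis.vec, ht]

lemma IsBVBasis.integral_mul_toLp (hφ : IsBVBasis T φ) {u : ℝ → ℝ} (hu : MemLp u 2 (leb T)) (j : ℕ) :
    ∫ t, u t * φ j t ∂(leb T) = inner ℝ (hφ.vec j) (hu.toLp u) := by
  rw [← hφ.integral_mul]
  refine integral_congr_ae ?_
  filter_upwards [hu.coeFn_toLp] with t ht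
  rw [ht]

lemma IsBVBasis.inner_vec (hφ : IsBVBasis T φ) (i j : ℕ) :
    inner ℝ (hφ.vec i) (hφ.vec j) = if i = j then 1 else 0 := by
  have h := hφ.integral_mul_toLp (hφ.memLp j 2) i
  rw [hφ.orthonormal] at h
  simp only [eq_comm (a := j)] at h
  exact h.symm

/-- The basis functions as a Hilbert basis of `L₂[0,T]`. -/
def IsBVBasis.hilbertBasis (hφ : IsBVBasis T φ) : HilbertBasis ℕ ℝ (L2 T) :=
  HilbertBasis.mkOfOrthogonalEqBot (v := hφ.vec)
    (orthonormal_iff_ite.2 hφ.inner_vec) (by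
      rw [Submodule.eq_bot_iff]
      intro u hu
      refine Lp.ext ((hφ.complete u (Lp.memLp u) fun j => ?_).trans (Lp.coeFn_zero _ _ _).symm)
      rw [hφ.integral_mul]
      exact (Submodule.mem_orthogonal _ _).1 hu _ (Submodule.subset_span ⟨j, rfl⟩))

lemma IsBVBasis.hilbertBasis_apply (hφ : IsBVBasis T φ) (j : ℕ) :
    hφ.hilbertBasis j = hφ.vec j := by
  simp [IsBVBasis.hilbertBasis]

lemma IsBVBasis.hasSum_sq (hφ : IsBVBasis T φ) (u : L2 T) :
    HasSum (fun j => inner ℝ (hφ.vec j) u ^ 2) (‖u‖ ^ 2) := by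
  have h := hφ.hilbertBasis.hasSum_inner_mul_inner u u
  rw [real_inner_self_eq_norm_sq] at h
  simp_rw [hφ.hilbertBasis_apply, real_inner_comm _ u, ← sq] at h
  exact h

lemma IsBVBasis.hasSum_vec (hφ : IsBVBasis T φ) (u : L2 T) :
    HasSum (fun j => inner ℝ (hφ.vec j) u • hφ.vec j) u := by
  have h := hφ.hilbertBasis.hasSum_repr u
  simp_rw [hφ.hilbertBasis.repr_apply_apply, hφ.hilbertBasis_apply] at h
  exact h

end Basis

/-! ### Existence and law of the Paley–Wiener–Zygmund integral. -/

section PartialSums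

variable {T : ℝ} [hT : Fact (0 < T)] {φ : ℕ → ℝ → ℝ} {m : Measure (C0 T)}

/-- Partial sums of the series defining the Paley–Wiener–Zygmund integral. -/
def pwzSum (φ : ℕ → ℝ → ℝ) (n : ℕ) (u : ℝ → ℝ) (x : C0 T) : ℝ :=
  ∑ j ∈ Finset.range n, (∫ t, u t * φ j t ∂(leb T)) * rsIntegral (φ j) x

lemma pwzSum_congr {u v : ℝ → ℝ} (h : u =ᵐ[leb T] v) (n : ℕ) (x : C0 T) :
    pwzSum φ n u x = pwzSum φ n v x := by
  unfold pwzSum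
  refine Finset.sum_congr rfl fun j _ => ?_
  congr 1
  refine integral_congr_ae ?_
  filter_upwards [h] with t ht
  rw [ht]

lemma hasPWZ_congr {u v : ℝ → ℝ} (h : u =ᵐ[leb T] v) (x : C0 T) (a : ℝ) :
    HasPWZ φ u x a ↔ HasPWZ φ v x a := by
  change Tendsto (fun n => pwzSum φ n u x) _ _ ↔ Tendsto (fun n => pwzSum φ n v x) _ _
  simp_rw [pwzSum_congr h]

lemma HasPWZ.pwz_eq {u : ℝ → ℝ} {x : C0 T} {a : ℝ} (h : HasPWZ φ u x a) : pwz φ u x = a := by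
  have hex : ∃ a, HasPWZ φ u x a := ⟨a, h⟩
  rw [pwz, dif_pos hex]
  exact tendsto_nhds_unique hex.choose_spec h

lemma hasPWZ_pwz {u : ℝ → ℝ} {x : C0 T} (h : ∃ a, HasPWZ φ u x a) : HasPWZ φ u x (pwz φ u x) := by
  obtain ⟨a, ha⟩ := h
  rwa [ha.pwz_eq]

lemma pwzSum_coe (hφ : IsBVBasis T φ) (n : ℕ) (u : L2 T) (x : C0 T) :
    pwzSum φ n u x = ∑ j ∈ Finset.range n, inner ℝ (hφ.vec j) u * rsIntegral (φ j) x :=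
  Finset.sum_congr rfl fun j _ => by rw [hφ.integral_mul]

lemma pwzSum_add (hφ : IsBVBasis T φ) (n : ℕ) (u v : L2 T) (x : C0 T) :
    pwzSum φ n (u + v : L2 T) x = pwzSum φ n u x + pwzSum φ n v x := by
  simp only [pwzSum_coe hφ, inner_add_right, add_mul, Finset.sum_add_distrib]

lemma pwzSum_smul (hφ : IsBVBasis T φ) (n : ℕ) (c : ℝ) (u : L2 T) (x : C0 T) :
    pwzSum φ n (c • u : L2 T) x = c * pwzSum φ n u x := by
  simp only [pwzSum_coe hφ, real_inner_smul_right, Finset.mul_sum, mul_assoc]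

lemma pwzSum_add_path (hφ : IsBVBasis T φ) (n : ℕ) (u : ℝ → ℝ) (x y : C0 T) :
    pwzSum φ n u (x + y) = pwzSum φ n u x + pwzSum φ n u y := by
  simp only [pwzSum, rsIntegral_add (hφ.boundedVariation _), mul_add, Finset.sum_add_distrib]

lemma pwzSum_smul_path (hφ : IsBVBasis T φ) (n : ℕ) (u : ℝ → ℝ) (c : ℝ) (x : C0 T) :
    pwzSum φ n u (c • x) = c * pwzSum φ n u x := by
  simp only [pwzSum, rsIntegral_smul (hφ.boundedVariation _), Finset.mul_sum]
  exact Finset.sum_congr rfl fun j _ => by ring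

lemma HasPWZ.add (hφ : IsBVBasis T φ) {u v : L2 T} {x : C0 T} {a b : ℝ} (hu : HasPWZ φ u x a)
    (hv : HasPWZ φ v x b) : HasPWZ φ (u + v : L2 T) x (a + b) :=
  (Tendsto.add hu hv).congr fun n => (pwzSum_add hφ n u v x).symm

lemma HasPWZ.smul (hφ : IsBVBasis T φ) (c : ℝ) {u : L2 T} {x : C0 T} {a : ℝ} (hu : HasPWZ φ u x a) :
    HasPWZ φ (c • u : L2 T) x (c * a) :=
  (Tendsto.const_mul c hu).congr fun n => (pwzSum_smul hφ n c u x).symm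

lemma HasPWZ.sub (hφ : IsBVBasis T φ) {u v : L2 T} {x : C0 T} {a b : ℝ} (hu : HasPWZ φ u x a)
    (hv : HasPWZ φ v x b) : HasPWZ φ (u - v : L2 T) x (a - b) := by
  have := hu.add hφ (hv.smul hφ (-1))
  rwa [neg_one_smul, neg_one_mul, ← sub_eq_add_neg, ← sub_eq_add_neg] at this

lemma HasPWZ.add_path (hφ : IsBVBasis T φ) {u : ℝ → ℝ} {x y : C0 T} {a b : ℝ}
    (hx : HasPWZ φ u x a) (hy : HasPWZ φ u y b) : HasPWZ φ u (x + y) (a + b) :=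
  (Tendsto.add hx hy).congr fun n => (pwzSum_add_path hφ n u x y).symm

lemma HasPWZ.smul_path (hφ : IsBVBasis T φ) (c : ℝ) {u : ℝ → ℝ} {x : C0 T} {a : ℝ}
    (hx : HasPWZ φ u x a) : HasPWZ φ u (c • x) (c * a) :=
  (Tendsto.const_mul c hx).congr fun n => (pwzSum_smul_path hφ n u c x).symm

lemma measurable_pwzSum (hφ : IsBVBasis T φ) (n : ℕ) (u : ℝ → ℝ) :
    Measurable fun x : C0 T => pwzSum φ n u x :=
  Finset.measurable_sum _ fun j _ =>
    (measurable_rsIntegral (hφ.boundedVariation j)).const_mul _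

/-- A finite combination of Stieltjes integrals is the Stieltjes integral of one function of bounded
variation, whose squared norm is given by orthonormality; joint laws of the summands are not needed.
-/
lemma map_sum_rsIntegral (hm : IsWienerMeasure T m) (hφ : IsBVBasis T φ) (F : Finset ℕ)
    (c : ℕ → ℝ) : m.map (fun x => ∑ j ∈ F, c j * rsIntegral (φ j) x) =
      gaussianReal 0 (∑ j ∈ F, c j ^ 2).toNNReal := by
  have hbv := boundedVariationOn_sum F c hφ.boundedVariation
  have h1 : (fun x : C0 T => ∑ j ∈ F, c j * rsIntegral (φ j) x) =
      rsIntegral (fun t => ∑ j ∈ F, c j * φ j t) := by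
    ext x
    refine tendsto_nhds_unique ?_ (tendsto_rsSum hbv x)
    simp_rw [rsSum_sum]
    exact tendsto_finsetSum _ fun j _ => (tendsto_rsSum (hφ.boundedVariation j) x).const_mul _
  rw [h1, map_rsIntegral hm hbv]
  congr 2
  have hint : ∀ i j, Integrable (fun t => φ i t * φ j t) (leb T) := fun i j =>
    (hφ.memLp i 2).integrable_mul (hφ.memLp j 2)
  have h2 : ∀ t, (∑ j ∈ F, c j * φ j t) ^ 2 =
      ∑ i ∈ F, ∑ j ∈ F, c i * c j * (φ i t * φ j t) := by
    intro t
    rw [sq, Finset.sum_mul_sum]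
    exact Finset.sum_congr rfl fun i _ => Finset.sum_congr rfl fun j _ => by ring
  simp_rw [h2]
  rw [integral_finsetSum _ fun i _ => integrable_finsetSum _ fun j _ => (hint i j).const_mul _]
  refine Finset.sum_congr rfl fun i hi => ?_
  rw [integral_finsetSum _ fun j _ => (hint i j).const_mul _]
  simp_rw [integral_const_mul, hφ.orthonormal]
  simp [hi, sq]

lemma lintegral_pwzSum_sub (hm : IsWienerMeasure T m) (hφ : IsBVBasis T φ) (u : L2 T) {k n : ℕ}
    (hkn : k ≤ n) : ∫⁻ x, ‖pwzSum φ n u x - pwzSum φ k u x‖ₑ ^ 4 ∂m = gaussFourth *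
      ENNReal.ofReal (∑ j ∈ Finset.range n, inner ℝ (hφ.vec j) u ^ 2 -
        ∑ j ∈ Finset.range k, inner ℝ (hφ.vec j) u ^ 2) ^ 2 := by
  rw [← Finset.sum_Ico_eq_sub _ hkn]
  simp_rw [pwzSum_coe hφ, ← Finset.sum_Ico_eq_sub _ hkn]
  refine lintegral_enorm_pow_four_of_map_eq ?_ (Finset.sum_nonneg fun _ _ => sq_nonneg _)
    (map_sum_rsIntegral hm hφ _ _)
  exact (Finset.measurable_sum _ fun j _ =>
    (measurable_rsIntegral (hφ.boundedVariation j)).const_mul _).aemeasurable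

/-- The Paley–Wiener–Zygmund integral of an `L₂` function exists almost surely. -/
theorem ae_hasPWZ (hm : IsWienerMeasure T m) (hφ : IsBVBasis T φ) (u : L2 T) :
    ∀ᵐ x ∂m, HasPWZ φ u x (pwz φ u x) := by
  have h := ae_cauchySeq_of_fourth_moment (P := m) (X := fun n x => pwzSum φ n u x)
    (τ := fun n => ∑ j ∈ Finset.range n, inner ℝ (hφ.vec j) u ^ 2) gaussFourth_ne_top
    (fun n => (measurable_pwzSum hφ n u).aemeasurable)
    (fun s t hst => (lintegral_pwzSum_sub hm hφ u hst).le) (hφ.hasSum_sq u).tendsto_sum_nat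
    (fun a b hab => Finset.sum_le_sum_of_subset_of_nonneg (Finset.range_mono hab)
      fun _ _ _ => sq_nonneg _)
  filter_upwards [h] with x hx
  exact hasPWZ_pwz (cauchySeq_tendsto_of_complete hx)

lemma aemeasurable_pwz (hm : IsWienerMeasure T m) (hφ : IsBVBasis T φ) (u : L2 T) :
    AEMeasurable (fun x => pwz φ u x) m :=
  aemeasurable_of_tendsto_metrizable_ae' (fun n => (measurable_pwzSum hφ n u).aemeasurable)
    (ae_hasPWZ hm hφ u)

lemma map_pwz (hm : IsWienerMeasure T m) (hφ : IsBVBasis T φ) (u : L2 T) :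
    m.map (fun x => pwz φ u x) = gaussianReal 0 (‖u‖ ^ 2).toNNReal := by
  have := hm.isProbabilityMeasure
  refine map_eq_gaussianReal_of_tendsto (X := fun n x => pwzSum φ n u x)
    (fun n => (measurable_pwzSum hφ n u).aemeasurable)
    (fun n => Finset.sum_nonneg fun j _ => sq_nonneg (inner ℝ (hφ.vec j) u)) (fun n => ?_)
    (ae_hasPWZ hm hφ u) (hφ.hasSum_sq u).tendsto_sum_nat
  simp_rw [pwzSum_coe hφ]
  exact map_sum_rsIntegral hm hφ _ _

lemma lintegral_pwz_pow_four (hm : IsWienerMeasure T m) (hφ : IsBVBasis T φ) (u : L2 T) :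
    ∫⁻ x, ‖pwz φ u x‖ₑ ^ 4 ∂m = gaussFourth * ENNReal.ofReal (‖u‖ ^ 2) ^ 2 :=
  lintegral_enorm_pow_four_of_map_eq (aemeasurable_pwz hm hφ u) (sq_nonneg _) (map_pwz hm hφ u)

lemma integral_cexp_pwz (hm : IsWienerMeasure T m) (hφ : IsBVBasis T φ) (u : L2 T) (t : ℝ) :
    ∫ x, Complex.exp (t * pwz φ u x * Complex.I) ∂m =
      Complex.exp (-(‖u‖ ^ 2 * t ^ 2 / 2)) := by
  have := integral_cexp_of_map_eq_gaussianReal (aemeasurable_pwz hm hφ u) (sq_nonneg _)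
    (map_pwz hm hφ u) t
  rw [this]; push_cast; rfl

lemma ae_pwz_sub (hm : IsWienerMeasure T m) (hφ : IsBVBasis T φ) (u v : L2 T) :
    ∀ᵐ x ∂m, pwz φ (u - v : L2 T) x = pwz φ u x - pwz φ v x := by
  filter_upwards [ae_hasPWZ hm hφ u, ae_hasPWZ hm hφ v] with x hu hv
  exact (hu.sub hφ hv).pwz_eq

end PartialSums

/-! ### Continuity of the Gaussian process `Z_h`. -/

section GaussPath

variable {T : ℝ} [hT : Fact (0 < T)] {φ : ℕ → ℝ → ℝ} {m : Measure (C0 T)}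

lemma exists_ae_abs_le {T : ℝ} {h : ℝ → ℝ} (hh : MemLp h ∞ (leb T)) :
    ∃ M : ℝ, 0 ≤ M ∧ ∀ᵐ t ∂(leb T), |h t| ≤ M := by
  refine ⟨(eLpNorm h ∞ (leb T)).toReal, ENNReal.toReal_nonneg, ?_⟩
  have h1 := ae_le_eLpNormEssSup (f := h) (μ := leb T)
  filter_upwards [h1] with t ht
  rw [← eLpNorm_exponent_top] at ht
  rw [← Real.norm_eq_abs, ← toReal_enorm]
  exact ENNReal.toReal_mono hh.2.ne ht

lemma norm_sq_eq_integral {T : ℝ} (u : L2 T) : ‖u‖ ^ 2 = ∫ t, u t ^ 2 ∂(leb T) := by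
  rw [← real_inner_self_eq_norm_sq, L2.inner_def]
  simp [sq]

lemma memLp_indicator {T : ℝ} {h : ℝ → ℝ} (hh : MemLp h ∞ (leb T)) (t : ℝ) :
    MemLp ((Set.Icc 0 t).indicator h) 2 (leb T) :=
  (hh.mono_exponent le_top).indicator measurableSet_Icc

/-- The function `h 1_{[0,t]}` as an element of `L₂[0,T]`. -/
def indVec {T : ℝ} {h : ℝ → ℝ} (hh : MemLp h ∞ (leb T)) (t : ℝ) : L2 T :=
  (memLp_indicator hh t).toLp _

lemma coeFn_indVec {T : ℝ} {h : ℝ → ℝ} (hh : MemLp h ∞ (leb T)) (t : ℝ) :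
    indVec hh t =ᵐ[leb T] (Set.Icc 0 t).indicator h := MemLp.coeFn_toLp _

lemma coeFn_indVec_sub {T : ℝ} {h : ℝ → ℝ} (hh : MemLp h ∞ (leb T)) {s t : ℝ} (hs : 0 ≤ s)
    (hst : s ≤ t) : (indVec hh t - indVec hh s : L2 T) =ᵐ[leb T] (Set.Ioc s t).indicator h := by
  filter_upwards [Lp.coeFn_sub (indVec hh t) (indVec hh s), coeFn_indVec hh t, coeFn_indVec hh s]
    with r h1 h2 h3
  rw [h1, Pi.sub_apply, h2, h3]
  by_cases hr0 : 0 ≤ r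
  · by_cases hrs : r ≤ s
    · simp [Set.indicator, hr0, hrs, hrs.trans hst]
    · by_cases hrt : r ≤ t
      · simp [Set.indicator, hr0, hrs, hrt, lt_of_not_ge hrs]
      · simp [Set.indicator, hrs, hrt]
  · have : ¬ s < r := fun h => hr0 (hs.trans h.le)
    simp [Set.indicator, hr0, this]

lemma norm_indVec_sub_sq_le {T : ℝ} {h : ℝ → ℝ} (hh : MemLp h ∞ (leb T)) {M : ℝ}
    (hM : ∀ᵐ t ∂(leb T), |h t| ≤ M) {s t : ℝ} (hs : 0 ≤ s) (hst : s ≤ t) :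
    ‖indVec hh t - indVec hh s‖ ^ 2 ≤ M ^ 2 * (t - s) := by
  rw [norm_sq_eq_integral]
  calc ∫ r, (indVec hh t - indVec hh s : L2 T) r ^ 2 ∂(leb T)
      ≤ ∫ r, (Set.Ioc s t).indicator (fun _ => M ^ 2) r ∂(leb T) := by
        refine integral_mono_ae (Lp.memLp _).integrable_sq
          ((integrable_const _).indicator measurableSet_Ioc) ?_
        filter_upwards [coeFn_indVec_sub hh hs hst, hM] with r h1 h2
        rw [h1]
        by_cases hr : r ∈ Set.Ioc s t
        · rw [Set.indicator_of_mem hr, Set.indicator_of_mem hr, ← sq_abs]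
          gcongr
        · rw [Set.indicator_of_notMem hr, Set.indicator_of_notMem hr]; simp
    _ ≤ M ^ 2 * (t - s) := by
        rw [integral_indicator measurableSet_Ioc, setIntegral_const, smul_eq_mul, mul_comm]
        gcongr
        rw [measureReal_def, ← ENNReal.toReal_ofReal (sub_nonneg.2 hst), ← Real.volume_Ioc]
        exact ENNReal.toReal_mono (by simp) (Measure.restrict_le_self _)

lemma norm_indVec_sub_sq_le' {h : ℝ → ℝ} (hh : MemLp h ∞ (leb T)) {M : ℝ}
    (hM : ∀ᵐ t ∂(leb T), |h t| ≤ M) (s t : Set.Icc (0 : ℝ) T) :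
    ‖indVec hh t - indVec hh s‖ ^ 2 ≤ M ^ 2 * |(t : ℝ) - s| := by
  rcases le_total (s : ℝ) t with hst | hst
  · rw [abs_of_nonneg (sub_nonneg.2 hst)]
    exact norm_indVec_sub_sq_le hh hM s.2.1 hst
  · rw [abs_sub_comm, abs_of_nonneg (sub_nonneg.2 hst), norm_sub_rev]
    exact norm_indVec_sub_sq_le hh hM t.2.1 hst

lemma continuous_indVec {h : ℝ → ℝ} (hh : MemLp h ∞ (leb T)) :
    Continuous fun t : Set.Icc (0 : ℝ) T => indVec hh t := by
  obtain ⟨M, -, hM⟩ := exists_ae_abs_le hh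
  refine continuous_iff_continuousAt.2 fun s => ?_
  rw [ContinuousAt, tendsto_iff_norm_sub_tendsto_zero]
  have h1 : Tendsto (fun t : Set.Icc (0 : ℝ) T => √(M ^ 2 * |(t : ℝ) - s|)) (𝓝 s) (𝓝 0) := by
    have : Continuous fun t : Set.Icc (0 : ℝ) T => √(M ^ 2 * |(t : ℝ) - s|) := by fun_prop
    simpa using this.tendsto s
  exact squeeze_zero (fun _ => norm_nonneg _)
    (fun t => Real.le_sqrt_of_sq_le (norm_indVec_sub_sq_le' hh hM s t)) h1

lemma continuous_pwzSum_indVec (hφ : IsBVBasis T φ) {h : ℝ → ℝ} (hh : MemLp h ∞ (leb T)) (n : ℕ)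
    (x : C0 T) : Continuous fun t : Set.Icc (0 : ℝ) T => pwzSum φ n (indVec hh t) x := by
  simp_rw [pwzSum_coe hφ]
  exact continuous_finsetSum _ fun j _ =>
    (continuous_const.inner (continuous_indVec hh)).mul continuous_const

lemma measurable_pwzSum_pi (hφ : IsBVBasis T φ) (N : ℕ) (u : ℝ → ℝ) :
    Measurable fun x : C0 T => fun n : Fin N => pwzSum φ n u x :=
  measurable_pi_lambda _ fun n => measurable_pwzSum hφ n u

/-- The maximal inequality in the number of terms, started at the empty partial sum `0`, with
Bessel's inequality bounding the clock. -/
lemma lintegral_iSup_pwzSum_le (hm : IsWienerMeasure T m) (hφ : IsBVBasis T φ) (u : L2 T) :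
    ∫⁻ x, ⨆ n, ‖pwzSum φ n u x‖ₑ ^ 4 ∂m ≤
      maxConst * gaussFourth * ENNReal.ofReal (‖u‖ ^ 2) ^ 2 := by
  have h := lintegral_iSup_edist_pow_four_le (P := m) (X := fun n x => pwzSum φ n u x)
    (τ := fun n => ∑ j ∈ Finset.range n, inner ℝ (hφ.vec j) u ^ 2) (K := gaussFourth)
    (fun s t => ((measurable_pwzSum hφ s u).edist (measurable_pwzSum hφ t u)).aemeasurable)
    (fun s t hst => by
      simp_rw [edist_comm (pwzSum φ s _ _), edist_eq_enorm_sub]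
      exact (lintegral_pwzSum_sub hm hφ u hst).le) id 0 (‖u‖ ^ 2)
    (fun k => ⟨Nat.zero_le _, by
      simpa using sum_le_hasSum _ (fun _ _ => sq_nonneg _) (hφ.hasSum_sq u)⟩)
  simpa [pwzSum, edist_eq_enorm_sub] using h

/-- The maximal inequality again, now in time, for the process whose value is the vector of the
first `N` partial sums under the sup distance; its increments are controlled by
`lintegral_iSup_pwzSum_le`. The bound is free of `N`, so monotone convergence gives control uniform
in the number of terms. -/
lemma lintegral_iSup_pwzSum_indVec_le (hm : IsWienerMeasure T m) (hφ : IsBVBasis T φ) {h : ℝ → ℝ}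
    (hh : MemLp h ∞ (leb T)) {M : ℝ} (hM : ∀ᵐ t ∂(leb T), |h t| ≤ M) (a : Set.Icc (0 : ℝ) T)
    (d : ℕ → Set.Icc (0 : ℝ) T) (w : ℝ) (hd : ∀ k, a ≤ d k ∧ (d k : ℝ) - a ≤ w) :
    ∫⁻ x, ⨆ N : ℕ, ⨆ k, edist (fun n : Fin N => pwzSum φ n (indVec hh a) x)
      (fun n : Fin N => pwzSum φ n (indVec hh (d k)) x) ^ 4 ∂m ≤
      maxConst * (maxConst * gaussFourth * ENNReal.ofReal (M ^ 2) ^ 2) * ENNReal.ofReal w ^ 2 := by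
  have hmeas : ∀ (N : ℕ) (s t : Set.Icc (0 : ℝ) T), AEMeasurable
      (fun x => edist (fun n : Fin N => pwzSum φ n (indVec hh s) x)
        (fun n : Fin N => pwzSum φ n (indVec hh t) x)) m := fun N s t =>
    ((measurable_pwzSum_pi hφ N _).edist (measurable_pwzSum_pi hφ N _)).aemeasurable
  rw [lintegral_iSup' (fun N => .iSup fun k => (hmeas N _ _).pow_const 4)]
  · refine iSup_le fun N => lintegral_iSup_edist_pow_four_le
      (X := fun (t : Set.Icc (0 : ℝ) T) x => fun n : Fin N => pwzSum φ n (indVec hh t) x)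
      (τ := fun t => (t : ℝ)) (hmeas N) (fun s t hst => ?_) d a w hd
    calc ∫⁻ x, edist (fun n : Fin N => pwzSum φ n (indVec hh s) x)
          (fun n : Fin N => pwzSum φ n (indVec hh t) x) ^ 4 ∂m
        ≤ ∫⁻ x, ⨆ n, ‖pwzSum φ n (indVec hh t - indVec hh s : L2 T) x‖ₑ ^ 4 ∂m := by
          refine lintegral_mono fun x => ?_
          rw [edist_pi_def, Finset.apply_sup_eq_sup_comp (fun y : ℝ≥0∞ => y ^ 4) (fun x y =>
            (pow_left_mono 4).map_sup x y) (by simp)]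
          refine Finset.sup_le fun n _ => le_iSup_of_le (n : ℕ) ?_
          have h1 := pwzSum_add hφ n (indVec hh t - indVec hh s) (indVec hh s) x
          rw [sub_add_cancel] at h1
          rw [Function.comp, edist_comm, edist_eq_enorm_sub, h1, add_sub_cancel_right]
      _ ≤ _ := lintegral_iSup_pwzSum_le hm hφ _
      _ ≤ maxConst * gaussFourth * ENNReal.ofReal (M ^ 2 * (t - s)) ^ 2 := by
          gcongr
          exact norm_indVec_sub_sq_le hh hM s.2.1 hst
      _ = _ := by
          rw [ENNReal.ofReal_mul (sq_nonneg M)]; ring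
  · refine Eventually.of_forall fun x N N' hN => iSup_mono fun k => pow_le_pow_left₀ zero_le ?_ 4
    rw [edist_pi_le_iff]
    exact fun n => edist_le_pi_edist (fun n : Fin N' => pwzSum φ n (indVec hh a) x)
      (fun n : Fin N' => pwzSum φ n (indVec hh (d k)) x) (Fin.castLE hN n)

/-- The points of the uniform partition of `[0,T]`. -/
def gridPt (T : ℝ) [hT : Fact (0 < T)] (n i : ℕ) : Set.Icc (0 : ℝ) T :=
  Set.projIcc 0 T hT.out.le (i * T / n)

lemma coe_gridPt {n i : ℕ} (hi : i ≤ n) : (gridPt T n i : ℝ) = i * T / n := by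
  rw [gridPt, Set.projIcc_of_mem hT.out.le (grid_mem hi)]

lemma gridPt_le {n i : ℕ} (hi : i < n) : gridPt T n i ≤ gridPt T n (i + 1) := by
  have h0 := hT.out
  rw [← Subtype.coe_le_coe, coe_gridPt hi.le, coe_gridPt hi]
  gcongr; omega

/-- Equicontinuity of the partial sums as functions of time. Over `M` intervals of length `T / M`
the summed fourth moments are of order `M (T / M) ^ 2 = T ^ 2 / M`, so the infimum over `M` vanishes
almost everywhere. -/
lemma ae_uniform_oscillation (hm : IsWienerMeasure T m) (hφ : IsBVBasis T φ) {h : ℝ → ℝ}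
    (hh : MemLp h ∞ (leb T)) : ∀ᵐ x ∂m, ∀ ε : ℝ≥0∞, 0 < ε → ∃ M : ℕ, 0 < M ∧
      ∀ i < M, ∀ n : ℕ, ∀ t : Set.Icc (0 : ℝ) T, gridPt T M i ≤ t → t ≤ gridPt T M (i + 1) →
        edist (pwzSum φ n (indVec hh t) x) (pwzSum φ n (indVec hh (gridPt T M i)) x) ≤ ε := by
  obtain ⟨B, hB0, hB⟩ := exists_ae_abs_le hh
  have : Nonempty (Set.Icc (0 : ℝ) T) := ⟨gridPt T 0 0⟩
  set q : ℕ → Set.Icc (0 : ℝ) T := TopologicalSpace.denseSeq _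
  -- A dense sequence clamped to the `i`-th grid interval: a countable supremum over it is
  -- measurable, and continuity of each partial sum in time extends the bound to the whole interval.
  set d : ℕ → ℕ → ℕ → Set.Icc (0 : ℝ) T := fun M i k => gridPt T M i ⊔ (gridPt T M (i + 1) ⊓ q k)
  set O : ℕ → ℕ → C0 T → ℝ≥0∞ := fun M i x => ⨆ N : ℕ, ⨆ k,
    edist (fun n : Fin N => pwzSum φ n (indVec hh (gridPt T M i)) x)
      (fun n : Fin N => pwzSum φ n (indVec hh (d M i k)) x) ^ 4
  have hOm : ∀ M i, AEMeasurable (O M i) m := fun M i => .iSup fun N => .iSup fun k =>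
    ((measurable_pwzSum_pi hφ N _).edist (measurable_pwzSum_pi hφ N _)).aemeasurable.pow_const 4
  set K : ℝ≥0∞ := maxConst * (maxConst * gaussFourth * ENNReal.ofReal (B ^ 2) ^ 2)
  have hK : K ≠ ∞ := ENNReal.mul_ne_top (by simp [maxConst]) (ENNReal.mul_ne_top
    (ENNReal.mul_ne_top (by simp [maxConst]) gaussFourth_ne_top) (by simp))
  have h1 : ∀ M : ℕ, ∫⁻ x, ⨅ M : ℕ, ∑ i ∈ Finset.range (M + 1), O (M + 1) i x ∂m ≤
      K * ENNReal.ofReal (T ^ 2 / (M + 1 : ℕ)) := by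
    intro M
    refine (lintegral_mono fun x => iInf_le _ M).trans ?_
    rw [lintegral_finsetSum' _ fun i _ => hOm _ i]
    have h2 : ∀ i ∈ Finset.range (M + 1), ∫⁻ x, O (M + 1) i x ∂m ≤
        K * ENNReal.ofReal (T / (M + 1 : ℕ)) ^ 2 := by
      intro i hi
      have hi' := Finset.mem_range.1 hi
      refine lintegral_iSup_pwzSum_indVec_le hm hφ hh hB _ (d (M + 1) i) _ fun k =>
        ⟨le_sup_left, ?_⟩
      have h3 : d (M + 1) i k ≤ gridPt T (M + 1) (i + 1) := sup_le (gridPt_le hi') inf_le_left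
      rw [← Subtype.coe_le_coe, coe_gridPt (n := M + 1) hi'] at h3
      rw [coe_gridPt hi'.le]
      have : ((i + 1 : ℕ) : ℝ) * T / (M + 1 : ℕ) - i * T / (M + 1 : ℕ) = T / (M + 1 : ℕ) := by
        push_cast; ring
      linarith
    refine (Finset.sum_le_sum h2).trans (le_of_eq ?_)
    rw [Finset.sum_const, Finset.card_range, nsmul_eq_mul, mul_left_comm]
    congr 1
    have h0 := hT.out
    rw [← ENNReal.ofReal_natCast, ← ENNReal.ofReal_pow (by positivity), ← ENNReal.ofReal_mul
      (by positivity)]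
    congr 1
    field_simp
  have h2 : Tendsto (fun M : ℕ => K * ENNReal.ofReal (T ^ 2 / (M + 1 : ℕ))) atTop (𝓝 0) := by
    have h3 := ENNReal.tendsto_ofReal
      ((tendsto_const_div_atTop_nhds_zero_nat (T ^ 2)).comp (tendsto_add_atTop_nat 1))
    have h4 := ENNReal.Tendsto.const_mul (a := K) h3 (Or.inr hK)
    simpa using h4
  have h3 : ∫⁻ x, ⨅ M : ℕ, ∑ i ∈ Finset.range (M + 1), O (M + 1) i x ∂m = 0 :=
    le_antisymm (ge_of_tendsto' h2 h1) zero_le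
  rw [lintegral_eq_zero_iff' (.iInf fun M => Finset.aemeasurable_fun_sum _ fun i _ => hOm _ _)] at h3
  filter_upwards [h3] with x hx ε hε
  have h4 : ⨅ M : ℕ, ∑ i ∈ Finset.range (M + 1), O (M + 1) i x < ε ^ 4 := by
    rw [show _ = (0 : ℝ≥0∞) from hx]; exact ENNReal.pow_pos hε 4
  obtain ⟨M, hM⟩ := iInf_lt_iff.1 h4
  refine ⟨M + 1, M.succ_pos, fun i hi n t hat htb => ?_⟩
  set a := gridPt T (M + 1) i
  set b := gridPt T (M + 1) (i + 1)
  have h5 : ∀ k, edist (pwzSum φ n (indVec hh (d (M + 1) i k)) x) (pwzSum φ n (indVec hh a) x) ≤ ε := by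
    intro k
    have h6 : edist (pwzSum φ n (indVec hh a) x) (pwzSum φ n (indVec hh (d (M + 1) i k)) x) ^ 4
        ≤ O (M + 1) i x := by
      refine le_iSup_of_le (n + 1) (le_iSup_of_le k (pow_le_pow_left₀ zero_le ?_ 4))
      exact edist_le_pi_edist (fun n : Fin (n + 1) => pwzSum φ n (indVec hh a) x)
        (fun n : Fin (n + 1) => pwzSum φ n (indVec hh (d (M + 1) i k)) x) (Fin.last n)
    have h7 : O (M + 1) i x ≤ ∑ i ∈ Finset.range (M + 1), O (M + 1) i x :=
      Finset.single_le_sum (f := fun i => O (M + 1) i x) (fun _ _ => zero_le)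
        (Finset.mem_range.2 hi)
    have h8 := (h6.trans h7).trans_lt hM
    rw [edist_comm]
    exact (lt_of_not_ge fun h => not_lt.2 (pow_le_pow_left₀ zero_le h 4) h8).le
  have hcl : IsClosed {s : Set.Icc (0 : ℝ) T |
      edist (pwzSum φ n (indVec hh (a ⊔ (b ⊓ s) : Set.Icc (0 : ℝ) T)) x)
        (pwzSum φ n (indVec hh a) x) ≤ ε} := by
    refine isClosed_le (((continuous_pwzSum_indVec hφ hh n x).comp ?_).edist continuous_const)
      continuous_const
    exact continuous_const.sup (continuous_const.inf continuous_id)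
  have hall := (TopologicalSpace.denseRange_denseSeq (Set.Icc (0 : ℝ) T)).closure_eq ▸
    hcl.closure_subset_iff.2 (Set.range_subset_iff.2 h5)
  have ht := hall (Set.mem_univ t)
  rwa [Set.mem_ofPred_eq, inf_eq_right.2 htb, sup_eq_right.2 hat] at ht

lemma exists_mem_gridPt {M : ℕ} (hM : 0 < M) (t : Set.Icc (0 : ℝ) T) :
    ∃ i < M, gridPt T M i ≤ t ∧ t ≤ gridPt T M (i + 1) := by
  rcases eq_or_lt_of_le t.2.1 with h0 | h0
  · refine ⟨0, hM, ?_, ?_⟩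
    · rw [← Subtype.coe_le_coe, coe_gridPt hM.le]; simpa using t.2.1
    · rw [← Subtype.coe_le_coe, ← h0]; exact (gridPt T M (0 + 1)).2.1
  · obtain ⟨i, hi, h1, h2⟩ := exists_mem_grid hM (t := t) ⟨h0, t.2.2⟩
    refine ⟨i, hi, ?_, ?_⟩
    · rw [← Subtype.coe_le_coe, coe_gridPt hi.le]; exact h1.le
    · rw [← Subtype.coe_le_coe, coe_gridPt hi]; exact h2

/-- Arzelà–Ascoli reasoning: convergence at finitely many grid points plus oscillation uniform in
`n` gives a uniform Cauchy sequence, whose limit is continuous. -/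
lemma exists_path_of_uniform_oscillation {S : ℕ → Set.Icc (0 : ℝ) T → ℝ}
    (hS : ∀ n, Continuous (S n)) (hS0 : ∀ n (t : Set.Icc (0 : ℝ) T), (t : ℝ) = 0 → S n t = 0)
    (hgrid : ∀ M i, ∃ a, Tendsto (fun n => S n (gridPt T M i)) atTop (𝓝 a))
    (hosc : ∀ ε : ℝ≥0∞, 0 < ε → ∃ M : ℕ, 0 < M ∧ ∀ i < M, ∀ n : ℕ, ∀ t : Set.Icc (0 : ℝ) T,
      gridPt T M i ≤ t → t ≤ gridPt T M (i + 1) → edist (S n t) (S n (gridPt T M i)) ≤ ε) :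
    ∃ w : C0 T, ∀ t, Tendsto (fun n => S n t) atTop (𝓝 (w.1 t)) := by
  have hU : ∀ ε > (0 : ℝ), ∃ N, ∀ k ≥ N, ∀ n ≥ N, ∀ t, dist (S k t) (S n t) < ε := by
    intro ε hε
    obtain ⟨M, hM, hosc'⟩ := hosc (ENNReal.ofReal (ε / 4)) (by simpa using by positivity)
    have hc : ∀ i ∈ Finset.range M, ∃ N, ∀ k ≥ N, ∀ n ≥ N,
        dist (S k (gridPt T M i)) (S n (gridPt T M i)) < ε / 4 := fun i _ =>
      Metric.cauchySeq_iff.1 (hgrid M i).choose_spec.cauchySeq (ε / 4) (by positivity)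
    choose! N hN using hc
    refine ⟨(Finset.range M).sup N, fun k hk n hn t => ?_⟩
    obtain ⟨i, hi, h1, h2⟩ := exists_mem_gridPt hM t
    have hi' := Finset.mem_range.2 hi
    have hle : N i ≤ (Finset.range M).sup N := Finset.le_sup hi'
    have h3 := hN i hi' k (hle.trans hk) n (hle.trans hn)
    have h4 : ∀ n, dist (S n t) (S n (gridPt T M i)) ≤ ε / 4 := fun n => by
      have := hosc' i hi n t h1 h2
      rw [edist_dist] at this
      exact (ENNReal.ofReal_le_ofReal_iff (by positivity)).1 this
    have h5 := h4 k
    have h6 := h4 n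
    rw [dist_comm] at h6
    calc dist (S k t) (S n t) ≤ dist (S k t) (S k (gridPt T M i)) +
          dist (S k (gridPt T M i)) (S n (gridPt T M i)) + dist (S n (gridPt T M i)) (S n t) :=
          dist_triangle4 _ _ _ _
      _ < ε := by linarith
  have hlim : ∀ t, ∃ a, Tendsto (fun n => S n t) atTop (𝓝 a) := fun t =>
    cauchySeq_tendsto_of_complete (Metric.cauchySeq_iff.2 fun ε hε => by
      obtain ⟨N, hN⟩ := hU ε hε
      exact ⟨N, fun k hk n hn => hN k hk n hn t⟩)
  choose W hW using hlim
  have huc : UniformCauchySeqOn S atTop Set.univ := by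
    rw [Metric.uniformCauchySeqOn_iff]
    intro ε hε
    obtain ⟨N, hN⟩ := hU ε hε
    exact ⟨N, fun k hk n hn t _ => hN k hk n hn t⟩
  have hunif : TendstoUniformly S W atTop := by
    rw [← tendstoUniformlyOn_univ]
    exact huc.tendstoUniformlyOn_of_tendsto fun t _ => hW t
  refine ⟨⟨⟨W, hunif.continuous (Frequently.of_forall hS)⟩, fun t ht => ?_⟩, hW⟩
  refine tendsto_nhds_unique (hW t) ?_
  simp_rw [hS0 _ t ht]
  exact tendsto_const_nhds

/-- For almost every path `x`, the Gaussian process `Z_h(x,·)` is defined and continuous. -/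
theorem ae_hasPWZ_gaussPath (hm : IsWienerMeasure T m) (hφ : IsBVBasis T φ) {h : ℝ → ℝ}
    (hh : MemLp h ∞ (leb T)) : ∀ᵐ x ∂m, ∀ t : Set.Icc (0 : ℝ) T,
      HasPWZ φ ((Set.Icc 0 (t : ℝ)).indicator h) x ((gaussPath φ h x).1 t) := by
  have h1 : ∀ᵐ x ∂m, ∀ M i, HasPWZ φ (indVec hh (gridPt T M i)) x
      (pwz φ (indVec hh (gridPt T M i)) x) :=
    ae_all_iff.2 fun M => ae_all_iff.2 fun i => ae_hasPWZ hm hφ _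
  filter_upwards [h1, ae_uniform_oscillation hm hφ hh] with x hx hosc
  have hex : ∃ w : C0 T, ∀ t : Set.Icc (0 : ℝ) T,
      HasPWZ φ ((Set.Icc 0 (t : ℝ)).indicator h) x (w.1 t) := by
    have hS0 : ∀ n (t : Set.Icc (0 : ℝ) T), (t : ℝ) = 0 → pwzSum φ n (indVec hh t) x = 0 := by
      intro n t ht
      have : indVec hh (t : ℝ) = 0 := by
        refine Lp.ext (((coeFn_indVec hh t).trans ?_).trans (Lp.coeFn_zero _ _ _).symm)
        filter_upwards [ae_leb_mem_Ioc (T := T)] with r hr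
        rw [ht, Set.indicator_of_notMem fun h => absurd h.2 (not_le.2 hr.1)]
        rfl
      have h2 := pwzSum_smul hφ n 0 (indVec hh t) x
      rw [zero_smul, zero_mul] at h2
      rw [this, h2]
    obtain ⟨w, hw⟩ := exists_path_of_uniform_oscillation
      (S := fun n t => pwzSum φ n (indVec hh t) x)
      (fun n => continuous_pwzSum_indVec hφ hh n x) hS0 (fun M i => ⟨_, hx M i⟩) hosc
    exact ⟨w, fun t => (hasPWZ_congr (coeFn_indVec hh t) x _).1 (hw t)⟩
  rw [gaussPath, dif_pos hex]
  exact hex.choose_spec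

end GaussPath

/-! ### The identity `⟨u, Z_h(x,·)⟩ = ⟨hu, x⟩`. -/

section Multiplication

/-- Multiplication by a function in `L_∞[0,T]` as an operator on `L₂[0,T]`. -/
def mulL {T : ℝ} {h : ℝ → ℝ} (hh : MemLp h ∞ (leb T)) : L2 T →L[ℝ] L2 T :=
  (ContinuousLinearMap.mul ℝ ℝ).holderL (leb T) ∞ 2 2 (hh.toLp h)

lemma coeFn_mulL {T : ℝ} {h : ℝ → ℝ} (hh : MemLp h ∞ (leb T)) (u : L2 T) :
    mulL hh u =ᵐ[leb T] fun t => h t * u t := by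
  filter_upwards [(ContinuousLinearMap.mul ℝ ℝ).coeFn_holder (r := 2) (hh.toLp h) u,
    hh.coeFn_toLp] with t h1 h2
  rw [← h2]
  exact h1

lemma norm_mulL_sq {T : ℝ} {h : ℝ → ℝ} (hh : MemLp h ∞ (leb T)) (u : L2 T) :
    ‖mulL hh u‖ ^ 2 = ∫ t, h t ^ 2 * u t ^ 2 ∂(leb T) := by
  rw [norm_sq_eq_integral]
  refine integral_congr_ae ?_
  filter_upwards [coeFn_mulL hh u] with t ht
  rw [ht, mul_pow]

variable {T : ℝ} [hT : Fact (0 < T)] {φ : ℕ → ℝ → ℝ} {m : Measure (C0 T)}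

lemma hasPWZ_zero (hφ : IsBVBasis T φ) (x : C0 T) : HasPWZ φ (0 : L2 T) x 0 := by
  have : ∀ n, pwzSum φ n (0 : L2 T) x = 0 := fun n => by
    rw [pwzSum_coe hφ]; simp
  exact (tendsto_const_nhds).congr fun n => (this n).symm

lemma HasPWZ.sum (hφ : IsBVBasis T φ) {ι : Type*} (s : Finset ι) {u : ι → L2 T} {x : C0 T} {a : ι → ℝ}
    (hu : ∀ i ∈ s, HasPWZ φ (u i) x (a i)) :
    HasPWZ φ (∑ i ∈ s, u i : L2 T) x (∑ i ∈ s, a i) := by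
  classical
  induction s using Finset.induction_on with
  | empty => exact hasPWZ_zero hφ x
  | insert i s hi ih =>
    rw [Finset.sum_insert hi, Finset.sum_insert hi]
    exact (hu i (Finset.mem_insert_self i s)).add hφ
      (ih fun j hj => hu j (Finset.mem_insert_of_mem hj))

/-- The integral depends continuously on the integrand, in `L₄`. -/
lemma ae_eq_pwz_of_tendsto (hm : IsWienerMeasure T m) (hφ : IsBVBasis T φ) {U : ℕ → L2 T} {u : L2 T}
    (hU : Tendsto U atTop (𝓝 u)) {Y : C0 T → ℝ}
    (hY : ∀ᵐ x ∂m, Tendsto (fun n => pwz φ (U n) x) atTop (𝓝 (Y x))) :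
    ∀ᵐ x ∂m, Y x = pwz φ u x := by
  have h1 : Tendsto (fun n => ∫⁻ x, ‖pwz φ (U n - u : L2 T) x‖ₑ ^ 4 ∂m) atTop (𝓝 0) := by
    simp_rw [lintegral_pwz_pow_four hm hφ]
    have h2 : Tendsto (fun n => ‖U n - u‖ ^ 2) atTop (𝓝 0) := by
      simpa using ((tendsto_iff_norm_sub_tendsto_zero.1 hU).pow 2)
    have h4 := ENNReal.Tendsto.const_mul (a := gaussFourth)
      (ENNReal.Tendsto.pow (n := 2) (ENNReal.tendsto_ofReal h2)) (Or.inr gaussFourth_ne_top)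
    simpa using h4
  -- Fatou's lemma: the fourth moments of `⟨U n - u, ·⟩` tend to zero while the integrands converge
  -- to `|Y - ⟨u, ·⟩| ^ 4`.
  have hlim : ∀ᵐ x ∂m, liminf (fun n => ‖pwz φ (U n - u : L2 T) x‖ₑ ^ 4) atTop =
      ‖Y x - pwz φ u x‖ₑ ^ 4 := by
    filter_upwards [hY, ae_all_iff.2 fun n => ae_pwz_sub hm hφ (U n) u] with x hY h4
    simp_rw [h4]
    exact (ENNReal.Tendsto.pow (hY.sub_const _).enorm).liminf_eq
  have h3 : ∫⁻ x, ‖Y x - pwz φ u x‖ₑ ^ 4 ∂m = 0 := by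
    refine le_antisymm ?_ zero_le
    rw [← lintegral_congr_ae hlim, ← h1.liminf_eq]
    exact lintegral_liminf_le' fun n => (aemeasurable_pwz hm hφ _).enorm.pow_const 4
  have hYm : AEMeasurable Y m :=
    aemeasurable_of_tendsto_metrizable_ae' (fun n => aemeasurable_pwz hm hφ (U n)) hY
  filter_upwards [(lintegral_eq_zero_iff'
    ((hYm.sub (aemeasurable_pwz hm hφ u)).enorm.pow_const 4)).1 h3] with x h3
  exact sub_eq_zero.1 (by simpa using h3)

/-- The `L₂` function whose Paley–Wiener–Zygmund integral is the Riemann–Stieltjes sum of `ψ` along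
the Gaussian path. -/
def stepVec {h : ℝ → ℝ} (hh : MemLp h ∞ (leb T)) (ψ : ℝ → ℝ) (n : ℕ) : L2 T :=
  ∑ i ∈ Finset.range n, ψ (i * T / n) • (indVec hh (gridPt T n (i + 1)) - indVec hh (gridPt T n i))

lemma coeFn_stepVec {h : ℝ → ℝ} (hh : MemLp h ∞ (leb T)) (ψ : ℝ → ℝ) (n : ℕ) :
    stepVec hh ψ n =ᵐ[leb T] fun t => h t * stepFn T ψ n t := by
  have h1 : ∀ᵐ t ∂(leb T), ∀ i ∈ Finset.range n,
      (ψ (i * T / n) • (indVec hh (gridPt T n (i + 1)) - indVec hh (gridPt T n i)) : L2 T) t =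
        ψ (i * T / n) * (Set.Ioc ((i : ℝ) * T / n) ((i + 1 : ℕ) * T / n)).indicator h t := by
    refine (Finset.eventually_all _).2 fun i hi => ?_
    have hi := Finset.mem_range.1 hi
    have h2 := coeFn_indVec_sub hh (gridPt T n i).2.1 (Subtype.coe_le_coe.2 (gridPt_le hi))
    rw [coe_gridPt hi.le, coe_gridPt hi] at h2
    rw [coe_gridPt hi.le, coe_gridPt hi]
    filter_upwards [h2, Lp.coeFn_smul (ψ (i * T / n))
      (indVec hh ((i + 1 : ℕ) * T / n) - indVec hh (i * T / n))] with t h3 h4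
    rw [h4, Pi.smul_apply, h3, smul_eq_mul]
  filter_upwards [h1, Lp.coeFn_finsetSum (Finset.range n) fun i =>
    (ψ (i * T / n) • (indVec hh (gridPt T n (i + 1)) - indVec hh (gridPt T n i)) : L2 T)]
    with t h1 h2
  rw [stepVec, h2, stepFn, Finset.mul_sum]
  rw [Finset.sum_apply]
  refine Finset.sum_congr rfl fun i hi => ?_
  rw [h1 i hi]
  by_cases ht : t ∈ Set.Ioc ((i : ℝ) * T / n) ((i + 1 : ℕ) * T / n)
  · rw [Set.indicator_of_mem ht, Set.indicator_of_mem ht, mul_comm]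
  · rw [Set.indicator_of_notMem ht, Set.indicator_of_notMem ht]; simp

lemma tendsto_stepVec (hφ : IsBVBasis T φ) {h : ℝ → ℝ} (hh : MemLp h ∞ (leb T)) (j : ℕ) :
    Tendsto (stepVec hh (φ j)) atTop (𝓝 (mulL hh (hφ.vec j))) := by
  obtain ⟨M, hM0, hM⟩ := exists_ae_abs_le hh
  obtain ⟨B, hB⟩ := exists_abs_le_of_boundedVariationOn (hφ.boundedVariation j)
  rw [tendsto_iff_norm_sub_tendsto_zero]
  have hB0 : 0 ≤ B := (abs_nonneg _).trans (hB 0 ⟨le_rfl, hT.out.le⟩)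
  have h1 : ∀ n, ‖stepVec hh (φ j) n - mulL hh (hφ.vec j)‖ ^ 2 =
      ∫ t, (h t * (stepFn T (φ j) n t - φ j t)) ^ 2 ∂(leb T) := by
    intro n
    rw [norm_sq_eq_integral]
    refine integral_congr_ae ?_
    filter_upwards [Lp.coeFn_sub (stepVec hh (φ j) n) (mulL hh (hφ.vec j)), coeFn_stepVec hh (φ j) n,
      coeFn_mulL hh (hφ.vec j), (hφ.memLp j 2).coeFn_toLp] with t h1 h2 h3 h4
    rw [h1, Pi.sub_apply, h2, h3, IsBVBasis.vec, h4, mul_sub]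
  have h2 : Tendsto (fun n => ‖stepVec hh (φ j) n - mulL hh (hφ.vec j)‖ ^ 2) atTop (𝓝 0) := by
    simp_rw [h1]
    have h3 : ∫ t, (h t * (φ j t - φ j t)) ^ 2 ∂(leb T) = 0 := by simp
    rw [← h3]
    refine tendsto_integral_of_dominated_convergence (fun _ => (M * (B + B)) ^ 2) (fun n => ?_)
      (integrable_const _) (fun n => ?_) ?_
    · exact (hh.1.mul ((measurable_stepFn _ n).aestronglyMeasurable.sub (hφ.memLp j 2).1)).pow 2
    · have hmem : ∀ᵐ t ∂(leb T), t ∈ Set.Icc 0 T := ae_restrict_mem measurableSet_Icc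
      filter_upwards [hM, hmem] with t h1 h2
      rw [Real.norm_eq_abs, abs_pow, abs_mul]
      gcongr
      exact (abs_sub _ _).trans (add_le_add (abs_stepFn_le hB n t) (hB t h2))
    · filter_upwards [ae_tendsto_stepFn (hφ.boundedVariation j)] with t ht
      exact ((ht.sub_const _).const_mul _).pow 2
  have h3 := h2.sqrt
  simpa using h3

/-- When `x` has a Gaussian path at all times, each Riemann–Stieltjes sum along that path is exactly
the integral of `h` times a step function, and these products converge to `h φ_j` in `L₂`. -/
lemma ae_rsIntegral_gaussPath (hm : IsWienerMeasure T m) (hφ : IsBVBasis T φ) {h : ℝ → ℝ}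
    (hh : MemLp h ∞ (leb T)) (j : ℕ) :
    ∀ᵐ x ∂m, rsIntegral (φ j) (gaussPath φ h x) = pwz φ (mulL hh (hφ.vec j)) x := by
  refine ae_eq_pwz_of_tendsto hm hφ (tendsto_stepVec hφ hh j) ?_
  filter_upwards [ae_hasPWZ_gaussPath hm hφ hh] with x hx
  refine (tendsto_rsSum (hφ.boundedVariation j) (gaussPath φ h x)).congr fun n => ?_
  have h1 : ∀ t : Set.Icc (0 : ℝ) T, HasPWZ φ (indVec hh t) x ((gaussPath φ h x).1 t) := fun t =>
    (hasPWZ_congr (coeFn_indVec hh t) x _).2 (hx t)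
  exact (HasPWZ.pwz_eq (HasPWZ.sum hφ _ fun i _ =>
    ((h1 (gridPt T n (i + 1))).sub hφ (h1 (gridPt T n i))).smul hφ _)).symm

/-- The projection of `u` onto the span of the first `n` basis vectors. -/
def partialProj (hφ : IsBVBasis T φ) (n : ℕ) (u : L2 T) : L2 T :=
  ∑ j ∈ Finset.range n, inner ℝ (hφ.vec j) u • hφ.vec j

lemma norm_partialProj_sub_sq (hφ : IsBVBasis T φ) (u : L2 T) {k n : ℕ} (hkn : k ≤ n) :
    ‖partialProj hφ n u - partialProj hφ k u‖ ^ 2 = ∑ j ∈ Finset.range n, inner ℝ (hφ.vec j) u ^ 2 -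
        ∑ j ∈ Finset.range k, inner ℝ (hφ.vec j) u ^ 2 := by
  rw [partialProj, partialProj, ← Finset.sum_Ico_eq_sub _ hkn, ← Finset.sum_Ico_eq_sub _ hkn,
    ← real_inner_self_eq_norm_sq, sum_inner]
  refine Finset.sum_congr rfl fun i hi => ?_
  rw [inner_sum, Finset.sum_eq_single i]
  · rw [inner_smul_left, inner_smul_right, hφ.inner_vec]; simp [sq]
  · intro j _ hij
    rw [inner_smul_left, inner_smul_right, hφ.inner_vec]; simp [hij.symm]
  · exact fun h => absurd hi h

/-- For almost every `x`, the integral of `u` along the Gaussian path `Z_h(x,·)` is the integral of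
`h u` along `x`. -/
theorem ae_hasPWZ_comp_gaussPath (hm : IsWienerMeasure T m) (hφ : IsBVBasis T φ) {h : ℝ → ℝ}
    (hh : MemLp h ∞ (leb T)) (u : L2 T) :
    ∀ᵐ x ∂m, HasPWZ φ u (gaussPath φ h x) (pwz φ (mulL hh u) x) := by
  have hpw : ∀ᵐ x ∂m, ∀ n, pwzSum φ n u (gaussPath φ h x) = pwz φ (mulL hh (partialProj hφ n u)) x ∧
      HasPWZ φ (mulL hh (partialProj hφ n u)) x (pwz φ (mulL hh (partialProj hφ n u)) x) := by
    filter_upwards [ae_all_iff.2 fun j => ae_rsIntegral_gaussPath hm hφ hh j,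
      ae_all_iff.2 fun j => ae_hasPWZ hm hφ (mulL hh (hφ.vec j))] with x h1 h2 n
    have h3 : HasPWZ φ (mulL hh (partialProj hφ n u)) x (pwzSum φ n u (gaussPath φ h x)) := by
      rw [partialProj, map_sum, pwzSum_coe hφ]
      refine HasPWZ.sum hφ _ fun j _ => ?_
      rw [map_smul, h1]
      exact (h2 j).smul hφ _
    rw [h3.pwz_eq]
    exact ⟨rfl, h3⟩
  -- The vectors `h φ_j` need not be orthogonal, but boundedness of multiplication by `h` bounds the
  -- increments by those of the Bessel sums of `u`, which is all the maximal inequality asks for.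
  have hcauchy : ∀ᵐ x ∂m, CauchySeq fun n => pwz φ (mulL hh (partialProj hφ n u)) x := by
    refine ae_cauchySeq_of_fourth_moment (K := gaussFourth * ENNReal.ofReal (‖mulL hh‖ ^ 2) ^ 2)
      (τ := fun n => ∑ j ∈ Finset.range n, inner ℝ (hφ.vec j) u ^ 2)
      (ENNReal.mul_ne_top gaussFourth_ne_top (by simp)) (fun n => aemeasurable_pwz hm hφ _)
      (fun s t hst => ?_) (hφ.hasSum_sq u).tendsto_sum_nat
      (fun a b hab => Finset.sum_le_sum_of_subset_of_nonneg (Finset.range_mono hab)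
        fun _ _ _ => sq_nonneg _)
    have h1 : ∫⁻ x, ‖pwz φ (mulL hh (partialProj hφ t u)) x -
        pwz φ (mulL hh (partialProj hφ s u)) x‖ₑ ^ 4 ∂m =
        ∫⁻ x, ‖pwz φ (mulL hh (partialProj hφ t u) - mulL hh (partialProj hφ s u) : L2 T) x‖ₑ ^ 4 ∂m := by
      refine lintegral_congr_ae ?_
      filter_upwards [ae_pwz_sub hm hφ (mulL hh (partialProj hφ t u))
        (mulL hh (partialProj hφ s u))] with x hx
      rw [hx]
    rw [h1, lintegral_pwz_pow_four hm hφ, mul_assoc, ← mul_pow,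
      ← ENNReal.ofReal_mul (sq_nonneg _), ← map_sub]
    gcongr
    rw [← norm_partialProj_sub_sq hφ u hst, ← mul_pow]
    gcongr
    exact (mulL hh).le_opNorm _
  have hlim := ae_eq_pwz_of_tendsto hm hφ (U := fun n => mulL hh (partialProj hφ n u))
    (u := mulL hh u) (Y := fun x => limUnder atTop fun n => pwz φ (mulL hh (partialProj hφ n u)) x)
    (((mulL hh).continuous.tendsto u).comp (hφ.hasSum_vec u).tendsto_sum_nat)
    (hcauchy.mono fun x hx => tendsto_nhds_limUnder (cauchySeq_tendsto_of_complete hx))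
  filter_upwards [hpw, hcauchy, hlim] with x h1 h2 h3
  have h4 := tendsto_nhds_limUnder (cauchySeq_tendsto_of_complete h2)
  rw [h3] at h4
  exact h4.congr fun n => (h1 n).1.symm

end Multiplication

/-! ### Joint measurability and Fubini for null sets. -/

section JointMeasurability

variable {T : ℝ} [hT : Fact (0 < T)] {φ : ℕ → ℝ → ℝ} {m : Measure (C0 T)}

lemma measurable_pwzSum_prod (hφ : IsBVBasis T φ) (n : ℕ) :
    Measurable fun p : L2 T × C0 T => pwzSum φ n p.1 p.2 := by
  simp_rw [pwzSum_coe hφ]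
  refine Finset.measurable_sum _ fun j _ => Measurable.mul ?_ ?_
  · exact (continuous_const.inner continuous_id).measurable.comp measurable_fst
  · exact (measurable_rsIntegral (hφ.boundedVariation j)).comp measurable_snd

lemma measurableSet_exists_hasPWZ (hφ : IsBVBasis T φ) :
    MeasurableSet {p : L2 T × C0 T | ∃ a, HasPWZ φ p.1 p.2 a} :=
  measurableSet_exists_tendsto fun n => measurable_pwzSum_prod hφ n

lemma measurable_pwz_prod (hφ : IsBVBasis T φ) :
    Measurable fun p : L2 T × C0 T => pwz φ p.1 p.2 := by
  refine measurable_of_tendsto_metrizable (f := fun n =>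
    {p : L2 T × C0 T | ∃ a, HasPWZ φ p.1 p.2 a}.indicator fun p => pwzSum φ n p.1 p.2)
    (fun n => (measurable_pwzSum_prod hφ n).indicator (measurableSet_exists_hasPWZ hφ)) ?_
  refine tendsto_pi_nhds.2 fun p => ?_
  by_cases hp : ∃ a, HasPWZ φ p.1 p.2 a
  · have : p ∈ {p : L2 T × C0 T | ∃ a, HasPWZ φ p.1 p.2 a} := hp
    simp_rw [Set.indicator_of_mem this]
    exact hasPWZ_pwz hp
  · have : p ∉ {p : L2 T × C0 T | ∃ a, HasPWZ φ p.1 p.2 a} := hp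
    simp_rw [Set.indicator_of_notMem this, pwz, dif_neg hp]
    exact tendsto_const_nhds

lemma IsWienerMeasure.sFinite {T : ℝ} {m : Measure (C0 T)} (hm : IsWienerMeasure T m) : SFinite m :=
  have := hm.isProbabilityMeasure
  have : IsFiniteMeasure m := IsZeroOrProbabilityMeasure.toIsFiniteMeasure m
  have : SigmaFinite m := IsFiniteMeasure.toSigmaFinite m
  instSFiniteOfSigmaFinite

section Comp

variable {Ω : Type*} [MeasurableSpace Ω] {W : Ω → L2 T}

lemma measurable_comp_fst_snd (hW : Measurable W) :
    Measurable fun p : Ω × C0 T => (W p.1, p.2) :=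
  (hW.comp measurable_fst).prodMk measurable_snd

lemma measurableSet_exists_hasPWZ_comp (hφ : IsBVBasis T φ) (hW : Measurable W) :
    MeasurableSet {p : Ω × C0 T | ∃ a, HasPWZ φ (W p.1) p.2 a} := by
  have h := measurable_comp_fst_snd hW (measurableSet_exists_hasPWZ hφ)
  rw [Set.preimage_ofPred_eq] at h
  exact h

lemma measurable_pwz_comp (hφ : IsBVBasis T φ) (hW : Measurable W) :
    Measurable fun p : Ω × C0 T => pwz φ (W p.1) p.2 := by
  have h := (measurable_pwz_prod hφ).comp (measurable_comp_fst_snd hW)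
  simp only [Function.comp_def] at h
  exact h

end Comp

variable {Ω : Type*} [MeasurableSpace Ω] (μ : Measure Ω) [SFinite μ] {W : Ω → L2 T}

lemma ae_ae_hasPWZ (hm : IsWienerMeasure T m) (hφ : IsBVBasis T φ) (hW : Measurable W) :
    ∀ᵐ x ∂m, ∀ᵐ ω ∂μ, ∃ a, HasPWZ φ (W ω) x a := by
  have := hm.sFinite
  refine (Measure.ae_ae_comm (p := fun ω x => ∃ a, HasPWZ φ (W ω) x a)
    (μ := μ) (ν := m) (measurableSet_exists_hasPWZ_comp hφ hW)).1 (.of_forall fun ω => ?_)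
  exact (ae_hasPWZ hm hφ (W ω)).mono fun x hx => ⟨_, hx⟩

/-- Exchanging the quantifiers over `ω` and `x` requires a jointly measurable set, and `gaussPath`
involves a choice. The path is therefore replaced by measurable versions `ξ j` of its countably many
Stieltjes integrals, which determine every partial sum. -/
lemma ae_ae_hasPWZ_comp_gaussPath (hm : IsWienerMeasure T m) (hφ : IsBVBasis T φ) {h : ℝ → ℝ}
    (hh : MemLp h ∞ (leb T)) (hW : Measurable W) :
    ∀ᵐ x ∂m, ∀ᵐ ω ∂μ, HasPWZ φ (W ω) (gaussPath φ h x) (pwz φ (mulL hh (W ω)) x) := by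
  have := hm.sFinite
  have hmk := fun j => aemeasurable_pwz hm hφ (mulL hh (hφ.vec j))
  set ξ : ℕ → C0 T → ℝ := fun j => (hmk j).mk _
  have hξ : ∀ j, Measurable (ξ j) := fun j => (hmk j).measurable_mk
  have hY : ∀ n, Measurable fun p : Ω × C0 T =>
      ∑ j ∈ Finset.range n, inner ℝ (hφ.vec j) (W p.1) * ξ j p.2 := by
    refine fun n => Finset.measurable_sum _ fun j _ => Measurable.mul ?_ ?_
    · exact (continuous_const.inner continuous_id).measurable.comp (hW.comp measurable_fst)
    · exact (hξ j).comp measurable_snd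
  have hpw : Measurable fun p : Ω × C0 T => pwz φ (mulL hh (W p.1)) p.2 :=
    measurable_pwz_comp (W := fun ω => mulL hh (W ω)) hφ ((mulL hh).continuous.measurable.comp hW)
  have hset : MeasurableSet {p : Ω × C0 T | Tendsto (fun n =>
      ∑ j ∈ Finset.range n, inner ℝ (hφ.vec j) (W p.1) * ξ j p.2 - pwz φ (mulL hh (W p.1)) p.2)
      atTop (𝓝 0)} :=
    measurableSet_tendsto (𝓝 0) fun n => (hY n).sub hpw
  have hae : ∀ᵐ x ∂m, ∀ j, rsIntegral (φ j) (gaussPath φ h x) = ξ j x := by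
    refine ae_all_iff.2 fun j => ?_
    filter_upwards [ae_rsIntegral_gaussPath hm hφ hh j, (hmk j).ae_eq_mk] with x h1 h2
    rw [h1, h2]
  have hiff : ∀ᵐ x ∂m, ∀ u : L2 T, HasPWZ φ u (gaussPath φ h x) (pwz φ (mulL hh u) x) ↔
      Tendsto (fun n => ∑ j ∈ Finset.range n, inner ℝ (hφ.vec j) u * ξ j x -
        pwz φ (mulL hh u) x) atTop (𝓝 0) := by
    filter_upwards [hae] with x hx u
    rw [tendsto_sub_nhds_zero_iff]
    refine tendsto_congr fun n => ?_
    simp_rw [← hx]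
    exact pwzSum_coe hφ n u _
  have h1 := (Measure.ae_ae_comm (μ := μ) (ν := m) hset).1 (.of_forall fun ω => by
    filter_upwards [hiff, ae_hasPWZ_comp_gaussPath hm hφ hh (W ω)] with x h1 h2
    exact (h1 _).1 h2)
  filter_upwards [h1, hiff] with x h1 h2
  filter_upwards [h1] with u hu
  exact (h2 _).2 hu

end JointMeasurability

/-! ### Complex measures as unimodular densities. -/

section ComplexMeasures

variable {X : Type*} [MeasurableSpace X]

lemma isFiniteMeasure_variation_complex (c : ComplexMeasure X) : IsFiniteMeasure c.variation := by
  have h : c.variation ≤ c.re.totalVariation + c.im.totalVariation := by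
    refine VectorMeasure.variation_le_of_forall_enorm_le fun E hE => ?_
    calc ‖c E‖ₑ = ‖((c.re E : ℂ) + c.im E * Complex.I)‖ₑ := by
          congr 1
          exact (Complex.re_add_im (c E)).symm
      _ ≤ ‖(c.re E : ℂ)‖ₑ + ‖(c.im E * Complex.I : ℂ)‖ₑ := enorm_add_le _ _
      _ = ‖c.re E‖ₑ + ‖c.im E‖ₑ := by simp [← ofReal_norm]
      _ ≤ _ := add_le_add (SignedMeasure.enorm_le_totalVariation _ _)
          (SignedMeasure.enorm_le_totalVariation _ _)
  exact isFiniteMeasure_of_le _ h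

/-- A complex measure has a density of modulus one with respect to its total variation. -/
theorem exists_density_variation (c : ComplexMeasure X) :
    ∃ θ : X → ℂ, Measurable θ ∧ Integrable θ c.variation ∧ (∀ᵐ u ∂c.variation, ‖θ u‖ = 1) ∧
      c = c.variation.withDensityᵥ θ := by
  have := isFiniteMeasure_variation_complex c
  have hac : ∀ s : SignedMeasure X, (∀ E, ‖s E‖ ≤ ‖c E‖) →
      s ≪ᵥ c.variation.toENNRealVectorMeasure := by
    intro s hs
    refine VectorMeasure.AbsolutelyContinuous.mk fun E hE hE0 => ?_
    rw [Measure.toENNRealVectorMeasure_apply_measurable hE] at hE0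
    have h1 := VectorMeasure.enorm_measure_le_variation c E
    rw [hE0] at h1
    have h2 : c E = 0 := by simpa using h1
    have h3 := hs E
    rw [h2, norm_zero] at h3
    exact norm_le_zero_iff.1 h3
  have hre := SignedMeasure.withDensityᵥ_rnDeriv_eq c.re c.variation
    (hac _ fun E => Complex.abs_re_le_norm _)
  have him := SignedMeasure.withDensityᵥ_rnDeriv_eq c.im c.variation
    (hac _ fun E => Complex.abs_im_le_norm _)
  have hire := SignedMeasure.integrable_rnDeriv c.re c.variation
  have hiim := SignedMeasure.integrable_rnDeriv c.im c.variation
  set θ : X → ℂ := fun u => (c.re.rnDeriv c.variation u : ℂ) + c.im.rnDeriv c.variation u * Complex.I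
  have hθm : Measurable θ :=
    (Complex.measurable_ofReal.comp (SignedMeasure.measurable_rnDeriv _ _)).add
      ((Complex.measurable_ofReal.comp (SignedMeasure.measurable_rnDeriv _ _)).mul_const _)
  have hθ : Integrable θ c.variation := hire.ofReal.add (hiim.ofReal.mul_const _)
  have heq : c = c.variation.withDensityᵥ θ := by
    ext E hE
    rw [withDensityᵥ_apply hθ hE]
    have h1 : ∫ u in E, θ u ∂c.variation = (∫ u in E, (c.re.rnDeriv c.variation u : ℂ) ∂c.variation) +
        (∫ u in E, (c.im.rnDeriv c.variation u : ℂ) ∂c.variation) * Complex.I := by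
      rw [← integral_mul_const, ← integral_add hire.ofReal.restrict
        (hiim.ofReal.mul_const _).restrict]
    rw [h1, integral_complex_ofReal, integral_complex_ofReal, ← withDensityᵥ_apply hire hE,
      ← withDensityᵥ_apply hiim hE, hre, him]
    exact (Complex.re_add_im (c E)).symm
  refine ⟨θ, hθm, hθ, ?_, heq⟩
  have h1 := Measure.variation_withDensityᵥ hθ
  rw [← heq] at h1
  have h2 : c.variation.withDensity (fun u => ‖θ u‖ₑ) = c.variation.withDensity fun _ => 1 := by
    rw [← h1]; exact withDensity_one.symm
  rw [withDensity_eq_iff_of_sigmaFinite hθm.enorm.aemeasurable aemeasurable_const] at h2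
  filter_upwards [h2] with u hu
  rw [← toReal_enorm, hu]; simp

lemma variation_withDensityᵥ_of_norm_eq_one {μ : Measure X} {θ : X → ℂ} (hθ : Integrable θ μ)
    (h1 : ∀ᵐ u ∂μ, ‖θ u‖ = 1) : (μ.withDensityᵥ θ).variation = μ := by
  rw [Measure.variation_withDensityᵥ hθ]
  conv_rhs => rw [← withDensity_one (μ := μ)]
  refine withDensity_congr_ae ?_
  filter_upwards [h1] with u hu
  rw [← ofReal_norm, hu]; simp

/-- Since `|θ| = 1`, the total variation of the vector measure is `μ` itself, so both sides are
continuous on `L₁(μ)` and it suffices to check indicators and sums. -/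
theorem integral_withDensityᵥ_eq {μ : Measure X} {θ : X → ℂ} (hθ : Integrable θ μ)
    (h1 : ∀ᵐ u ∂μ, ‖θ u‖ = 1) {g : X → ℂ} (hg : Integrable g μ) :
    ∫ᵛ u, g u ∂[ContinuousLinearMap.mul ℝ ℂ; μ.withDensityᵥ θ] = ∫ u, g u * θ u ∂μ := by
  have hv := variation_withDensityᵥ_of_norm_eq_one hθ h1
  have hmul : ∀ {f : X → ℂ}, Integrable f μ → Integrable (fun u => f u * θ u) μ := fun {f} hf =>
    hf.mul_bdd (c := 1) hθ.aestronglyMeasurable (h1.mono fun u hu => hu.le)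
  have hnorm : ∀ f : X → ℂ, ∫ u, ‖f u * θ u‖ ∂μ = ∫ u, ‖f u‖ ∂μ := fun f =>
    integral_congr_ae (h1.mono fun u hu => by simp [hu])
  refine Integrable.induction (μ := μ) (fun g => ∫ᵛ u, g u ∂[ContinuousLinearMap.mul ℝ ℂ;
    μ.withDensityᵥ θ] = ∫ u, g u * θ u ∂μ) ?_ ?_ ?_ ?_ hg
  · intro c s hs hs'
    have : IsFiniteMeasure ((μ.withDensityᵥ θ).variation.restrict s) := by
      rw [hv]; exact ⟨by simpa using hs'⟩
    rw [VectorMeasure.integral_indicator_const c hs, withDensityᵥ_apply hθ hs]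
    have h2 : (fun u => s.indicator (fun _ => c) u * θ u) = s.indicator fun u => c * θ u := by
      ext u
      by_cases hu : u ∈ s <;> simp [hu]
    rw [h2, integral_indicator hs, integral_const_mul]
    rfl
  · intro f g _ hf hg h2 h3
    rw [VectorMeasure.integral_add (by rwa [VectorMeasure.Integrable, hv])
      (by rwa [VectorMeasure.Integrable, hv]), h2, h3, ← integral_add (hmul hf) (hmul hg)]
    simp_rw [Pi.add_apply, add_mul]
  · refine isClosed_eq ?_ ?_
    · have h2 := VectorMeasure.continuous_integral (μ := μ.withDensityᵥ θ)
        (B := ContinuousLinearMap.mul ℝ ℂ) (E := ℂ)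
      rw [hv] at h2
      exact h2
    · refine (LipschitzWith.of_dist_le_mul (K := 1) fun f g => ?_).continuous
      have hf := L1.integrable_coeFn f
      have hg := L1.integrable_coeFn g
      rw [dist_eq_norm, dist_eq_norm, L1.norm_eq_integral_norm, ← integral_sub (hmul hf) (hmul hg)]
      simp_rw [← sub_mul]
      refine (norm_integral_le_integral_norm _).trans ?_
      rw [hnorm, NNReal.coe_one, one_mul]
      refine le_of_eq (integral_congr_ae ?_)
      filter_upwards [Lp.coeFn_sub f g] with u hu
      rw [hu, Pi.sub_apply]
  · intro f g hfg _ h2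
    rw [← VectorMeasure.integral_congr_ae (f := f) (by rwa [hv]), h2]
    exact integral_congr_ae (hfg.mono fun u hu => by simp only [hu])

end ComplexMeasures

/-! ### A complex measure is determined by its Gaussian convolutions. -/

section Uniqueness

variable {E : Type*} [NormedAddCommGroup E] [InnerProductSpace ℝ E]

lemma exp_inner_sub_le (u v : E) (t : ℝ) :
    Real.exp (t * inner ℝ u v - ‖u‖ ^ 2 / 2) ≤ Real.exp (‖t • v‖ ^ 2 / 2) := by
  have h := sq_nonneg ‖u - t • v‖
  rw [norm_sub_sq_real, inner_smul_right] at h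
  exact Real.exp_le_exp.2 (by linarith)

lemma exp_sub_sq_eq (u v : E) : Real.exp (-(‖u - v‖ ^ 2 / 2)) =
    Real.exp (-(‖v‖ ^ 2 / 2)) * Real.exp (inner ℝ u v - ‖u‖ ^ 2 / 2) := by
  rw [← Real.exp_add, norm_sub_sq_real]; congr 1; ring

variable [CompleteSpace E] [SecondCountableTopology E] [MeasurableSpace E] [BorelSpace E]

/-- A finite measure with exponential moments is determined by its Laplace transform. -/
lemma measure_ext_of_integral_exp_inner {P Q : Measure E} [IsFiniteMeasure P] [IsFiniteMeasure Q]
    (hP : ∀ (v : E) (t : ℝ), Integrable (fun u => Real.exp (t * inner ℝ u v)) P)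
    (h : ∀ v : E, ∫ u, Real.exp (inner ℝ u v) ∂P = ∫ u, Real.exp (inner ℝ u v) ∂Q) : P = Q := by
  have hmgf : ∀ v : E, mgf (fun u => inner ℝ u v) P = mgf (fun u => inner ℝ u v) Q := by
    intro v
    ext t
    simp_rw [mgf, ← inner_smul_right]
    exact h (t • v)
  have h0 : P = 0 ↔ Q = 0 := by
    have := h 0
    simp only [inner_zero_right, Real.exp_zero, integral_const, smul_eq_mul, mul_one] at this
    rw [← Measure.measure_univ_eq_zero, ← Measure.measure_univ_eq_zero,
      ← measureReal_eq_zero_iff, ← measureReal_eq_zero_iff, this]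
  refine Measure.ext_of_charFun (funext fun v => ?_)
  -- All exponential moments are finite, so the complex moment generating function is analytic
  -- everywhere and equality on the real axis passes to `I`, where it is the characteristic
  -- function.
  have hset : integrableExpSet (fun u => inner ℝ u v) P = Set.univ :=
    Set.eq_univ_of_forall fun t => hP v t
  have h1 := eqOn_complexMGF_of_mgf' (hmgf v) h0 (x := Complex.I) (by
    rw [hset, interior_univ]; trivial)
  simp only [complexMGF] at h1
  simp only [charFun_apply]
  simp_rw [mul_comm _ Complex.I]
  exact h1

/-- The weight `exp(-‖u‖²/2)` makes all exponential moments finite; the weighted positive and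
negative parts of `ρ` are then finite measures with equal Laplace transforms. -/
lemma ae_eq_zero_of_integral_exp_inner {ν : Measure E} [IsFiniteMeasure ν] {ρ : E → ℝ}
    (hm : Measurable ρ) (hρ : Integrable ρ ν)
    (h : ∀ v : E, ∫ u, Real.exp (inner ℝ u v - ‖u‖ ^ 2 / 2) * ρ u ∂ν = 0) : ρ =ᵐ[ν] 0 := by
  set w : E → ℝ := fun u => Real.exp (-(‖u‖ ^ 2 / 2))
  have hw : Measurable w := by fun_prop
  set P : (E → ℝ) → Measure E := fun σ => ν.withDensity fun u => ENNReal.ofReal (w u * max (σ u) 0)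
  have hPm : ∀ {σ : E → ℝ}, Measurable σ → Measurable fun u => ENNReal.ofReal (w u * max (σ u) 0) :=
    fun hσ => (hw.mul (hσ.max measurable_const)).ennreal_ofReal
  have hint : ∀ {σ : E → ℝ}, Integrable σ ν → ∀ (v : E) (t : ℝ),
      Integrable (fun u => Real.exp (t * inner ℝ u v - ‖u‖ ^ 2 / 2) * σ u) ν := by
    intro σ hσ v t
    refine hσ.bdd_mul (c := Real.exp (‖t • v‖ ^ 2 / 2)) ?_ (.of_forall fun u => ?_)
    · exact (by fun_prop : Measurable fun u : E =>
        Real.exp (t * inner ℝ u v - ‖u‖ ^ 2 / 2)).aestronglyMeasurable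
    · rw [Real.norm_eq_abs, Real.abs_exp]; exact exp_inner_sub_le u v t
  have hfin : ∀ {σ : E → ℝ}, Integrable σ ν → IsFiniteMeasure (P σ) := by
    intro σ hσ
    refine isFiniteMeasure_withDensity_ofReal ?_
    have h1 := (hint hσ.pos_part 0 0).2
    refine h1.congr (.of_forall fun u => ?_)
    simp [w, sub_eq_add_neg]
  have hexp : ∀ (u v : E) (t : ℝ), w u * Real.exp (t * inner ℝ u v) =
      Real.exp (t * inner ℝ u v - ‖u‖ ^ 2 / 2) := by
    intro u v t
    rw [← Real.exp_add]; congr 1; ring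
  have hnn : ∀ (σ : E → ℝ) u, 0 ≤ w u * max (σ u) 0 := fun σ u =>
    mul_nonneg (Real.exp_pos _).le (le_max_right _ _)
  have hPint : ∀ {σ : E → ℝ}, Measurable σ → ∀ (v : E), ∫ u, Real.exp (inner ℝ u v) ∂(P σ) =
      ∫ u, Real.exp (inner ℝ u v - ‖u‖ ^ 2 / 2) * max (σ u) 0 ∂ν := by
    intro σ hσ v
    rw [integral_withDensity_eq_integral_toReal_smul (hPm hσ) (.of_forall fun _ => by simp)]
    refine integral_congr_ae (.of_forall fun u => ?_)
    have := hexp u v 1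
    rw [one_mul] at this
    simp only [smul_eq_mul]
    rw [ENNReal.toReal_ofReal (hnn σ u), ← this]; ring
  have := hfin hρ
  have := hfin hρ.neg
  have hPQ : P ρ = P (-ρ) := by
    refine measure_ext_of_integral_exp_inner (fun v t => ?_) fun v => ?_
    · rw [integrable_withDensity_iff_integrable_smul' (hPm hm) (.of_forall fun _ => by simp)]
      refine (hint hρ.pos_part v t).congr (.of_forall fun u => ?_)
      simp only [smul_eq_mul]
      rw [ENNReal.toReal_ofReal (hnn ρ u), ← hexp]; ring
    · rw [hPint hm, hPint hm.neg, ← sub_eq_zero]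
      have h1 := hint hρ.pos_part v 1
      have h2 := hint hρ.neg_part v 1
      simp_rw [one_mul] at h1 h2
      simp only [Pi.neg_apply]
      rw [← integral_sub h1 h2]
      refine Eq.trans (integral_congr_ae (.of_forall fun u => ?_)) (h v)
      simp only
      rw [← mul_sub]
      congr 1
      rcases le_total 0 (ρ u) with h | h
      · rw [max_eq_left h, max_eq_right (by linarith)]; ring
      · rw [max_eq_right h, max_eq_left (by linarith)]; ring
  rw [withDensity_eq_iff_of_sigmaFinite (hPm hm).aemeasurable (hPm hm.neg).aemeasurable] at hPQ
  filter_upwards [hPQ] with u hu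
  rw [ENNReal.ofReal_eq_ofReal_iff (hnn _ _) (hnn _ _), mul_right_inj' (Real.exp_pos _).ne'] at hu
  rcases le_total 0 (ρ u) with h | h
  · rw [max_eq_left h, Pi.neg_apply, max_eq_right (by linarith)] at hu; exact hu
  · rw [max_eq_right h, Pi.neg_apply, max_eq_left (by linarith)] at hu
    simp only [Pi.zero_apply]; linarith

/-- A complex measure on a separable Hilbert space is determined by its Gaussian convolutions. -/
theorem complexMeasure_ext_of_gaussian {c c' : ComplexMeasure E}
    (h : ∀ v : E, ∫ᵛ u, (Real.exp (-(‖u - v‖ ^ 2 / 2)) : ℂ) ∂[ContinuousLinearMap.mul ℝ ℂ; c] =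
      ∫ᵛ u, (Real.exp (-(‖u - v‖ ^ 2 / 2)) : ℂ) ∂[ContinuousLinearMap.mul ℝ ℂ; c']) : c = c' := by
  have hgm : ∀ v : E, Measurable fun u : E => (Real.exp (-(‖u - v‖ ^ 2 / 2)) : ℂ) := fun v => by
    fun_prop
  have hgi : ∀ (v : E) (μ : Measure E) [IsFiniteMeasure μ],
      Integrable (fun u : E => (Real.exp (-(‖u - v‖ ^ 2 / 2)) : ℂ)) μ := fun v μ _ =>
    Integrable.of_bound (hgm v).aestronglyMeasurable 1 (.of_forall fun u => by
      rw [Complex.norm_real, Real.norm_eq_abs, Real.abs_exp, Real.exp_le_one_iff]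
      have := sq_nonneg ‖u - v‖
      linarith)
  have h1 := isFiniteMeasure_variation_complex c
  have h2 := isFiniteMeasure_variation_complex c'
  have h3 := isFiniteMeasure_variation_complex (c - c')
  obtain ⟨θ, hθm, hθ, hθ1, hd⟩ := exists_density_variation (c - c')
  have h4 : ∀ v : E, ∫ u, (Real.exp (-(‖u - v‖ ^ 2 / 2)) : ℂ) * θ u ∂(c - c').variation = 0 := by
    intro v
    rw [← integral_withDensityᵥ_eq hθ hθ1 (hgi v _), ← hd,
      VectorMeasure.integral_sub_vectorMeasure (hgi v _) (hgi v _), h v, sub_self]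
  -- Completing the square: up to the constant `exp(-‖v‖²/2)`, the Gaussian convolution is the
  -- Laplace transform of the weighted measure.
  have h5 : ∀ v : E, ∫ u, (Real.exp (inner ℝ u v - ‖u‖ ^ 2 / 2) : ℂ) * θ u ∂(c - c').variation = 0 := by
    intro v
    have h6 := h4 v
    simp_rw [exp_sub_sq_eq, Complex.ofReal_mul, mul_assoc] at h6
    rw [integral_const_mul] at h6
    refine (mul_eq_zero.1 h6).resolve_left ?_
    exact_mod_cast (Real.exp_pos _).ne'
  have hint : ∀ v : E, Integrable
      (fun u => (Real.exp (inner ℝ u v - ‖u‖ ^ 2 / 2) : ℂ) * θ u) (c - c').variation := by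
    intro v
    refine hθ.bdd_mul (c := Real.exp (‖v‖ ^ 2 / 2)) ?_ (.of_forall fun u => ?_)
    · exact (by fun_prop : Measurable fun u : E =>
        (Real.exp (inner ℝ u v - ‖u‖ ^ 2 / 2) : ℂ)).aestronglyMeasurable
    · rw [Complex.norm_real, Real.norm_eq_abs, Real.abs_exp]
      simpa using exp_inner_sub_le u v 1
  have hre := ae_eq_zero_of_integral_exp_inner (Complex.measurable_re.comp hθm) hθ.re fun v => by
    have := integral_re (hint v)
    rw [h5 v] at this
    rw [← Complex.zero_re]
    refine Eq.trans (integral_congr_ae (.of_forall fun u => ?_)) this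
    exact (Complex.re_ofReal_mul _ _).symm
  have him := ae_eq_zero_of_integral_exp_inner (Complex.measurable_im.comp hθm) hθ.im fun v => by
    have := integral_im (hint v)
    rw [h5 v] at this
    rw [← Complex.zero_im]
    refine Eq.trans (integral_congr_ae (.of_forall fun u => ?_)) this
    exact (Complex.im_ofReal_mul _ _).symm
  have h7 : θ =ᵐ[(c - c').variation] 0 := by
    filter_upwards [hre, him] with u h8 h9
    exact Complex.ext h8 h9
  rw [← sub_eq_zero, hd, WithDensityᵥEq.congr_ae h7, withDensityᵥ_zero]

end Uniqueness

/-! ### Analytic continuation of Gaussian mixtures. -/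

section AnalyticContinuation

variable {Ω : Type*} [MeasurableSpace Ω] {μ : Measure Ω} {κ : Ω → ℂ} {N : Ω → ℝ}

/-- The Gaussian mixture `w ↦ ∫ κ exp(-N w / 2) dμ`. -/
def gaussMix (μ : Measure Ω) (κ : Ω → ℂ) (N : Ω → ℝ) (w : ℂ) : ℂ :=
  ∫ ω, κ ω * Complex.exp (-(N ω * w / 2)) ∂μ

lemma norm_exp_neg_mul (x : ℝ) (w : ℂ) :
    ‖Complex.exp (-(x * w / 2))‖ = Real.exp (-(x * w.re / 2)) := by
  rw [Complex.norm_exp]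
  congr 1
  have : (x : ℂ) * w / 2 = ((x / 2 : ℝ) : ℂ) * w := by push_cast; ring
  rw [Complex.neg_re, this, Complex.re_ofReal_mul]; ring

lemma norm_exp_neg_mul_le_one {x : ℝ} (hx : 0 ≤ x) {w : ℂ} (hw : 0 ≤ w.re) :
    ‖Complex.exp (-(x * w / 2))‖ ≤ 1 := by
  rw [norm_exp_neg_mul, Real.exp_le_one_iff]
  have := mul_nonneg hx hw
  linarith

lemma measurable_exp_neg_mul (hN : Measurable N) (w : ℂ) :
    Measurable fun ω => Complex.exp (-(N ω * w / 2)) := by fun_prop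

lemma integrable_gaussMix (hκ : Integrable κ μ) (hN : Measurable N) (hN0 : ∀ ω, 0 ≤ N ω) {w : ℂ}
    (hw : 0 ≤ w.re) : Integrable (fun ω => κ ω * Complex.exp (-(N ω * w / 2))) μ :=
  hκ.mul_bdd (c := 1) (measurable_exp_neg_mul hN w).aestronglyMeasurable
    (.of_forall fun ω => norm_exp_neg_mul_le_one (hN0 ω) hw)

lemma norm_mul_exp_neg_le (k : ℂ) {x : ℝ} (hx : 0 ≤ x) {w : ℂ} (hw : 0 ≤ w.re) :
    ‖k * Complex.exp (-(x * w / 2))‖ ≤ ‖k‖ := by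
  rw [norm_mul]
  exact mul_le_of_le_one_right (norm_nonneg _) (norm_exp_neg_mul_le_one hx hw)

lemma norm_gaussMix_le (hκ : Integrable κ μ) (hN0 : ∀ ω, 0 ≤ N ω) {w : ℂ} (hw : 0 ≤ w.re) :
    ‖gaussMix μ κ N w‖ ≤ ∫ ω, ‖κ ω‖ ∂μ :=
  norm_integral_le_of_norm_le hκ.norm (.of_forall fun ω => norm_mul_exp_neg_le _ (hN0 ω) hw)

/-- Near `w₀` the real part stays above `r = Re w₀ / 2`, and `(N/2) exp(-rN/2) ≤ 1/r` dominates the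
derivative, so no moment of `N` is needed. -/
lemma differentiableOn_gaussMix (hκ : Integrable κ μ) (hN : Measurable N) (hN0 : ∀ ω, 0 ≤ N ω) :
    DifferentiableOn ℂ (gaussMix μ κ N) rightHalf := by
  intro w₀ hw₀
  have hw₀' : 0 < w₀.re := hw₀
  set r := w₀.re / 2
  have hr : 0 < r := half_pos hw₀'
  have hre : ∀ w ∈ Metric.ball w₀ r, r ≤ w.re := by
    intro w hw
    have h1 := (Complex.abs_re_le_norm (w - w₀)).trans (mem_ball_iff_norm.1 hw).le
    rw [Complex.sub_re] at h1
    have h2 := (abs_le.1 h1).1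
    have h3 : w₀.re = r + r := (add_halves _).symm
    linarith
  have h := hasDerivAt_integral_of_dominated_loc_of_deriv_le (μ := μ) (s := Metric.ball w₀ r)
    (F := fun w ω => κ ω * Complex.exp (-(N ω * w / 2)))
    (F' := fun w ω => κ ω * (Complex.exp (-(N ω * w / 2)) * (-(N ω / 2 : ℂ))))
    (bound := fun ω => ‖κ ω‖ * r⁻¹) (x₀ := w₀) (Metric.ball_mem_nhds w₀ hr)
    (.of_forall fun w => hκ.1.mul (measurable_exp_neg_mul hN w).aestronglyMeasurable)
    (integrable_gaussMix hκ hN hN0 hw₀'.le)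
    (hκ.1.mul (Measurable.aestronglyMeasurable (by fun_prop)))
    (.of_forall fun ω w hw => ?_) (hκ.norm.mul_const _) (.of_forall fun ω w _ => ?_)
  · exact h.2.differentiableAt.differentiableWithinAt
  · rw [norm_mul, norm_mul, norm_exp_neg_mul, norm_neg]
    gcongr
    have h1 : ‖(N ω / 2 : ℂ)‖ = N ω / 2 := by
      rw [norm_div, Complex.norm_real, Real.norm_of_nonneg (hN0 ω)]; norm_num
    rw [h1]
    have h2 : Real.exp (-(N ω * w.re / 2)) ≤ Real.exp (-(N ω / 2 * r)) := by
      refine Real.exp_le_exp.2 (neg_le_neg ?_)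
      have := mul_le_mul_of_nonneg_left (hre w hw) (hN0 ω)
      linarith
    have h3 : N ω / 2 * r ≤ Real.exp (N ω / 2 * r) := by
      have := Real.add_one_le_exp (N ω / 2 * r); linarith
    calc Real.exp (-(N ω * w.re / 2)) * (N ω / 2)
        ≤ Real.exp (-(N ω / 2 * r)) * (N ω / 2) := by
          gcongr; exact div_nonneg (hN0 ω) zero_le_two
      _ = Real.exp (-(N ω / 2 * r)) * (N ω / 2 * r) * r⁻¹ := by field_simp
      _ ≤ Real.exp (-(N ω / 2 * r)) * Real.exp (N ω / 2 * r) * r⁻¹ := by gcongr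
      _ = r⁻¹ := by rw [← Real.exp_add]; simp
  · refine HasDerivAt.const_mul _ (HasDerivAt.cexp ?_)
    have h1 := ((hasDerivAt_id w).const_mul (N ω / 2 : ℂ)).neg
    simp only [mul_one] at h1
    refine h1.congr_of_eventuallyEq (.of_forall fun z => ?_)
    simp only [Pi.neg_apply, id]; ring

lemma inv_mem_rightHalf {l : ℂ} (hl : l ∈ rightHalf) : l⁻¹ ∈ rightHalf := by
  have hl' : 0 < l.re := hl
  change 0 < (l⁻¹).re
  rw [Complex.inv_re]
  exact div_pos hl' (Complex.normSq_pos.2 fun h => by rw [h] at hl'; simp at hl')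

lemma rightHalf_ne_zero {l : ℂ} (hl : l ∈ rightHalf) : l ≠ 0 := fun h => by
  have hl' : 0 < l.re := hl
  rw [h] at hl'; simp at hl'

lemma differentiableOn_gaussMix_inv (hκ : Integrable κ μ) (hN : Measurable N)
    (hN0 : ∀ ω, 0 ≤ N ω) : DifferentiableOn ℂ (fun l => gaussMix μ κ N l⁻¹) rightHalf :=
  (differentiableOn_gaussMix hκ hN hN0).comp
    (fun _ hl => (differentiableAt_inv (rightHalf_ne_zero hl)).differentiableWithinAt)
    fun _ hl => inv_mem_rightHalf hl

/-- The value of `λ⁻¹` at `λ = -iq`. -/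
def feynmanInv (q : ℝ) : ℂ := (-(Complex.I * q))⁻¹

lemma feynmanInv_neg (q : ℝ) : feynmanInv (-q) = -feynmanInv q := by
  simp [feynmanInv, inv_neg]

lemma feynmanInv_re (q : ℝ) : (feynmanInv q).re = 0 := by
  simp [feynmanInv, Complex.inv_re]

lemma norm_exp_feynmanInv (x q : ℝ) : ‖Complex.exp (-(x * feynmanInv q / 2))‖ = 1 := by
  rw [norm_exp_neg_mul, feynmanInv_re]; simp

lemma toFeynman_le_inv {q : ℝ} (hq : q ≠ 0) :
    Tendsto (fun l : ℂ => l⁻¹) (toFeynman q) (𝓝 (feynmanInv q)) := by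
  refine (tendsto_inv₀ ?_).mono_left nhdsWithin_le_nhds
  simpa using hq

instance neBot_toFeynman (q : ℝ) : (toFeynman q).NeBot := by
  refine mem_closure_iff_nhdsWithin_neBot.1 ?_
  rw [show rightHalf = {z : ℂ | 0 < z.re} from rfl, Complex.closure_setOfPred_lt_re]
  simp

instance isCountablyGenerated_toFeynman (q : ℝ) : (toFeynman q).IsCountablyGenerated := by
  unfold toFeynman; infer_instance

lemma eventually_toFeynman (q : ℝ) : ∀ᶠ l in toFeynman q, l ∈ rightHalf := self_mem_nhdsWithin

lemma tendsto_gaussMix (hκ : Integrable κ μ) (hN : Measurable N) (hN0 : ∀ ω, 0 ≤ N ω) {q : ℝ}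
    (hq : q ≠ 0) :
    Tendsto (fun l => gaussMix μ κ N l⁻¹) (toFeynman q) (𝓝 (gaussMix μ κ N (feynmanInv q))) := by
  refine tendsto_integral_filter_of_dominated_convergence (fun ω => ‖κ ω‖)
    (.of_forall fun l => hκ.1.mul (measurable_exp_neg_mul hN _).aestronglyMeasurable) ?_ hκ.norm
    (.of_forall fun ω => ?_)
  · filter_upwards [eventually_toFeynman q] with l hl
    exact .of_forall fun ω => norm_mul_exp_neg_le _ (hN0 ω) (inv_mem_rightHalf hl).le
  · have : Continuous fun w : ℂ => κ ω * Complex.exp (-(N ω * w / 2)) := by fun_prop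
    exact (this.tendsto _).comp (toFeynman_le_inv hq)

lemma frequently_ofReal_one {P : ℂ → Prop} (h : ∀ l : ℝ, 0 < l → P l) : ∃ᶠ z in 𝓝[≠] (1 : ℂ), P z := by
  have h1 : Tendsto (fun n : ℕ => ((1 + 1 / ((n : ℝ) + 1) : ℝ) : ℂ)) atTop (𝓝[≠] (1 : ℂ)) := by
    refine tendsto_nhdsWithin_iff.2 ⟨?_, .of_forall fun n => ?_⟩
    · have h2 := (tendsto_one_div_add_atTop_nhds_zero_nat (𝕜 := ℝ)).const_add 1
      rw [add_zero] at h2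
      exact (Complex.continuous_ofReal.tendsto 1).comp h2
    · have : (0 : ℝ) < 1 / ((n : ℝ) + 1) := Nat.one_div_pos_of_nat
      simp only [Set.mem_compl_iff, Set.mem_singleton_iff]
      rw [Complex.ofReal_eq_one]
      linarith
  refine h1.frequently (Frequently.of_forall fun n => h _ ?_)
  have : (0 : ℝ) < 1 / ((n : ℝ) + 1) := Nat.one_div_pos_of_nat
  linarith

/-- Identity theorem: the two continuations agree on the positive reals, which accumulate at `1`. -/
lemma HasAnalyticWiener.eqOn {T : ℝ} {m : Measure (C0 T)} {Ψ : ℝ → C0 T → ℂ} {J J' : ℂ → ℂ}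
    (hJ : HasAnalyticWiener m Ψ J) (hJ' : HasAnalyticWiener m Ψ J') : Set.EqOn J J' rightHalf := by
  have hopen : IsOpen rightHalf := isOpen_lt continuous_const Complex.continuous_re
  have hconv : Convex ℝ rightHalf := convex_halfSpace_re_gt 0
  refine (hJ.analytic.analyticOnNhd hopen).eqOn_of_preconnected_of_frequently_eq
    (hJ'.analytic.analyticOnNhd hopen) hconv.isPreconnected (z₀ := 1) (by simp [rightHalf])
    (frequently_ofReal_one fun l hl => ?_)
  rw [hJ.eq_integral l hl, hJ'.eq_integral l hl]

end AnalyticContinuation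

/-! ### Superpositions of exponentials and their Gaussian integrals. -/

section Representation

variable {T : ℝ} [hT : Fact (0 < T)] {φ : ℕ → ℝ → ℝ} {m : Measure (C0 T)}

variable {Ω : Type*} [MeasurableSpace Ω] {μ : Measure Ω} {κ : Ω → ℂ} {W : Ω → L2 T}

/-- The functional `y ↦ ∫ κ(ω) exp{i⟨W ω, y⟩} dμ(ω)`. -/
def pwzTransform (φ : ℕ → ℝ → ℝ) (μ : Measure Ω) (κ : Ω → ℂ) (W : Ω → L2 T) (y : C0 T) : ℂ :=
  ∫ ω, κ ω * Complex.exp (Complex.I * (pwz φ (W ω) y : ℂ)) ∂μ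

lemma norm_exp_I_mul (x : ℝ) : ‖Complex.exp (Complex.I * x)‖ = 1 := by
  rw [mul_comm, Complex.norm_exp_ofReal_mul_I]

lemma measurable_exp_pwz (hφ : IsBVBasis T φ) (hW : Measurable W) :
    Measurable fun p : Ω × C0 T => Complex.exp (Complex.I * (pwz φ (W p.1) p.2 : ℂ)) :=
  ((Complex.measurable_ofReal.comp (measurable_pwz_comp hφ hW)).const_mul _).cexp

lemma measurable_exp_pwz_left (hφ : IsBVBasis T φ) (hW : Measurable W) (y : C0 T) :
    Measurable fun ω => Complex.exp (Complex.I * (pwz φ (W ω) y : ℂ)) := by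
  have h := (measurable_exp_pwz hφ hW).comp (measurable_prodMk_right (y := y))
  simp only [Function.comp_def] at h
  exact h

lemma integrable_mul_exp_pwz (hφ : IsBVBasis T φ) (hκ : Integrable κ μ) (hW : Measurable W)
    (y : C0 T) : Integrable (fun ω => κ ω * Complex.exp (Complex.I * (pwz φ (W ω) y : ℂ))) μ :=
  hκ.mul_bdd (c := 1) (measurable_exp_pwz_left hφ hW y).aestronglyMeasurable
    (.of_forall fun _ => (norm_exp_I_mul _).le)

lemma norm_mul_exp_pwz (k : ℂ) (x : ℝ) : ‖k * Complex.exp (Complex.I * x)‖ = ‖k‖ := by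
  rw [norm_mul, norm_exp_I_mul, mul_one]

lemma measurable_pwzTransform [SFinite μ] (hφ : IsBVBasis T φ) (hκ : Measurable κ)
    (hW : Measurable W) : Measurable (pwzTransform φ μ κ W) := by
  have h : StronglyMeasurable fun p : C0 T × Ω =>
      κ p.2 * Complex.exp (Complex.I * (pwz φ (W p.2) p.1 : ℂ)) :=
    ((hκ.comp measurable_snd).mul
      ((measurable_exp_pwz hφ hW).comp measurable_swap)).stronglyMeasurable
  exact h.integral_prod_right'.measurable

/-- The Gaussian integral of `pwzTransform`. -/
lemma integral_pwzTransform_smul [IsFiniteMeasure μ] (hm : IsWienerMeasure T m) (hφ : IsBVBasis T φ)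
    (hκm : Measurable κ) (hκ : Integrable κ μ) (hW : Measurable W) (c : ℝ) :
    Integrable (fun x => ∫ ω, κ ω * Complex.exp (Complex.I * ((c * pwz φ (W ω) x : ℝ) : ℂ)) ∂μ) m ∧
    ∫ x, ∫ ω, κ ω * Complex.exp (Complex.I * ((c * pwz φ (W ω) x : ℝ) : ℂ)) ∂μ ∂m =
      gaussMix μ κ (fun ω => ‖W ω‖ ^ 2) ((c ^ 2 : ℝ) : ℂ) := by
  have := hm.sFinite
  have := hm.isProbabilityMeasure
  have hmeas : Measurable fun p : C0 T × Ω => κ p.2 *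
      Complex.exp (Complex.I * ((c * pwz φ (W p.2) p.1 : ℝ) : ℂ)) :=
    (hκm.comp measurable_snd).mul ((Complex.measurable_ofReal.comp
      (((measurable_pwz_comp hφ hW).comp measurable_swap).const_mul c)).const_mul _).cexp
  have hint : Integrable (fun p : C0 T × Ω => κ p.2 *
      Complex.exp (Complex.I * ((c * pwz φ (W p.2) p.1 : ℝ) : ℂ))) (m.prod μ) := by
    refine (hκ.comp_snd m).mono hmeas.aestronglyMeasurable (.of_forall fun p => ?_)
    rw [norm_mul_exp_pwz]
  refine ⟨hint.integral_prod_left, ?_⟩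
  rw [integral_integral_swap hint]
  refine integral_congr_ae (.of_forall fun ω => ?_)
  simp only
  rw [integral_const_mul]
  congr 1
  have h := integral_cexp_pwz hm hφ (W ω) c
  refine Eq.trans (integral_congr_ae (.of_forall fun x => ?_)) (h.trans ?_)
  · simp only; congr 1; push_cast; ring
  · congr 1; push_cast; ring

/-- An integrand that depends on the path through a superposition of exponentials has a generalized
analytic Wiener integral. -/
lemma hasAnalyticWiener_of_ae_eq [IsFiniteMeasure μ] (hm : IsWienerMeasure T m)
    (hφ : IsBVBasis T φ) (hκm : Measurable κ) (hκ : Integrable κ μ) (hW : Measurable W)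
    {Ψ : ℝ → C0 T → ℂ} (hΨ : ∀ c : ℝ, ∀ᵐ x ∂m, Ψ c x =
      ∫ ω, κ ω * Complex.exp (Complex.I * ((c * pwz φ (W ω) x : ℝ) : ℂ)) ∂μ) :
    HasAnalyticWiener m Ψ fun l => gaussMix μ κ (fun ω => ‖W ω‖ ^ 2) l⁻¹ where
  integrable l _ := (integral_pwzTransform_smul hm hφ hκm hκ hW _).1.congr
    ((hΨ _).mono fun _ h => h.symm)
  eq_integral l hl := by
    rw [integral_congr_ae (hΨ _), (integral_pwzTransform_smul hm hφ hκm hκ hW _).2, inv_pow,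
      Real.sq_sqrt hl.le, Complex.ofReal_inv]
  analytic := differentiableOn_gaussMix_inv hκ (by fun_prop) fun _ => by positivity

/-- The paths along which the integrals of almost all `u` with respect to `M` exist. -/
def PWZDomain (φ : ℕ → ℝ → ℝ) (M : Measure (L2 T)) (y : C0 T) : Prop :=
  ∀ᵐ u : L2 T ∂M, ∃ a, HasPWZ φ u y a

lemma PWZDomain.smul (hφ : IsBVBasis T φ) {M : Measure (L2 T)} {y : C0 T} (hy : PWZDomain φ M y)
    (c : ℝ) : PWZDomain φ M (c • y) :=
  hy.mono fun _ ⟨a, ha⟩ => ⟨c * a, ha.smul_path hφ c⟩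

lemma PWZDomain.add (hφ : IsBVBasis T φ) {M : Measure (L2 T)} {y z : C0 T} (hy : PWZDomain φ M y)
    (hz : PWZDomain φ M z) : PWZDomain φ M (y + z) := by
  filter_upwards [hy, hz] with u ⟨a, ha⟩ ⟨b, hb⟩
  exact ⟨a + b, ha.add_path hφ hb⟩

lemma ae_pwzDomain (hm : IsWienerMeasure T m) (hφ : IsBVBasis T φ) (M : Measure (L2 T)) [SFinite M] :
    ∀ᵐ y ∂m, PWZDomain φ M y :=
  ae_ae_hasPWZ (W := fun u => u) M hm hφ measurable_id

/-- The domain is invariant under scaling, so the case `ρ = 1` already gives every `ρ`. -/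
lemma sae_pwzDomain (hm : IsWienerMeasure T m) (hφ : IsBVBasis T φ) (M : Measure (L2 T)) [SFinite M] :
    SAE m (PWZDomain φ M) := fun ρ _ =>
  (ae_pwzDomain hm hφ M).mono fun _ h => h.smul hφ ρ

lemma ae_pwzDomain_gaussPath (hm : IsWienerMeasure T m) (hφ : IsBVBasis T φ) {h : ℝ → ℝ}
    (hh : MemLp h ∞ (leb T)) (M : Measure (L2 T)) [SFinite M] :
    ∀ᵐ x ∂m, PWZDomain φ M (gaussPath φ h x) :=
  (ae_ae_hasPWZ_comp_gaussPath (W := fun u => u) M hm hφ hh measurable_id).mono fun _ hx =>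
    hx.mono fun _ hu => ⟨_, hu⟩

/-- `F` is the superposition `∫ κ(ω) exp{i⟨W ω, ·⟩} dμ(ω)` on the paths for which the integrals
of almost all `u` with respect to `M` exist. -/
def IsPWZRep (φ : ℕ → ℝ → ℝ) (M : Measure (L2 T)) (μ : Measure Ω) (κ : Ω → ℂ) (W : Ω → L2 T)
    (F : C0 T → ℂ) : Prop :=
  ∀ y, PWZDomain φ M y →
    (∀ᵐ ω ∂μ, ∃ a, HasPWZ φ (W ω) y a) ∧ F y = pwzTransform φ μ κ W y

variable {M : Measure (L2 T)} [SFinite M] {F : C0 T → ℂ}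

lemma IsPWZRep.sae_eq (hF : IsPWZRep φ M μ κ W F) (hm : IsWienerMeasure T m) (hφ : IsBVBasis T φ) :
    SAE m fun y => F y = pwzTransform φ μ κ W y := fun ρ hρ =>
  (sae_pwzDomain hm hφ M ρ hρ).mono fun _ h => (hF _ h).2

lemma siMeasurable_pwzTransform [SFinite μ] (hφ : IsBVBasis T φ) (hκ : Measurable κ)
    (hW : Measurable W) : SIMeasurable m (pwzTransform φ μ κ W) := fun ρ _ =>
  ((measurable_pwzTransform hφ hκ hW).comp (measurable_const_smul ρ)).aestronglyMeasurable

lemma SIMeasurable.congr {T : ℝ} {m : Measure (C0 T)} {F G : C0 T → ℂ} (hG : SIMeasurable m G) (h : SAE m fun y => F y = G y) :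
    SIMeasurable m F := fun ρ hρ =>
  (hG ρ hρ).congr ((h ρ hρ).mono fun _ hy => hy.symm)

/-- The values of `F` along a shift of `y` by a Gaussian path. -/
lemma IsPWZRep.ae_eq_add_smul_gaussPath [SFinite μ] (hF : IsPWZRep φ M μ κ W F)
    (hm : IsWienerMeasure T m) (hφ : IsBVBasis T φ) (hW : Measurable W) {h : ℝ → ℝ}
    (hh : MemLp h ∞ (leb T)) {y : C0 T} (hy : PWZDomain φ M y) :
    ∀ᵐ x ∂m, ∀ c b : ℝ, F (b • (y + c • gaussPath φ h x)) =
      ∫ ω, κ ω * Complex.exp (Complex.I * ((b * pwz φ (W ω) y : ℝ) : ℂ)) *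
        Complex.exp (Complex.I * ((c * (b * pwz φ (mulL hh (W ω)) x) : ℝ) : ℂ)) ∂μ := by
  -- The domain is closed under sums and multiples, so it contains the shifted path for all `c` and
  -- `b` at once; no absolute continuity of shifts is invoked.
  filter_upwards [ae_pwzDomain_gaussPath hm hφ hh M, ae_ae_hasPWZ_comp_gaussPath μ hm hφ hh hW]
    with x h1 h2 c b
  rw [(hF _ ((hy.add hφ (h1.smul hφ c)).smul hφ b)).2]
  refine integral_congr_ae ?_
  filter_upwards [h2, (hF _ hy).1] with ω h3 h4
  rw [(((hasPWZ_pwz h4).add_path hφ (h3.smul_path hφ c)).smul_path hφ b).pwz_eq, mul_assoc,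
    ← Complex.exp_add]
  congr 2
  push_cast; ring

end Representation

/-! ### Existence and uniqueness of the transform. -/

section Transform

variable {T : ℝ} [hT : Fact (0 < T)] {φ : ℕ → ℝ → ℝ} {m : Measure (C0 T)}

variable {Ω : Type*} [MeasurableSpace Ω] {μ : Measure Ω} {κ : Ω → ℂ} {W : Ω → L2 T}

/-- The density `κ exp(-N w / 2)`. -/
def twist (κ : Ω → ℂ) (N : Ω → ℝ) (w : ℂ) (ω : Ω) : ℂ := κ ω * Complex.exp (-(N ω * w / 2))

lemma gaussMix_mul_exp (N : Ω → ℝ) (w : ℂ) (y : C0 T) :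
    gaussMix μ (fun ω => κ ω * Complex.exp (Complex.I * (pwz φ (W ω) y : ℂ))) N w =
      pwzTransform φ μ (twist κ N w) W y :=
  integral_congr_ae (.of_forall fun _ => mul_right_comm _ _ _)

lemma measurable_twist (hκ : Measurable κ) {N : Ω → ℝ} (hN : Measurable N) (w : ℂ) :
    Measurable (twist κ N w) := hκ.mul (measurable_exp_neg_mul hN w)

lemma measurable_norm_mulL_sq {h : ℝ → ℝ} (hh : MemLp h ∞ (leb T)) (hW : Measurable W) :
    Measurable fun ω => ‖mulL hh (W ω)‖ ^ 2 :=
  ((mulL hh).continuous.measurable.comp hW).norm.pow_const 2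

variable {M : Measure (L2 T)} [SFinite M] [IsFiniteMeasure μ] {F : C0 T → ℂ}

lemma IsPWZRep.hasAnalyticWiener (hF : IsPWZRep φ M μ κ W F) (hm : IsWienerMeasure T m)
    (hφ : IsBVBasis T φ) (hκm : Measurable κ) (hκ : Integrable κ μ) (hW : Measurable W)
    {h : ℝ → ℝ} (hh : MemLp h ∞ (leb T)) {y : C0 T} (hy : PWZDomain φ M y) :
    HasAnalyticWiener m (fun c x => F (y + c • gaussPath φ h x)) fun l =>
      gaussMix μ (fun ω => κ ω * Complex.exp (Complex.I * (pwz φ (W ω) y : ℂ)))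
        (fun ω => ‖mulL hh (W ω)‖ ^ 2) l⁻¹ := by
  refine hasAnalyticWiener_of_ae_eq hm hφ (hκm.mul (measurable_exp_pwz_left hφ hW y))
    (integrable_mul_exp_pwz hφ hκ hW y) ((mulL hh).continuous.measurable.comp hW) fun c => ?_
  filter_upwards [hF.ae_eq_add_smul_gaussPath hm hφ hW hh hy] with x hx
  have := hx c 1
  simp_rw [one_smul, one_mul] at this
  exact this

lemma hasAnalyticWiener_tendsto (hφ : IsBVBasis T φ) (hκ : Integrable κ μ) (hW : Measurable W)
    {h : ℝ → ℝ} (hh : MemLp h ∞ (leb T)) {q : ℝ} (hq : q ≠ 0) (y : C0 T) :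
    Tendsto (fun l => gaussMix μ (fun ω => κ ω * Complex.exp (Complex.I * (pwz φ (W ω) y : ℂ)))
        (fun ω => ‖mulL hh (W ω)‖ ^ 2) l⁻¹) (toFeynman q)
      (𝓝 (pwzTransform φ μ (twist κ (fun ω => ‖mulL hh (W ω)‖ ^ 2) (feynmanInv q)) W y)) := by
  rw [← gaussMix_mul_exp]
  exact tendsto_gaussMix (integrable_mul_exp_pwz hφ hκ hW y) (measurable_norm_mulL_sq hh hW)
    (fun _ => sq_nonneg _) hq

/-- The transform of a superposition of exponentials exists and is the superposition with
twisted density. -/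
theorem IsPWZRep.isGFFT (hF : IsPWZRep φ M μ κ W F) (hm : IsWienerMeasure T m)
    (hφ : IsBVBasis T φ) (hκm : Measurable κ) (hκ : Integrable κ μ) (hW : Measurable W)
    {h : ℝ → ℝ} (hh : MemLp h ∞ (leb T)) {q : ℝ} (hq : q ≠ 0) (p : ℝ) {H : C0 T → ℂ}
    (hH : SAE m fun y => H y =
      pwzTransform φ μ (twist κ (fun ω => ‖mulL hh (W ω)‖ ^ 2) (feynmanInv q)) W y) :
    IsGFFT m φ p q h F H := by
  have := hm.isProbabilityMeasure
  have hN := measurable_norm_mulL_sq hh hW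
  have hHm : SIMeasurable m H := (siMeasurable_pwzTransform hφ (measurable_twist hκm hN _) hW).congr hH
  have hTm : ∀ l : ℂ, SIMeasurable m fun y => gaussMix μ (fun ω => κ ω *
      Complex.exp (Complex.I * (pwz φ (W ω) y : ℂ))) (fun ω => ‖mulL hh (W ω)‖ ^ 2) l⁻¹ := fun l => by
    simp_rw [gaussMix_mul_exp]
    exact siMeasurable_pwzTransform hφ (measurable_twist hκm hN _) hW
  refine ⟨(siMeasurable_pwzTransform hφ hκm hW).congr (hF.sae_eq hm hφ), hHm, fun l y =>
    gaussMix μ (fun ω => κ ω * Complex.exp (Complex.I * (pwz φ (W ω) y : ℂ)))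
      (fun ω => ‖mulL hh (W ω)‖ ^ 2) l⁻¹, fun l _ => hTm l, fun ρ hρ => ?_,
    fun _ ρ hρ => ?_, fun hp ρ hρ => ?_⟩
  · filter_upwards [sae_pwzDomain hm hφ M ρ hρ] with y hy
    exact hF.hasAnalyticWiener hm hφ hκm hκ hW hh hy
  · filter_upwards [hH ρ hρ] with y hy
    rw [hy]
    exact hasAnalyticWiener_tendsto hφ hκ hW hh hq _
  -- For `p > 1` the convergence is dominated: both functionals are bounded by the total mass `C` of
  -- `|κ| μ`, uniformly in `l` and `y`.
  · have hr : 0 < p / (p - 1) := div_pos (by linarith) (by linarith)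
    set C : ℝ := ∫ ω, ‖κ ω‖ ∂μ
    have hbd : ∀ (w : ℂ) (hw : 0 ≤ w.re) (y : C0 T), ‖gaussMix μ (fun ω => κ ω *
        Complex.exp (Complex.I * (pwz φ (W ω) y : ℂ))) (fun ω => ‖mulL hh (W ω)‖ ^ 2) w‖ ≤ C := by
      intro w hw y
      refine (norm_gaussMix_le (integrable_mul_exp_pwz hφ hκ hW y) (fun _ => sq_nonneg _) hw).trans
        (le_of_eq ?_)
      simp_rw [norm_mul_exp_pwz]
      rfl
    have h0 : ∫⁻ _ : C0 T, (0 : ℝ≥0∞) ∂m = 0 := lintegral_zero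
    rw [← h0]
    refine tendsto_lintegral_filter_of_dominated_convergence'
      (fun _ => ENNReal.ofReal (C + C) ^ (p / (p - 1))) (.of_forall fun l => ?_) ?_ ?_ ?_
    · exact (((hTm l ρ hρ).sub (hHm ρ hρ)).enorm).pow_const _
    · filter_upwards [eventually_toFeynman q] with l hl
      filter_upwards [hH ρ hρ] with y hy
      rw [hy, ← gaussMix_mul_exp]
      refine ENNReal.rpow_le_rpow ?_ hr.le
      rw [← ofReal_norm]
      exact ENNReal.ofReal_le_ofReal ((norm_sub_le _ _).trans
        (add_le_add (hbd _ (inv_mem_rightHalf hl).le _) (hbd _ (feynmanInv_re q).ge _)))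
    · rw [lintegral_const]
      exact ENNReal.mul_ne_top (ENNReal.rpow_ne_top_of_nonneg hr.le ENNReal.ofReal_ne_top)
        (measure_ne_top _ _)
    · filter_upwards [hH ρ hρ] with y hy
      have h1 := (hasAnalyticWiener_tendsto hφ hκ hW hh hq (ρ • y)).sub_const (H (ρ • y))
      rw [← hy, sub_self] at h1
      have h2 := ((ENNReal.continuous_rpow_const (y := p / (p - 1))).tendsto _).comp h1.enorm
      simp only [enorm_zero, ENNReal.zero_rpow_of_pos hr] at h2
      exact h2

/-- The transform of a superposition of exponentials is determined. -/
theorem IsPWZRep.sae_eq_of_isGFFT (hF : IsPWZRep φ M μ κ W F) (hm : IsWienerMeasure T m)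
    (hφ : IsBVBasis T φ) (hκm : Measurable κ) (hκ : Integrable κ μ) (hW : Measurable W)
    {h : ℝ → ℝ} (hh : MemLp h ∞ (leb T)) {q : ℝ} (hq : q ≠ 0) {p : ℝ} (hp : 1 ≤ p) {H : C0 T → ℂ}
    (hH : IsGFFT m φ p q h F H) : SAE m fun y => H y =
      pwzTransform φ μ (twist κ (fun ω => ‖mulL hh (W ω)‖ ^ 2) (feynmanInv q)) W y := by
  obtain ⟨-, hHm, Tl, hTm, hTl, hone, hgt⟩ := hH
  intro ρ hρ
  have heq : ∀ᵐ y ∂m, ∀ l ∈ rightHalf, gaussMix μ (fun ω => κ ω *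
      Complex.exp (Complex.I * (pwz φ (W ω) (ρ • y) : ℂ))) (fun ω => ‖mulL hh (W ω)‖ ^ 2) l⁻¹ =
        Tl l (ρ • y) := by
    filter_upwards [sae_pwzDomain hm hφ M ρ hρ, hTl ρ hρ] with y hy h1
    exact fun l hl => (hF.hasAnalyticWiener hm hφ hκm hκ hW hh hy).eqOn h1 hl
  have hlim : ∀ᵐ y ∂m, Tendsto (fun l => Tl l (ρ • y)) (toFeynman q) (𝓝
      (pwzTransform φ μ (twist κ (fun ω => ‖mulL hh (W ω)‖ ^ 2) (feynmanInv q)) W (ρ • y))) := by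
    filter_upwards [heq] with y hy
    refine (hasAnalyticWiener_tendsto hφ hκ hW hh hq (ρ • y)).congr' ?_
    filter_upwards [eventually_toFeynman q] with l hl using hy l hl
  rcases hp.eq_or_lt with hp | hp
  · filter_upwards [hlim, hone hp.symm ρ hρ] with y h1 h2
    exact tendsto_nhds_unique h2 h1
  · have hr : 0 < p / (p - 1) := div_pos (by linarith) (by linarith)
    have hN := measurable_norm_mulL_sq hh hW
    have h0m := siMeasurable_pwzTransform (m := m) hφ
      (measurable_twist hκm hN (feynmanInv q)) hW (μ := μ) ρ hρ
    -- Fatou's lemma needs a sequence. It is shifted by `n₀` so that all its terms lie in the right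
    -- half-plane, where the measurability of `Tl` is known.
    obtain ⟨s, hs⟩ := exists_seq_tendsto (toFeynman q)
    obtain ⟨n₀, hn₀⟩ := eventually_atTop.1 (hs.eventually (eventually_toFeynman q))
    set l : ℕ → ℂ := fun n => s (n + n₀)
    have hl : Tendsto l atTop (toFeynman q) := hs.comp (tendsto_add_atTop_nat n₀)
    have hlr : ∀ n, l n ∈ rightHalf := fun n => hn₀ _ (Nat.le_add_left _ _)
    have hfat : ∫⁻ y, liminf (fun n => ‖Tl (l n) (ρ • y) - H (ρ • y)‖ₑ ^ (p / (p - 1))) atTop ∂m = 0 := by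
      refine le_antisymm ?_ zero_le
      rw [← ((hgt hp ρ hρ).comp hl).liminf_eq]
      exact lintegral_liminf_le' fun n =>
        ((hTm _ (hlr n) ρ hρ).sub (hHm ρ hρ)).enorm.pow_const _
    have hli : ∀ᵐ y ∂m, liminf (fun n => ‖Tl (l n) (ρ • y) - H (ρ • y)‖ₑ ^ (p / (p - 1))) atTop =
        ‖pwzTransform φ μ (twist κ (fun ω => ‖mulL hh (W ω)‖ ^ 2) (feynmanInv q)) W (ρ • y) -
          H (ρ • y)‖ₑ ^ (p / (p - 1)) := by
      filter_upwards [hlim] with y hy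
      exact (((ENNReal.continuous_rpow_const (y := p / (p - 1))).tendsto _).comp
        ((hy.comp hl).sub_const _).enorm).liminf_eq
    rw [lintegral_congr_ae hli] at hfat
    filter_upwards [(lintegral_eq_zero_iff' ((h0m.sub (hHm ρ hρ)).enorm.pow_const _)).1 hfat] with y hy
    have h1 := (ENNReal.rpow_eq_zero_iff_of_pos hr).1 hy
    exact (sub_eq_zero.1 (enorm_eq_zero.1 h1)).symm

end Transform

/-! ### The class `S(L₂[0,T])` and uniqueness of the representing measure. -/

section FresnelClass

variable {T : ℝ} [hT : Fact (0 < T)] {φ : ℕ → ℝ → ℝ} {m : Measure (C0 T)}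

lemma integral_withDensityᵥ_exp_pwz (hφ : IsBVBasis T φ) {Ω : Type*} [MeasurableSpace Ω]
    {μ : Measure Ω} [IsFiniteMeasure μ] {κ : Ω → ℂ} (hκ : Integrable κ μ) (hκ1 : ∀ᵐ ω ∂μ, ‖κ ω‖ = 1)
    {W : Ω → L2 T} (hW : Measurable W) (y : C0 T) :
    ∫ᵛ ω, Complex.exp (Complex.I * (pwz φ (W ω) y : ℂ))
      ∂[ContinuousLinearMap.mul ℝ ℂ; μ.withDensityᵥ κ] = pwzTransform φ μ κ W y := by
  rw [integral_withDensityᵥ_eq hκ hκ1]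
  · exact integral_congr_ae (.of_forall fun _ => mul_comm _ _)
  · exact Integrable.of_bound (measurable_exp_pwz_left hφ hW y).aestronglyMeasurable 1
      (.of_forall fun _ => (norm_exp_I_mul _).le)

/-- A functional of the class `S(L₂[0,T])` is represented by a density of modulus one with respect
to a finite measure. -/
theorem MemS.exists_isPWZRep (hφ : IsBVBasis T φ) {F : C0 T → ℂ} (hF : MemS φ F) :
    ∃ μ : Measure (L2 T), IsFiniteMeasure μ ∧ ∃ θ : L2 T → ℂ, Measurable θ ∧ Integrable θ μ ∧
      (∀ᵐ u ∂μ, ‖θ u‖ = 1) ∧ IsPWZRep φ μ μ θ (fun u => u) F := by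
  obtain ⟨f, hf⟩ := hF
  have hfin := isFiniteMeasure_variation_complex f
  obtain ⟨θ, hθm, hθ, hθ1, heq⟩ := exists_density_variation f
  refine ⟨f.variation, hfin, θ, hθm, hθ, hθ1, fun y hy => ⟨hy, ?_⟩⟩
  have h := integral_withDensityᵥ_exp_pwz hφ hθ hθ1 (W := fun u => u) measurable_id y
  rw [← heq] at h
  rw [hf y hy, h]

/-- The representing measure is the image under `W` of the complex measure with density `κ`.
Equality holds at every path, because `pwz` takes the same default value on both sides. -/
theorem exists_memS_eq_pwzTransform (hφ : IsBVBasis T φ) {Ω : Type*} [MeasurableSpace Ω]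
    {μ : Measure Ω} [IsFiniteMeasure μ] {κ : Ω → ℂ} (hκ : Integrable κ μ) (hκ1 : ∀ᵐ ω ∂μ, ‖κ ω‖ = 1)
    {W : Ω → L2 T} (hW : Measurable W) :
    ∃ C, MemS φ C ∧ ∀ y, C y = pwzTransform φ μ κ W y := by
  refine ⟨fun y => ∫ᵛ u : L2 T, Complex.exp (Complex.I * (pwz φ u y : ℂ))
    ∂[ContinuousLinearMap.mul ℝ ℂ; (μ.withDensityᵥ κ).map W], ⟨_, fun _ _ => rfl⟩, fun y => ?_⟩
  have hmeas := measurable_exp_pwz_left (W := fun u : L2 T => u) hφ measurable_id y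
  have hv := variation_withDensityᵥ_of_norm_eq_one hκ hκ1
  simp only
  rw [← integral_withDensityᵥ_exp_pwz hφ hκ hκ1 hW y]
  refine VectorMeasure.integral_map hW hmeas.aestronglyMeasurable ?_
  rw [VectorMeasure.Integrable, hv]
  exact Integrable.of_bound (hmeas.comp hW).aestronglyMeasurable 1
      (.of_forall fun _ => (norm_exp_I_mul _).le)

/-- Integrating `exp(i⟨u - v, y⟩)` over Wiener space gives `exp(-‖u - v‖²/2)`. Almost everywhere
values of the functional thus determine the Gaussian convolutions of its measure. -/
lemma integral_pwzTransform_mul_exp (hm : IsWienerMeasure T m) (hφ : IsBVBasis T φ)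
    {μ : Measure (L2 T)} [IsFiniteMeasure μ] {κ : L2 T → ℂ} (hκm : Measurable κ)
    (hκ : Integrable κ μ) (v : L2 T) :
    ∫ y, pwzTransform φ μ κ (fun u => u) y * Complex.exp (-(Complex.I * (pwz φ v y : ℂ))) ∂m =
      gaussMix μ κ (fun u => ‖u - v‖ ^ 2) 1 := by
  have h := (integral_pwzTransform_smul hm hφ hκm hκ (W := fun u => u - v) (by fun_prop) 1).2
  rw [one_pow, Complex.ofReal_one] at h
  rw [← h]
  refine integral_congr_ae ?_
  filter_upwards [ae_pwzDomain hm hφ μ, ae_hasPWZ hm hφ v] with y hy hv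
  rw [pwzTransform, ← integral_mul_const]
  refine integral_congr_ae ?_
  filter_upwards [hy] with u hu
  rw [((hasPWZ_pwz hu).sub hφ hv).pwz_eq, mul_assoc, ← Complex.exp_add]
  congr 2
  push_cast; ring

lemma integral_withDensityᵥ_gauss {μ : Measure (L2 T)} [IsFiniteMeasure μ] {κ : L2 T → ℂ}
    (hκ : Integrable κ μ) (hκ1 : ∀ᵐ u ∂μ, ‖κ u‖ = 1) (v : L2 T) :
    ∫ᵛ u, (Real.exp (-(‖u - v‖ ^ 2 / 2)) : ℂ)
      ∂[ContinuousLinearMap.mul ℝ ℂ; μ.withDensityᵥ κ] = gaussMix μ κ (fun u => ‖u - v‖ ^ 2) 1 := by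
  rw [integral_withDensityᵥ_eq hκ hκ1]
  · refine integral_congr_ae (.of_forall fun u => ?_)
    simp only
    rw [mul_comm]; push_cast; rw [mul_one]
  · refine Integrable.of_bound (Measurable.aestronglyMeasurable (by fun_prop)) 1
      (.of_forall fun u => ?_)
    rw [Complex.norm_real, Real.norm_eq_abs, Real.abs_exp, Real.exp_le_one_iff]
    have := sq_nonneg ‖u - v‖
    linarith

/-- The measure that represents a functional of the class `S(L₂[0,T])` is determined by the values
of the functional almost everywhere. -/
theorem MemS.isPWZRep_of_ae_eq (hm : IsWienerMeasure T m) (hφ : IsBVBasis T φ) {H : C0 T → ℂ}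
    (hH : MemS φ H) {μ : Measure (L2 T)} [IsFiniteMeasure μ] {κ : L2 T → ℂ} (hκm : Measurable κ)
    (hκ : Integrable κ μ) (hκ1 : ∀ᵐ u ∂μ, ‖κ u‖ = 1)
    (hHκ : ∀ᵐ y ∂m, H y = pwzTransform φ μ κ (fun u => u) y) :
    IsPWZRep φ μ μ κ (fun u => u) H := by
  obtain ⟨c, hc⟩ := hH
  have hfin := isFiniteMeasure_variation_complex c
  obtain ⟨θ, hθm, hθ, hθ1, heq⟩ := exists_density_variation c
  have hcθ : ∀ y, PWZDomain φ c.variation y → H y = pwzTransform φ c.variation θ (fun u => u) y := by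
    intro y hy
    have h := integral_withDensityᵥ_exp_pwz hφ hθ hθ1 (W := fun u => u) measurable_id y
    rw [← heq] at h
    rw [hc y hy, h]
  have hcμ : c = μ.withDensityᵥ κ := by
    refine complexMeasure_ext_of_gaussian fun v => ?_
    have h1 := integral_withDensityᵥ_gauss hθ hθ1 v
    rw [← heq] at h1
    rw [h1, integral_withDensityᵥ_gauss hκ hκ1 v, ← integral_pwzTransform_mul_exp hm hφ hθm hθ v,
      ← integral_pwzTransform_mul_exp hm hφ hκm hκ v]
    refine integral_congr_ae ?_
    filter_upwards [hHκ, ae_pwzDomain hm hφ c.variation] with y h2 h3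
    rw [← h2, ← hcθ y h3]
  -- Equal variations mean equal exceptional sets of paths, so the formula holds on the whole domain
  -- of `μ` and not merely almost everywhere.
  have hv : c.variation = μ := by rw [hcμ, variation_withDensityᵥ_of_norm_eq_one hκ hκ1]
  intro y hy
  refine ⟨hy, ?_⟩
  rw [hc y (by rw [hv]; exact hy), hcμ]
  exact integral_withDensityᵥ_exp_pwz hφ hκ hκ1 (W := fun u => u) measurable_id y

end FresnelClass

/-! ### Iterated transforms. -/

section Iterated

variable {T : ℝ} [hT : Fact (0 < T)] {φ : ℕ → ℝ → ℝ} {m : Measure (C0 T)}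

/-- The quadratic form `u ↦ ∫₀ᵀ k² u²`. -/
def sqForm {T : ℝ} (k : ℝ → ℝ) (u : L2 T) : ℝ := ∫ t, k t ^ 2 * u t ^ 2 ∂(leb T)

lemma norm_mulL_sq_eq_sqForm {T : ℝ} {k : ℝ → ℝ} (hk : MemLp k ∞ (leb T)) (u : L2 T) :
    ‖mulL hk u‖ ^ 2 = sqForm k u := norm_mulL_sq hk u

/-- The sum of the quadratic forms of a list of kernels. -/
def sqForms {T : ℝ} (L : List (ℝ → ℝ)) (u : L2 T) : ℝ := (L.map fun k => sqForm k u).sum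

section Twist

variable {Ω : Type*} [MeasurableSpace Ω] {μ : Measure Ω} {κ : Ω → ℂ} {N : Ω → ℝ}

lemma norm_twist_feynmanInv (q : ℝ) (ω : Ω) : ‖twist κ N (feynmanInv q) ω‖ = ‖κ ω‖ := by
  rw [twist, norm_mul, norm_exp_feynmanInv, mul_one]

lemma integrable_twist (hκm : Measurable κ) (hκ : Integrable κ μ) (hN : Measurable N) (q : ℝ) :
    Integrable (twist κ N (feynmanInv q)) μ :=
  hκ.mono (measurable_twist hκm hN _).aestronglyMeasurable
    (.of_forall fun ω => (norm_twist_feynmanInv q ω).le)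

end Twist

variable {μ : Measure (L2 T)} [IsFiniteMeasure μ]

/-- Each transform multiplies the density by a unimodular factor, and the exponents add. An
intermediate transform is known only s-a.e.; its membership in the class restores the pointwise
representation that the next transform needs. -/
lemma isIterGFFT_rep (hm : IsWienerMeasure T m) (hφ : IsBVBasis T φ) {p q : ℝ} (hp : 1 ≤ p)
    (hq : q ≠ 0) (L : List (ℝ → ℝ)) (hL : ∀ k ∈ L, MemLp k ∞ (leb T)) :
    ∀ {F : C0 T → ℂ} {κ : L2 T → ℂ}, Measurable κ → Integrable κ μ → (∀ᵐ u ∂μ, ‖κ u‖ = 1) →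
      IsPWZRep φ μ μ κ (fun u => u) F → (∃ A, IsIterGFFT m φ p q L F A) ∧
      ∀ A, IsIterGFFT m φ p q L F A →
        IsPWZRep φ μ μ (twist κ (sqForms L) (feynmanInv q)) (fun u => u) A := by
  induction L with
  | nil =>
    intro F κ _ _ _ hF
    refine ⟨⟨F, rfl⟩, fun A hA => ?_⟩
    have h1 : A = F := hA
    have h2 : twist κ (sqForms []) (feynmanInv q) = κ := by
      funext u; simp [twist, sqForms]
    rw [h1, h2]
    exact hF
  | cons k L ih =>
    intro F κ hκm hκ hκ1 hF
    have hk := hL k List.mem_cons_self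
    have hN : Measurable fun u : L2 T => ‖mulL hk u‖ ^ 2 :=
      measurable_norm_mulL_sq (W := fun u => u) hk measurable_id
    set κ' := twist κ (fun u => ‖mulL hk u‖ ^ 2) (feynmanInv q)
    have hκm' : Measurable κ' := measurable_twist hκm hN _
    have hκ' : Integrable κ' μ := integrable_twist hκm hκ hN q
    have hκ1' : ∀ᵐ u ∂μ, ‖κ' u‖ = 1 :=
      hκ1.mono fun u hu => (norm_twist_feynmanInv q u).trans hu
    have htw : twist κ' (sqForms L) (feynmanInv q) = twist κ (sqForms (k :: L)) (feynmanInv q) := by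
      funext u
      simp only [κ', twist, mul_assoc, ← Complex.exp_add]
      congr 2
      rw [sqForms, sqForms, List.map_cons, List.sum_cons, norm_mulL_sq_eq_sqForm]
      push_cast; ring
    rw [← htw]
    have hrec := fun {H : C0 T → ℂ} => ih (fun j hj => hL j (List.mem_cons_of_mem _ hj)) (F := H)
      hκm' hκ' hκ1'
    constructor
    · obtain ⟨H, hHS, hH⟩ := exists_memS_eq_pwzTransform hφ hκ' hκ1' (W := fun u => u) measurable_id
      obtain ⟨A, hA⟩ := (hrec (hHS.isPWZRep_of_ae_eq hm hφ hκm' hκ' hκ1' (.of_forall hH))).1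
      exact ⟨A, H, hHS, hF.isGFFT hm hφ hκm hκ measurable_id hk hq p
        (fun ρ _ => .of_forall fun y => hH _), hA⟩
    · rintro A ⟨H, hHS, hH, hA⟩
      have h1 := hF.sae_eq_of_isGFFT hm hφ hκm hκ measurable_id hk hq hp hH 1 one_pos
      simp_rw [one_smul] at h1
      exact (hrec (hHS.isPWZRep_of_ae_eq hm hφ hκm' hκ' hκ1' h1)).2 A hA

end Iterated

/-! ### Products and convolution products. -/

section Product

variable {T : ℝ} [hT : Fact (0 < T)] {φ : ℕ → ℝ → ℝ} {m : Measure (C0 T)}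

variable {μ ν : Measure (L2 T)} [IsFiniteMeasure μ] [IsFiniteMeasure ν]
  {a b : L2 T → ℂ} {A B : C0 T → ℂ}

/-- The vector `(u + v) / √2`. -/
def halfSum (z : L2 T × L2 T) : L2 T := (Real.sqrt 2)⁻¹ • (z.1 + z.2)

lemma measurable_halfSum {T : ℝ} : Measurable (halfSum (T := T)) := by unfold halfSum; fun_prop

lemma HasPWZ.halfSum (hφ : IsBVBasis T φ) {z : L2 T × L2 T} {y : C0 T} {r s : ℝ}
    (hr : HasPWZ φ z.1 y r) (hs : HasPWZ φ z.2 y s) :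
    HasPWZ φ (halfSum z) y ((Real.sqrt 2)⁻¹ * (r + s)) := (hr.add hφ hs).smul hφ _

lemma ae_prod_and {X Y : Type*} [MeasurableSpace X] [MeasurableSpace Y] {μ : Measure X}
    {ν : Measure Y} [SFinite ν] {P : X → Prop} {Q : Y → Prop} (hP : ∀ᵐ u ∂μ, P u)
    (hQ : ∀ᵐ v ∂ν, Q v) : ∀ᵐ z ∂(μ.prod ν), P z.1 ∧ Q z.2 :=
  (Measure.quasiMeasurePreserving_fst.ae hP).and (Measure.quasiMeasurePreserving_snd.ae hQ)

lemma PWZDomain.of_add {y : C0 T} (hy : PWZDomain φ (μ + ν) y) :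
    PWZDomain φ μ y ∧ PWZDomain φ ν y := ae_add_measure_iff.1 hy

/-- Fubini over pairs of frequencies: the factor `1/√2` passes from the path to the frequency, and
exponents add. The sum `μ + ν` encodes the intersection of the two domains. -/
lemma IsPWZRep.mul_halfSum (hφ : IsBVBasis T φ) (hA : IsPWZRep φ μ μ a (fun u => u) A)
    (hB : IsPWZRep φ ν ν b (fun u => u) B) :
    IsPWZRep φ (μ + ν) (μ.prod ν) (fun z => a z.1 * b z.2) halfSum
      fun x => A ((Real.sqrt 2)⁻¹ • x) * B ((Real.sqrt 2)⁻¹ • x) := by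
  intro y hy
  obtain ⟨hyμ, hyν⟩ := hy.of_add
  have hz := ae_prod_and hyμ hyν
  refine ⟨hz.mono fun z ⟨⟨r, hr⟩, ⟨s, hs⟩⟩ => ⟨_, hr.halfSum hφ hs⟩, ?_⟩
  change A _ * B _ = _
  rw [(hA _ (hyμ.smul hφ _)).2, (hB _ (hyν.smul hφ _)).2, pwzTransform, pwzTransform,
    ← integral_prod_mul]
  refine integral_congr_ae ?_
  filter_upwards [hz] with z ⟨hr, hs⟩
  have hr := hasPWZ_pwz hr
  have hs := hasPWZ_pwz hs
  rw [(hr.halfSum hφ hs).pwz_eq, (hr.smul_path hφ _).pwz_eq, (hs.smul_path hφ _).pwz_eq,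
    mul_mul_mul_comm, ← Complex.exp_add]
  congr 2
  push_cast; ring

/-- The vector `(h₁ u - h₂ v) / √2`. -/
def halfDiff {h₁ h₂ : ℝ → ℝ} (hh₁ : MemLp h₁ ∞ (leb T)) (hh₂ : MemLp h₂ ∞ (leb T))
    (z : L2 T × L2 T) : L2 T := (Real.sqrt 2)⁻¹ • (mulL hh₁ z.1 - mulL hh₂ z.2)

lemma measurable_halfDiff {h₁ h₂ : ℝ → ℝ} (hh₁ : MemLp h₁ ∞ (leb T)) (hh₂ : MemLp h₂ ∞ (leb T)) :
    Measurable (halfDiff hh₁ hh₂) := by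
  unfold halfDiff; fun_prop

lemma add_neg_smul_path {T : ℝ} (y z : C0 T) (c : ℝ) : y + (-c) • z = y - c • z := by
  module

/-- The generalized convolution product of superpositions of exponentials. -/
theorem IsPWZRep.isGCP (hm : IsWienerMeasure T m) (hφ : IsBVBasis T φ)
    (hA : IsPWZRep φ μ μ a (fun u => u) A) (hB : IsPWZRep φ ν ν b (fun u => u) B)
    (ham : Measurable a) (ha : Integrable a μ) (hbm : Measurable b) (hb : Integrable b ν)
    {h₁ h₂ : ℝ → ℝ} (hh₁ : MemLp h₁ ∞ (leb T)) (hh₂ : MemLp h₂ ∞ (leb T)) {q : ℝ} (hq : q ≠ 0)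
    {C : C0 T → ℂ} (hC : SAE m fun y => C y = pwzTransform φ (μ.prod ν) (twist
      (fun z => a z.1 * b z.2) (fun z => ‖halfDiff hh₁ hh₂ z‖ ^ 2) (feynmanInv q)) halfSum y) :
    IsGCP m φ q h₁ h₂ A B C := by
  refine ⟨(siMeasurable_pwzTransform hφ ham measurable_id).congr (hA.sae_eq hm hφ),
    (siMeasurable_pwzTransform hφ hbm measurable_id).congr (hB.sae_eq hm hφ), fun ρ hρ => ?_⟩
  have habm : Measurable fun z : L2 T × L2 T => a z.1 * b z.2 :=
    (ham.comp measurable_fst).mul (hbm.comp measurable_snd)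
  have hab : Integrable (fun z : L2 T × L2 T => a z.1 * b z.2) (μ.prod ν) := ha.mul_prod hb
  have hN : Measurable fun z => ‖halfDiff hh₁ hh₂ z‖ ^ 2 :=
    (measurable_halfDiff hh₁ hh₂).norm.pow_const 2
  filter_upwards [sae_pwzDomain hm hφ μ ρ hρ, sae_pwzDomain hm hφ ν ρ hρ, hC ρ hρ] with y' hyμ hyν hy
  rw [hy]
  set y := ρ • y'
  have hκ := integrable_mul_exp_pwz hφ hab measurable_halfSum y
  refine ⟨_, hasAnalyticWiener_of_ae_eq hm hφ
    (habm.mul (measurable_exp_pwz_left hφ measurable_halfSum y)) hκ (measurable_halfDiff hh₁ hh₂)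
    (fun c => ?_), ?_⟩
  · filter_upwards [hA.ae_eq_add_smul_gaussPath hm hφ measurable_id hh₁ hyμ,
      hB.ae_eq_add_smul_gaussPath hm hφ measurable_id hh₂ hyν,
      ae_ae_hasPWZ μ hm hφ (W := fun u => mulL hh₁ u) (mulL hh₁).continuous.measurable,
      ae_ae_hasPWZ ν hm hφ (W := fun u => mulL hh₂ u) (mulL hh₂).continuous.measurable]
      with x h1 h2 h3 h4
    -- The second factor is shifted by `-c`, which produces the difference in `halfDiff`.
    have h5 := h2 (-c) (Real.sqrt 2)⁻¹
    rw [add_neg_smul_path] at h5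
    rw [h1, h5, ← integral_prod_mul]
    simp only [Pi.mul_apply]
    refine integral_congr_ae ?_
    filter_upwards [ae_prod_and hyμ hyν, ae_prod_and h3 h4] with z ⟨hr, hs⟩ ⟨hr', hs'⟩
    have h6 := (((hasPWZ_pwz hr').sub hφ (hasPWZ_pwz hs')).smul hφ (Real.sqrt 2)⁻¹).pwz_eq
    have h7 := ((hasPWZ_pwz hr).halfSum hφ (hasPWZ_pwz hs)).pwz_eq
    rw [halfDiff, h6, h7, mul_mul_mul_comm, mul_mul_mul_comm (a z.1), ← Complex.exp_add,
      ← Complex.exp_add, mul_assoc (a z.1 * b z.2), mul_assoc (a z.1 * b z.2), ← Complex.exp_add,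
      ← Complex.exp_add]
    congr 2
    push_cast; ring
  · rw [← gaussMix_mul_exp]
    exact tendsto_gaussMix hκ hN (fun _ => sq_nonneg _) hq

end Product

/-! ### The quadratic identity behind the theorem. -/

section QuadraticForms

variable {T : ℝ} {h s s₁ s₂ r : ℝ → ℝ}

lemma integrable_sqForm {k : ℝ → ℝ} (hk : MemLp k ∞ (leb T)) (u : L2 T) :
    Integrable (fun t => k t ^ 2 * u t ^ 2) (leb T) := by
  refine (Lp.memLp (mulL hk u)).integrable_sq.congr ?_
  filter_upwards [coeFn_mulL hk u] with t ht
  rw [ht, mul_pow]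

lemma inv_sqrt_two_sq : (Real.sqrt 2)⁻¹ ^ 2 = (1 / 2 : ℝ) := by
  rw [inv_pow, Real.sq_sqrt zero_le_two, one_div]

lemma sqForm_smul (k : ℝ → ℝ) (u : L2 T) : sqForm ((Real.sqrt 2)⁻¹ • k) u = 1 / 2 * sqForm k u := by
  rw [sqForm, sqForm, ← integral_const_mul]
  refine integral_congr_ae (.of_forall fun t => ?_)
  simp only [Pi.smul_apply, smul_eq_mul, mul_pow, inv_sqrt_two_sq]
  ring

lemma sqForm_eq_sum {n : ℕ} {k : Fin n → ℝ → ℝ} (hk : ∀ j, MemLp (k j) ∞ (leb T))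
    (hs : ∀ᵐ t ∂(leb T), s t ^ 2 = ∑ j, k j t ^ 2) (u : L2 T) :
    sqForm s u = ∑ j, sqForm (k j) u := by
  simp only [sqForm]
  rw [← integral_finsetSum _ fun j _ => integrable_sqForm (hk j) u]
  refine integral_congr_ae ?_
  filter_upwards [hs] with t ht
  rw [ht, Finset.sum_mul]

lemma sqForm_eq_add (hh : MemLp h ∞ (leb T)) (hs : MemLp s ∞ (leb T))
    (hr : ∀ᵐ t ∂(leb T), r t ^ 2 = h t ^ 2 + s t ^ 2) (u : L2 T) :
    sqForm r u = sqForm h u + sqForm s u := by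
  rw [sqForm, sqForm, sqForm, ← integral_add (integrable_sqForm hh u) (integrable_sqForm hs u)]
  refine integral_congr_ae ?_
  filter_upwards [hr] with t ht
  rw [ht, add_mul]

/-- This is where `h² = s₁ s₂` enters: it identifies the cross term of the convolution with that of
the transform of the product. -/
lemma inner_mulL_mulL (hh : MemLp h ∞ (leb T)) (hs₁ : MemLp s₁ ∞ (leb T))
    (hs₂ : MemLp s₂ ∞ (leb T)) (hprod : ∀ᵐ t ∂(leb T), h t ^ 2 = s₁ t * s₂ t) (u v : L2 T) :
    inner ℝ (mulL hs₁ u) (mulL hs₂ v) = inner ℝ (mulL hh u) (mulL hh v) := by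
  rw [L2.inner_def, L2.inner_def]
  refine integral_congr_ae ?_
  filter_upwards [hprod, coeFn_mulL hs₁ u, coeFn_mulL hs₂ v, coeFn_mulL hh u, coeFn_mulL hh v]
    with t h1 h2 h3 h4 h5
  simp only [h2, h3, h4, h5, RCLike.inner_apply, conj_trivial]
  linear_combination -(u t * v t) * h1

/-- Expanding both squares, the `s₁` and `s₂` terms cancel, and minus the cross term of the
difference is the cross term of the sum. The left side is the total exponent of the convolution
product, the right side that of the transform. -/
lemma norm_halfDiff_add (hh : MemLp h ∞ (leb T)) (hs₁ : MemLp s₁ ∞ (leb T))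
    (hs₂ : MemLp s₂ ∞ (leb T)) (hprod : ∀ᵐ t ∂(leb T), h t ^ 2 = s₁ t * s₂ t) (z : L2 T × L2 T) :
    1 / 2 * (sqForm h z.1 + sqForm s₁ z.1) + 1 / 2 * (sqForm h z.2 + sqForm s₂ z.2) -
      ‖halfDiff hs₁ hs₂ z‖ ^ 2 = ‖mulL hh (halfSum z)‖ ^ 2 := by
  rw [halfSum, halfDiff, map_smul, map_add, norm_smul, norm_smul, mul_pow, mul_pow, norm_sub_sq_real,
    norm_add_sq_real, inner_mulL_mulL hh hs₁ hs₂ hprod, norm_mulL_sq_eq_sqForm,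
    norm_mulL_sq_eq_sqForm, norm_mulL_sq_eq_sqForm, norm_mulL_sq_eq_sqForm, Real.norm_eq_abs, sq_abs,
    inv_sqrt_two_sq]
  ring

end QuadraticForms

/-! ### Convolution products of iterated transforms. -/

section IteratedTransforms

variable {T : ℝ} [hT : Fact (0 < T)] {φ : ℕ → ℝ → ℝ} {m : Measure (C0 T)}

lemma measurable_sqForms {L : List (ℝ → ℝ)} (hL : ∀ k ∈ L, MemLp k ∞ (leb T)) :
    Measurable (sqForms (T := T) L) := by
  induction L with
  | nil => exact measurable_const
  | cons k L ih =>
    have h1 : Measurable (sqForm (T := T) k) := by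
      rw [← funext (norm_mulL_sq_eq_sqForm (hL k (by simp)))]
      exact measurable_norm_mulL_sq (hL k (by simp)) measurable_id
    exact h1.add (ih fun k hk => hL k (by simp [hk]))

lemma sqForms_ofFn_append {n : ℕ} {k : Fin n → ℝ → ℝ} {s h : ℝ → ℝ}
    (hk : ∀ j, MemLp (k j) ∞ (leb T)) (hs : ∀ᵐ t ∂(leb T), s t ^ 2 = ∑ j, k j t ^ 2) (u : L2 T) :
    sqForms (List.ofFn (fun j => (Real.sqrt 2)⁻¹ • k j) ++ [(Real.sqrt 2)⁻¹ • h]) u =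
      1 / 2 * (sqForm h u + sqForm s u) := by
  rw [sqForm_eq_sum hk hs u]
  simp only [sqForms, List.map_append, List.map_ofFn, List.sum_append, List.sum_ofFn,
    Function.comp_apply, sqForm_smul, List.map_cons, List.map_nil, List.sum_singleton,
    ← Finset.mul_sum]
  ring

lemma sqForms_pair {s h : ℝ → ℝ} (u : L2 T) :
    sqForms [(Real.sqrt 2)⁻¹ • s, (Real.sqrt 2)⁻¹ • h] u = 1 / 2 * (sqForm h u + sqForm s u) := by
  simp only [sqForms, List.map_cons, List.map_nil, List.sum_cons, List.sum_nil, sqForm_smul]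
  ring

lemma sqForms_singleton {s h r : ℝ → ℝ} (hh : MemLp h ∞ (leb T)) (hs : MemLp s ∞ (leb T))
    (hr : ∀ᵐ t ∂(leb T), r t ^ 2 = h t ^ 2 + s t ^ 2) (u : L2 T) :
    sqForms [(Real.sqrt 2)⁻¹ • r] u = 1 / 2 * (sqForm h u + sqForm s u) := by
  simp only [sqForms, List.map_cons, List.map_nil, List.sum_cons, List.sum_nil, sqForm_smul,
    sqForm_eq_add hh hs hr u, add_zero]

variable {μ ν : Measure (L2 T)} [IsFiniteMeasure μ] [IsFiniteMeasure ν] {a b : L2 T → ℂ}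
  {F G C : C0 T → ℂ}

/-- The convolution product of iterated transforms is determined by the sums of the squares of
the kernels. -/
theorem gcpOfIterGFFT_of_sqForms (hm : IsWienerMeasure T m) (hφ : IsBVBasis T φ)
    (hF : IsPWZRep φ μ μ a (fun u => u) F) (hG : IsPWZRep φ ν ν b (fun u => u) G)
    (ham : Measurable a) (ha : Integrable a μ) (ha1 : ∀ᵐ u ∂μ, ‖a u‖ = 1)
    (hbm : Measurable b) (hb : Integrable b ν) (hb1 : ∀ᵐ u ∂ν, ‖b u‖ = 1)
    {h s₁ s₂ : ℝ → ℝ} (hh : MemLp h ∞ (leb T)) (hs₁ : MemLp s₁ ∞ (leb T))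
    (hs₂ : MemLp s₂ ∞ (leb T)) (hprod : ∀ᵐ t ∂(leb T), h t ^ 2 = s₁ t * s₂ t)
    {p q : ℝ} (hp : 1 ≤ p) (hq : q ≠ 0)
    (hC : SAE m fun y => C y = pwzTransform φ (μ.prod ν) (twist
      (fun z => a z.1 * b z.2) (fun z => ‖mulL hh (halfSum z)‖ ^ 2) (feynmanInv q)) halfSum y)
    {L₁ L₂ : List (ℝ → ℝ)} (hL₁ : ∀ k ∈ L₁, MemLp k ∞ (leb T)) (hL₂ : ∀ k ∈ L₂, MemLp k ∞ (leb T))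
    (h₁ : ∀ u : L2 T, sqForms L₁ u = 1 / 2 * (sqForm h u + sqForm s₁ u))
    (h₂ : ∀ u : L2 T, sqForms L₂ u = 1 / 2 * (sqForm h u + sqForm s₂ u)) :
    GCPOfIterGFFT m φ p q (-q) s₁ s₂ L₁ L₂ F G C := by
  obtain ⟨hA, hA'⟩ := isIterGFFT_rep hm hφ hp hq L₁ hL₁ ham ha ha1 hF
  obtain ⟨hB, hB'⟩ := isIterGFFT_rep hm hφ hp hq L₂ hL₂ hbm hb hb1 hG
  refine ⟨hA, hB, fun A B hAit hBit => ?_⟩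
  refine (hA' A hAit).isGCP hm hφ (hB' B hBit) (measurable_twist ham (measurable_sqForms hL₁) _)
    (integrable_twist ham ha (measurable_sqForms hL₁) q)
    (measurable_twist hbm (measurable_sqForms hL₂) _)
    (integrable_twist hbm hb (measurable_sqForms hL₂) q) hs₁ hs₂ (neg_ne_zero.2 hq) ?_
  intro ρ hρ
  filter_upwards [hC ρ hρ] with y hy
  rw [hy]
  congr 1
  funext z
  simp only [twist]
  -- The parameter `-q` of the convolution reverses the sign of its exponent (`feynmanInv_neg`),
  -- which supplies the minus sign in `norm_halfDiff_add`.
  rw [mul_mul_mul_comm, ← Complex.exp_add, mul_assoc (a z.1 * b z.2),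
    ← Complex.exp_add, ← norm_halfDiff_add hh hs₁ hs₂ hprod z, h₁, h₂, feynmanInv_neg]
  congr 2
  push_cast; ring

end IteratedTransforms

end WienerGFFT

end

/-! ### The theorem. -/

open WienerGFFT in
theorem theorem5p3 (T : ℝ) [Fact (0 < T)] (m : Measure (C0 T)) (hm : IsWienerMeasure T m)
    (φ : ℕ → ℝ → ℝ) (hφ : IsBVBasis T φ)
    (F G : C0 T → ℂ) (hF : MemS φ F) (hG : MemS φ G)
    (h : ℝ → ℝ) (hh : NonzeroLinfty T h)
    (n₁ n₂ : ℕ) (k₁ : Fin n₁ → ℝ → ℝ) (k₂ : Fin n₂ → ℝ → ℝ)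
    (hk₁ : ∀ j, NonzeroLinfty T (k₁ j)) (hk₂ : ∀ j, NonzeroLinfty T (k₂ j))
    -- `s₁ = s(K₁)` and `s₂ = s(K₂)`
    (s₁ s₂ : ℝ → ℝ) (hs₁ : MemLp s₁ ∞ (leb T)) (hs₂ : MemLp s₂ ∞ (leb T))
    (hs₁' : ∀ᵐ t ∂(leb T), s₁ t ^ 2 = ∑ j, k₁ j t ^ 2)
    (hs₂' : ∀ᵐ t ∂(leb T), s₂ t ^ 2 = ∑ j, k₂ j t ^ 2)
    (hprod : ∀ᵐ t ∂(leb T), h t ^ 2 = s₁ t * s₂ t)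
    -- `r₁ = s(h, s(K₁))` and `r₂ = s(h, s(K₂))`
    (r₁ r₂ : ℝ → ℝ) (hr₁ : MemLp r₁ ∞ (leb T)) (hr₂ : MemLp r₂ ∞ (leb T))
    (hr₁' : ∀ᵐ t ∂(leb T), r₁ t ^ 2 = h t ^ 2 + s₁ t ^ 2)
    (hr₂' : ∀ᵐ t ∂(leb T), r₂ t ^ 2 = h t ^ 2 + s₂ t ^ 2)
    (p : ℝ) (hp : p ∈ Set.Icc (1 : ℝ) 2) (q : ℝ) (hq : q ≠ 0) :
    -- the right-hand side exists
    (∃ C, MemS φ C ∧ IsGFFT m φ p q h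
      (fun x => F ((Real.sqrt 2)⁻¹ • x) * G ((Real.sqrt 2)⁻¹ • x)) C) ∧
    -- and each of the three convolution products exists and is s-a.e. equal to it
    ∀ C, IsGFFT m φ p q h (fun x => F ((Real.sqrt 2)⁻¹ • x) * G ((Real.sqrt 2)⁻¹ • x)) C →
      GCPOfIterGFFT m φ p q (-q) s₁ s₂
        (List.ofFn (fun j => (Real.sqrt 2)⁻¹ • k₁ j) ++ [(Real.sqrt 2)⁻¹ • h])
        (List.ofFn (fun j => (Real.sqrt 2)⁻¹ • k₂ j) ++ [(Real.sqrt 2)⁻¹ • h]) F G C ∧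
      GCPOfIterGFFT m φ p q (-q) s₁ s₂
        [(Real.sqrt 2)⁻¹ • s₁, (Real.sqrt 2)⁻¹ • h]
        [(Real.sqrt 2)⁻¹ • s₂, (Real.sqrt 2)⁻¹ • h] F G C ∧
      GCPOfIterGFFT m φ p q (-q) s₁ s₂
        [(Real.sqrt 2)⁻¹ • r₁] [(Real.sqrt 2)⁻¹ • r₂] F G C := by
  obtain ⟨μ, _, a, ham, ha, ha1, hFa⟩ := hF.exists_isPWZRep hφ
  obtain ⟨ν, _, b, hbm, hb, hb1, hGb⟩ := hG.exists_isPWZRep hφ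
  have hFG := hFa.mul_halfSum hφ hGb
  have habm : Measurable fun z : L2 T × L2 T => a z.1 * b z.2 :=
    (ham.comp measurable_fst).mul (hbm.comp measurable_snd)
  have hab : Integrable (fun z : L2 T × L2 T => a z.1 * b z.2) (μ.prod ν) := ha.mul_prod hb
  have hN : Measurable fun z : L2 T × L2 T => ‖mulL hh.1 (halfSum z)‖ ^ 2 :=
    measurable_norm_mulL_sq hh.1 measurable_halfSum
  refine ⟨?_, fun C hC => ?_⟩
  · obtain ⟨C, hCS, hC⟩ := exists_memS_eq_pwzTransform hφ (integrable_twist habm hab hN q)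
      ((ae_prod_and ha1 hb1).mono fun z hz => by
        rw [norm_twist_feynmanInv, norm_mul, hz.1, hz.2, mul_one]) measurable_halfSum
    exact ⟨C, hCS, hFG.isGFFT hm hφ habm hab measurable_halfSum hh.1 hq p
      fun ρ _ => .of_forall fun y => hC (ρ • y)⟩
  -- Every version of the right-hand transform agrees s-a.e. with the explicit superposition, so for
  -- each pair of kernel lists only the sums of squares remain to be computed.
  · have hC' := hFG.sae_eq_of_isGFFT hm hφ habm hab measurable_halfSum hh.1 hq hp.1 hC
    have main := fun {L₁ L₂} => gcpOfIterGFFT_of_sqForms (L₁ := L₁) (L₂ := L₂) hm hφ hFa hGb ham ha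
      ha1 hbm hb hb1 hh.1 hs₁ hs₂ hprod hp.1 hq hC'
    refine ⟨main ?_ ?_ (sqForms_ofFn_append (fun j => (hk₁ j).1) hs₁')
      (sqForms_ofFn_append (fun j => (hk₂ j).1) hs₂'), main ?_ ?_ sqForms_pair sqForms_pair,
      main ?_ ?_ (sqForms_singleton hh.1 hs₁ hr₁') (sqForms_singleton hh.1 hs₂ hr₂')⟩
    all_goals
      intro k hk
      simp only [List.mem_append, List.mem_ofFn, List.mem_cons, List.not_mem_nil, or_false] at hk
      rcases hk with ⟨j, rfl⟩ | rfl
      all_goals first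
        | exact (hk₁ _).1.const_smul _
        | exact (hk₂ _).1.const_smul _
        | exact hh.1.const_smul _
        | exact hs₁.const_smul _
        | exact hs₂.const_smul _
        | exact hr₁.const_smul _
        | exact hr₂.const_smul _
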